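/- **Setting.** Let $0<T\le\breve T$, let $(\Omega,\mathcal F,(\mathcal F_t)_{t\ge0},\mathbb P)$ be a filtered probability space, $\mathbb E_T=\mathbb E[\,\cdot\,|\mathcal F_T]$, and let $W$ be an $m$-dimensional $(\mathcal F_t)$-Brownian motion. Let $K:\mathbb R_+^2\to\mathbb R^{d\times m}$ be a measurable kernel with $K(t,r)=0$ for $t<r$ and $\sup_{t\le\breve T}\int_0^t|K(t,r)|^2\,dr<\infty$, such that for some $C>0$, $H\in(0,1)$ and all $0\le t<s$ the derivative $\partial_sK(s,t)$ exists and $$|K(s,t)|\le C(s-t)^{H-\frac12},\qquad |\partial_sK(s,t)|\le C(s-t)^{H-\frac32}.$$ Let $\phi\in C^3(\mathbb R)$, where $\phi$ and its derivatives up to order $3$ have polynomial growth. Let $f:[0,\breve T]\times\mathbb R^d\to\mathbb R$ be measurable and let $\mathbb F$ be the set of $s\in[0,\breve T]$ such that $f_s\not\equiv0$. For $s\in\mathbb F$ let $f_s$ be $C^3$, where $f$ and its spatial derivatives up to order $3$ are jointly continuous on $\mathbb F\times\mathbb R^d$ and bounded there by $C_f\big(1+e^{\kappa_f s}\sum_{i=1}^d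 e^{\kappa_f x_i}\big)$ for some constants $C_f,\kappa_f>0$. For $0\le t\le b\le\breve T$ let $J^{t,b}_s=\mathbf 1_{\{t\le s\le\breve T\}}\int_t^{s\wedge b}K(s,r)\,dW_r$, taken in a version continuous on $[t,\breve T]$. For $t\in[0,T]$ and a path $\omega:[0,\breve T]\to\mathbb R^d$ that is the sum of a continuous path and of $\eta\mathbf 1_{[t,\breve T]}$ with $\eta\in C([t,\breve T],\mathbb R^d)$, put $$\mathfrak F(\omega)=\int_0^Tf_s(\omega_s)\,ds+\int_T^{\breve T}\mathbb E\big[f_s(\theta+J^{T,\breve T}_s)\big]\Big|_{\theta=\omega_s}ds,\qquad u(t,\omega)=\mathbb E\big[\phi\big(\mathfrak F(\omega+J^{t,T})\big)\big],$$ $$\widehat W^{t,\omega}_s=\omega_s+J^{t,\breve T}_s,\qquad V^{t,\omega}_T=\mathbb E_T\int_0^{\breve T}f_s(\widehat W^{t,\omega}_s)\,ds .$$ Let $\partial_\omega u(t,\omega)$ and $\partial^2_\omega u(t,\omega)$ be the first and second Fréchet derivatives at $0$ of $\eta\mapsto u(t,\omega+\eta\mathbf 1_{[t,\breve T]})$ on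 $C([t,\breve T],\mathbb R^d)$ with the supremum norm. For $\mathbb R^{d\times m}$-valued $\eta$ with columns $\eta^{(j)}$ put $\langle\partial_\omega u,\eta\rangle=(\langle\partial_\omega u,\eta^{(j)}\rangle)_{j\le m}$ and $\langle\partial_\omega^2u,(\eta,\eta)\rangle=\sum_{j\le m}\langle\partial^2_\omega u,(\eta^{(j)},\eta^{(j)})\rangle$. With $K^{\delta,t}(s)=K(s\vee(t+\delta),t)$ define $$\langle\partial_\omega u(t,\omega),K^t\rangle=\lim_{\delta\downarrow0}\langle\partial_\omega u(t,\omega),K^{\delta,t}\rangle,\qquad \langle\partial^2_\omega u(t,\omega),(K^t,K^t)\rangle=\lim_{\delta\downarrow0}\langle\partial^2_\omega u(t,\omega),(K^{\delta,t},K^{\delta,t})\rangle .$$ Finally let $\nabla$ and $\Delta$ denote gradient and Hessian in space, $\langle\nabla h(x),y\rangle=\nabla h(x)^\top y$ and $\langle\Delta h(x),(y,y)\rangle=\mathrm{Tr}(y^\top\Delta h(x)\,y)$ for $y\in\mathbb R^{d\times m}$. **Proposition.** For all $t\in[0,T]$ and $\omega\in C([0,\breve T],\mathbb R^d)$, the two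 Fréchet derivatives and the two limits exist, all integrals and expectations below are well defined, and $$\langle\partial_\omega u(t,\omega),K^t\rangle=\mathbb E\Big[\phi'(V^{t,\omega}_T)\int_t^{\breve T}\big\langle\nabla f_s(\widehat W^{t,\omega}_s),K(s,t)\big\rangle ds\Big],$$ $$\langle\partial^2_\omega u(t,\omega),(K^t,K^t)\rangle=\mathbb E\Big[\phi''(V^{t,\omega}_T)\,\Big|\mathbb E_T\int_t^{\breve T}\big\langle\nabla f_s(\widehat W^{t,\omega}_s),K(s,t)\big\rangle ds\Big|^2\Big]+\mathbb E\Big[\phi'(V^{t,\omega}_T)\int_t^{\breve T}\big\langle\Delta f_s(\widehat W^{t,\omega}_s),(K(s,t),K(s,t))\big\rangle ds\Big].$$ If $f_s\equiv0$ for all $s\in(T,\breve T]$ (in particular if $T=\breve T$), the inner conditional expectation $\mathbb E_T$ in the second formula can be omitted. -/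

import Mathlib

open MeasureTheory ProbabilityTheory Filter Set Topology
open scoped NNReal ENNReal Matrix

namespace VolDeriv

noncomputable section

/-- Frobenius norm of a `d × m` matrix. -/
def frobenius {d m : ℕ} (A : Matrix (Fin d) (Fin m) ℝ) : ℝ :=
  √(∑ i, ∑ j, (A i j) ^ 2)

/-! ### Brownian motion and the Wiener integral of a deterministic matrix-valued function -/

/-- `W` is an `m`-dimensional standard Brownian motion with respect to the filtration `𝓕`. -/
structure IsBrownianMotion {Ω : Type*} {mΩ : MeasurableSpace Ω} {m : ℕ} (P : Measure Ω)
    (𝓕 : Filtration ℝ≥0 mΩ) (W : ℝ≥0 → Ω → EuclideanSpace ℝ (Fin m)) : Prop where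
  adapted : Adapted 𝓕 W
  start : ∀ᵐ w ∂P, W 0 w = 0
  indep : ∀ s t : ℝ≥0, s ≤ t →
    Indep (MeasurableSpace.comap (fun w => W t w - W s w) inferInstance) (𝓕 s) P
  law : ∀ s t : ℝ≥0, s ≤ t →
    P.map (fun w => W t w - W s w) =
      (stdGaussian (EuclideanSpace ℝ (Fin m))).map (fun x => √((t : ℝ) - (s : ℝ)) • x)
  continuous : ∀ᵐ w ∂P, Continuous (fun t => W t w)

/-- A matrix-valued step function on the half-line, with coefficient `c i` on `(a i, b i]`. -/
structure StepFun (d m : ℕ) where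
  n : ℕ
  a : Fin n → ℝ≥0
  b : Fin n → ℝ≥0
  le : ∀ i, a i ≤ b i
  c : Fin n → Matrix (Fin d) (Fin m) ℝ

/-- The value of a step function at time `r`. -/
def StepFun.eval {d m : ℕ} (g : StepFun d m) (r : ℝ) : Matrix (Fin d) (Fin m) ℝ :=
  ∑ i, (Ioc (g.a i : ℝ) (g.b i : ℝ)).indicator (fun _ => g.c i) r

/-- The elementary stochastic integral `∑ cᵢ (W_{bᵢ} - W_{aᵢ})` of a step function. -/
def StepFun.integral {Ω : Type*} {d m : ℕ} (g : StepFun d m)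
    (W : ℝ≥0 → Ω → EuclideanSpace ℝ (Fin m)) (w : Ω) : EuclideanSpace ℝ (Fin d) :=
  ∑ i, WithLp.toLp 2 (g.c i *ᵥ (W (g.b i) w - W (g.a i) w).ofLp)

/-- `X = ∫₀^∞ h(r) dW_r` (Wiener integral, determined up to almost sure equality): there are step
functions converging to `h` in `L²([0,∞))` whose elementary integrals converge to `X` in
`L²(P)`. -/
def IsWienerIntegral {Ω : Type*} [MeasurableSpace Ω] {d m : ℕ} (P : Measure Ω)
    (W : ℝ≥0 → Ω → EuclideanSpace ℝ (Fin m)) (h : ℝ → Matrix (Fin d) (Fin m) ℝ)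
    (X : Ω → EuclideanSpace ℝ (Fin d)) : Prop :=
  ∃ g : ℕ → StepFun d m,
    Tendsto (fun k => ∫⁻ r in Ici (0 : ℝ), ENNReal.ofReal (frobenius ((g k).eval r - h r) ^ 2))
      atTop (𝓝 0) ∧
    Tendsto (fun k => eLpNorm (fun w => (g k).integral W w - X w) 2 P) atTop (𝓝 0)

/-! ### The kernel and the Gaussian Volterra processes -/

/-- Standing assumptions on the kernel: measurable, `K(t,r) = 0` for `t < r`, and
`sup_{t ∈ [0,Tb]} ∫₀ᵗ |K(t,r)|² dr < ∞`. -/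
structure IsVolterraKernel {d m : ℕ} (Tb : ℝ) (K : ℝ → ℝ → Matrix (Fin d) (Fin m) ℝ) : Prop where
  measurable : ∀ i j, Measurable (fun p : ℝ × ℝ => K p.1 p.2 i j)
  causal : ∀ t r, t < r → K t r = 0
  sq_integrable :
    (⨆ t ∈ Icc (0 : ℝ) Tb, ∫⁻ r in Icc 0 t, ENNReal.ofReal (frobenius (K t r) ^ 2)) < ∞

/-- Off the diagonal `∂ₛK(s,t)` exists, `|K(s,t)| ≤ C (s-t)^{H-1/2}` and
`|∂ₛK(s,t)| ≤ C (s-t)^{H-3/2}`, for some `C > 0` and `H ∈ (0,1)`. -/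
def KernelAssumption {d m : ℕ} (K : ℝ → ℝ → Matrix (Fin d) (Fin m) ℝ) : Prop :=
  ∃ C H : ℝ, 0 < C ∧ 0 < H ∧ H < 1 ∧ ∀ t s : ℝ, 0 ≤ t → t < s →
    (∀ i j, DifferentiableAt ℝ (fun r => K r t i j) s) ∧
    frobenius (K s t) ≤ C * (s - t) ^ (H - 1 / 2) ∧
    frobenius (Matrix.of fun i j => deriv (fun r => K r t i j) s) ≤ C * (s - t) ^ (H - 3 / 2)

/-- `J` is a continuous version of the process
`J_s = 1_{[t,Tb]}(s) ∫_t^{s ∧ b} K(s,r) dW_r`. For `b = Tb` this is the process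
`∫_t^s K(s,r) dW_r` on `[t,Tb]`. -/
structure IsVolterraIntegral {Ω : Type*} [MeasurableSpace Ω] {d m : ℕ} (P : Measure Ω)
    (W : ℝ≥0 → Ω → EuclideanSpace ℝ (Fin m)) (K : ℝ → ℝ → Matrix (Fin d) (Fin m) ℝ)
    (Tb t b : ℝ) (J : ℝ → Ω → EuclideanSpace ℝ (Fin d)) : Prop where
  measurable : ∀ s, Measurable (J s)
  zero_off : ∀ s, s ∉ Icc t Tb → ∀ w, J s w = 0
  wiener : ∀ s ∈ Icc t Tb,
    IsWienerIntegral P W ((Ioc t (min s b)).indicator (fun r => K s r)) (J s)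
  continuous : ∀ w, ContinuousOn (fun s => J s w) (Icc t Tb)

/-! ### Growth classes -/

/-- `g` has polynomial growth. -/
def PolyGrowth (g : ℝ → ℝ) : Prop :=
  ∃ C κ : ℝ, 0 < C ∧ 0 < κ ∧ ∀ x, |g x| ≤ C * (1 + |x| ^ κ)

/-- The class `Cⁿ_poly(ℝ)`. -/
def CPoly (n : ℕ) (g : ℝ → ℝ) : Prop :=
  ContDiff ℝ n g ∧ ∀ k ≤ n, PolyGrowth (iteratedDeriv k g)

/-- The set of times in `[0,Tb]` at which `f_s` is not identically zero. -/
def timeSupport {d : ℕ} (Tb : ℝ) (f : ℝ → EuclideanSpace ℝ (Fin d) → ℝ) : Set ℝ :=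
  {s | s ∈ Icc 0 Tb ∧ ∃ x, f s x ≠ 0}

/-- The class `C^{0,n}_exp(F × ℝᵈ)`: for times in `F`, `f_s` is `n` times continuously
differentiable in space, all spatial derivatives up to order `n` are jointly continuous on
`F × ℝᵈ` and bounded there by `C (1 + e^{κ s} ∑ᵢ e^{κ xᵢ})`. -/
def CExp {d : ℕ} (n : ℕ) (F : Set ℝ) (f : ℝ → EuclideanSpace ℝ (Fin d) → ℝ) : Prop :=
  (∀ s ∈ F, ContDiff ℝ n (f s)) ∧
  ∀ k ≤ n,
    ContinuousOn (fun p : ℝ × EuclideanSpace ℝ (Fin d) => iteratedFDeriv ℝ k (f p.1) p.2)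
      (F ×ˢ univ) ∧
    ∃ C κ : ℝ, 0 < C ∧ 0 < κ ∧ ∀ s ∈ F, ∀ x : EuclideanSpace ℝ (Fin d),
      ‖iteratedFDeriv ℝ k (f s) x‖ ≤ C * (1 + Real.exp (κ * s) * ∑ i, Real.exp (κ * x i))

/-! ### The value functional -/

/-- `𝔣_s(θ) = E[f_s(θ + I_s)]`, with `I_s = ∫_T^s K(s,r) dW_r`. -/
def frakf {Ω : Type*} [MeasurableSpace Ω] {d : ℕ} (P : Measure Ω)
    (f : ℝ → EuclideanSpace ℝ (Fin d) → ℝ) (I : ℝ → Ω → EuclideanSpace ℝ (Fin d))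
    (s : ℝ) (θ : EuclideanSpace ℝ (Fin d)) : ℝ :=
  ∫ w, f s (θ + I s w) ∂P

/-- `𝔉(ω) = ∫_0^T f_s(ω_s) ds + ∫_T^Tb 𝔣_s(ω_s) ds`. -/
def frakF {Ω : Type*} [MeasurableSpace Ω] {d : ℕ} (P : Measure Ω)
    (f : ℝ → EuclideanSpace ℝ (Fin d) → ℝ) (I : ℝ → Ω → EuclideanSpace ℝ (Fin d))
    (T Tb : ℝ) (ω : ℝ → EuclideanSpace ℝ (Fin d)) : ℝ :=
  (∫ s in (0 : ℝ)..T, f s (ω s)) + ∫ s in T..Tb, frakf P f I s (ω s)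

/-- The option price `u(t,ω) = E[φ(𝔉(ω + J^{t,T}))]`, where `J t b` is the process
`s ↦ 1_{[t,Tb]}(s) ∫_t^{s ∧ b} K(s,r) dW_r`. Only the values of `ω` on `[0,Tb]` matter. -/
def value {Ω : Type*} [MeasurableSpace Ω] {d : ℕ} (P : Measure Ω)
    (f : ℝ → EuclideanSpace ℝ (Fin d) → ℝ) (φ : ℝ → ℝ)
    (J : ℝ → ℝ → ℝ → Ω → EuclideanSpace ℝ (Fin d))
    (T Tb t : ℝ) (ω : ℝ → EuclideanSpace ℝ (Fin d)) : ℝ :=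
  ∫ w, φ (frakF P f (J T Tb) T Tb (fun s => ω s + J t T s w)) ∂P

/-- `Ŵ^{t,ω}_s = ω_s + ∫_t^s K(s,r) dW_r` for `s ≥ t`, and `ω_s` for `s < t`. -/
def shiftedProcess {Ω : Type*} {d : ℕ} (J : ℝ → ℝ → ℝ → Ω → EuclideanSpace ℝ (Fin d))
    (Tb t : ℝ) (ω : ℝ → EuclideanSpace ℝ (Fin d)) (s : ℝ) (w : Ω) : EuclideanSpace ℝ (Fin d) :=
  ω s + J t Tb s w

/-- `V^{t,ω}_T = E[∫_0^Tb f_s(Ŵ^{t,ω}_s) ds | 𝓕_T]`. -/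
def payoffVar {Ω : Type*} {mΩ : MeasurableSpace Ω} {d : ℕ} (P : Measure Ω)
    (𝓕 : Filtration ℝ≥0 mΩ) (f : ℝ → EuclideanSpace ℝ (Fin d) → ℝ)
    (J : ℝ → ℝ → ℝ → Ω → EuclideanSpace ℝ (Fin d))
    (T Tb t : ℝ) (ω : ℝ → EuclideanSpace ℝ (Fin d)) : Ω → ℝ :=
  P[fun w => ∫ s in (0 : ℝ)..Tb, f s (shiftedProcess J Tb t ω s w) | 𝓕 T.toNNReal]

/-! ### Pathwise derivatives -/

/-- `ω + η 1_{[t,Tb]}` for `η ∈ C([t,Tb], ℝᵈ)`. -/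
def perturb {d : ℕ} {t Tb : ℝ} (ω : ℝ → EuclideanSpace ℝ (Fin d))
    (η : C(Icc t Tb, EuclideanSpace ℝ (Fin d))) : ℝ → EuclideanSpace ℝ (Fin d) :=
  open scoped Classical in
  fun s => ω s + if h : s ∈ Icc t Tb then η ⟨s, h⟩ else 0

/-- The functional `v` of a path is Fréchet differentiable at `ω` along directions in
`C([t,Tb], ℝᵈ)` (with the supremum norm). -/
def PathDifferentiableAt {d : ℕ} {G : Type*} [NormedAddCommGroup G] [NormedSpace ℝ G]
    (t Tb : ℝ) (v : (ℝ → EuclideanSpace ℝ (Fin d)) → G)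
    (ω : ℝ → EuclideanSpace ℝ (Fin d)) : Prop :=
  DifferentiableAt ℝ (fun η : C(Icc t Tb, EuclideanSpace ℝ (Fin d)) => v (perturb ω η)) 0

/-- The Fréchet derivative of `v` at `ω` along directions in `C([t,Tb], ℝᵈ)`. For `v = u(t,·)`
this is `∂_ω u(t,ω)`, and taking it twice gives `∂²_ω u(t,ω)`. -/
def pathDeriv {d : ℕ} {G : Type*} [NormedAddCommGroup G] [NormedSpace ℝ G]
    (t Tb : ℝ) (v : (ℝ → EuclideanSpace ℝ (Fin d)) → G) (ω : ℝ → EuclideanSpace ℝ (Fin d)) :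
    C(Icc t Tb, EuclideanSpace ℝ (Fin d)) →L[ℝ] G :=
  fderiv ℝ (fun η : C(Icc t Tb, EuclideanSpace ℝ (Fin d)) => v (perturb ω η)) 0

/-- The `j`-th column of `K(s,t)`, as a vector of `ℝᵈ`. -/
def kernelCol {d m : ℕ} (K : ℝ → ℝ → Matrix (Fin d) (Fin m) ℝ) (t : ℝ) (j : Fin m) (s : ℝ) :
    EuclideanSpace ℝ (Fin d) :=
  WithLp.toLp 2 (fun i => K s t i j)

/-- The `j`-th column of the truncated kernel `s ↦ K(s ∨ (t+δ), t)`, as an element of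
`C([t,Tb], ℝᵈ)`. It is continuous for `δ > 0`, see `truncCol_apply`; `mkD` would give `0`
otherwise. -/
def truncCol {d m : ℕ} (K : ℝ → ℝ → Matrix (Fin d) (Fin m) ℝ) (Tb t δ : ℝ) (j : Fin m) :
    C(Icc t Tb, EuclideanSpace ℝ (Fin d)) :=
  ContinuousMap.mkD (fun s : Icc t Tb => kernelCol K t j (max (s : ℝ) (t + δ))) 0

theorem truncCol_apply {d m : ℕ} {K : ℝ → ℝ → Matrix (Fin d) (Fin m) ℝ}
    (hK : KernelAssumption K) {Tb t δ : ℝ} (ht : 0 ≤ t) (hδ : 0 < δ) (j : Fin m)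
    (s : Icc t Tb) :
    truncCol K Tb t δ j s = kernelCol K t j (max (s : ℝ) (t + δ)) := by
  obtain ⟨C, H, -, -, -, h⟩ := hK
  have hc : Continuous
      (fun s : Icc t Tb => kernelCol K t j (max (s : ℝ) (t + δ))) := by
    refine (PiLp.continuous_toLp 2 _).comp (continuous_pi fun i => ?_)
    rw [continuous_iff_continuousAt]
    intro s
    have hlt : t < max (s : ℝ) (t + δ) := lt_of_lt_of_le (by linarith) (le_max_right _ _)
    have h1 : ContinuousAt (fun r => K r t i j) (max (s : ℝ) (t + δ)) :=
      ((h t _ ht hlt).1 i j).continuousAt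
    have h2 : ContinuousAt (fun s : Icc t Tb => max (s : ℝ) (t + δ)) s := by fun_prop
    exact ContinuousAt.comp (f := fun s : Icc t Tb => max (s : ℝ) (t + δ)) h1 h2
  exact ContinuousMap.mkD_apply_of_continuous hc

/-! ### The integrals appearing in the formulae -/

/-- The integrand `⟨∇f_s(Ŵ^{t,ω}_s), K^{(j)}(s,t)⟩`, `K^{(j)}` being the `j`-th column. -/
def gradTerm {Ω : Type*} {d m : ℕ} (K : ℝ → ℝ → Matrix (Fin d) (Fin m) ℝ)
    (f : ℝ → EuclideanSpace ℝ (Fin d) → ℝ) (J : ℝ → ℝ → ℝ → Ω → EuclideanSpace ℝ (Fin d))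
    (Tb t : ℝ) (ω : ℝ → EuclideanSpace ℝ (Fin d)) (j : Fin m) (w : Ω) (s : ℝ) : ℝ :=
  fderiv ℝ (f s) (shiftedProcess J Tb t ω s w) (kernelCol K t j s)

/-- The integrand `Tr(K(s,t)ᵀ D²f_s(Ŵ^{t,ω}_s) K(s,t))`, written as a sum over the columns of
`K(s,t)`. -/
def hessTerm {Ω : Type*} {d m : ℕ} (K : ℝ → ℝ → Matrix (Fin d) (Fin m) ℝ)
    (f : ℝ → EuclideanSpace ℝ (Fin d) → ℝ) (J : ℝ → ℝ → ℝ → Ω → EuclideanSpace ℝ (Fin d))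
    (Tb t : ℝ) (ω : ℝ → EuclideanSpace ℝ (Fin d)) (w : Ω) (s : ℝ) : ℝ :=
  ∑ j : Fin m, fderiv ℝ (fderiv ℝ (f s)) (shiftedProcess J Tb t ω s w)
    (kernelCol K t j s) (kernelCol K t j s)

/-- The `j`-th component of `∫_t^Tb ⟨∇f_s(Ŵ^{t,ω}_s), K(s,t)⟩ ds`. -/
def gradInt {Ω : Type*} {d m : ℕ} (K : ℝ → ℝ → Matrix (Fin d) (Fin m) ℝ)
    (f : ℝ → EuclideanSpace ℝ (Fin d) → ℝ) (J : ℝ → ℝ → ℝ → Ω → EuclideanSpace ℝ (Fin d))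
    (Tb t : ℝ) (ω : ℝ → EuclideanSpace ℝ (Fin d)) (j : Fin m) (w : Ω) : ℝ :=
  ∫ s in t..Tb, gradTerm K f J Tb t ω j w s

/-- `∫_t^Tb Tr(K(s,t)ᵀ D²f_s(Ŵ^{t,ω}_s) K(s,t)) ds`. -/
def hessInt {Ω : Type*} {d m : ℕ} (K : ℝ → ℝ → Matrix (Fin d) (Fin m) ℝ)
    (f : ℝ → EuclideanSpace ℝ (Fin d) → ℝ) (J : ℝ → ℝ → ℝ → Ω → EuclideanSpace ℝ (Fin d))
    (Tb t : ℝ) (ω : ℝ → EuclideanSpace ℝ (Fin d)) (w : Ω) : ℝ :=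
  ∫ s in t..Tb, hessTerm K f J Tb t ω w s

end

end VolDeriv

/-! Averaging out the noise after time `T` turns the value into a single expectation. Put g_s(x) =
E[f_s(x + J^{T,Tb}_s)]. Since J^{T,Tb} vanishes before `T`, g_s = f_s there, and 𝔉 is the one
integral of g over (0,Tb] (`frakF_eq`). Hence u(t,ω) = E[φ(G)] with G = ∫ g_s(X_s) ds and X = ω +
J^{t,T}. The chain rule suggests E[φ'(G) ∫ ∇g_s(X_s) η_s ds] as first derivative, and as second
derivative a φ'' term with the squared gradient integral plus a φ' term with the Hessian integral.

These are justified by explicit quadratic remainders. A `TaylorFamily` is a function with candidates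
for its first two derivatives, exponential growth and remainder bounds. Such bounds survive
averaging over J^{T,Tb} (`TaylorFamily.average`), so smoothness of g itself is never needed.
Integrated in time and composed with φ (`PolyBounded.abs_taylor_le`,
`PolyBounded.abs_taylor_mul_le`), they give a remainder equal to ‖η‖² times a polynomial in ∫ C
e^{κ‖X_s‖} ds. All powers of this integral have finite mean: Wiener integrals inherit Gaussian
exponential moments from step functions by Fatou (`IsWienerIntegral.lintegral_exp_inner_le`), and
Jensen moves the power inside the time integral (`pow_integral_le_of_weight`).

The formulae still make sense for a singular direction bounded by some α with α and α² integrable.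
Powers (s-t)^{H-1/2} qualify because H > 0, and one α serves the kernel and all its truncations
(`KernelAssumption.exists_bound`). Dominated convergence, in time and then on Ω, gives the limits.

It remains to return from g and X to f and Ŵ. At each time Ŵ = X + J^{T,Tb} almost surely, where X
is known at time `T` up to null sets and J^{T,Tb} is independent of 𝓕_T. The freezing lemma together
with a Fubini theorem for conditional expectations (`condExp_integral_comp`) shows that E_T of a
time integral along Ŵ is the time integral of the averaged integrand along X. For f this says V = G.
In terms linear in the time integral, E_T disappears because φ'(V) is 𝓕_T-measurable
(`integral_deriv_mul_integral`). In the squared term it stays, unless the gradient integral is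
already known at time `T`, as happens when f vanishes afterwards. -/

namespace VolDeriv

/-! ### Step functions on monotone grids, and the Frobenius norm. -/

section StepFunctions

/-- A finite set of times is the range of a monotone sequence. -/
theorem exists_monotone_grid (S : Finset ℝ≥0) (hS : S.Nonempty) :
    ∃ (N : ℕ) (p : ℕ → ℝ≥0), Monotone p ∧ (∀ k, p k ∈ S) ∧ ∀ x ∈ S, ∃ k ≤ N, p k = x := by
  have hc : 0 < S.card := hS.card_pos
  let e := S.orderEmbOfFin rfl
  -- The increasing enumeration of the set, frozen at its last element so as to be defined on all of
  -- ℕ.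
  refine ⟨S.card, fun k => e ⟨min k (S.card - 1), by omega⟩, ?_, ?_, ?_⟩
  · intro i j hij
    apply e.monotone
    simp only [Fin.mk_le_mk]
    omega
  · intro k
    exact Finset.orderEmbOfFin_mem S rfl _
  · intro x hx
    have : x ∈ Set.range e := by
      rw [Finset.range_orderEmbOfFin]
      exact hx
    obtain ⟨i, hi⟩ := this
    refine ⟨i, i.2.le, ?_⟩
    rw [← hi]
    have hi2 : min (i : ℕ) (S.card - 1) = i := by
      have := i.2
      omega
    exact congrArg e (Fin.ext hi2)

/-- Every step function is a step function on consecutive intervals of a monotone grid, with the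
same elementary integral. -/
theorem StepFun.exists_grid {d m : ℕ} (g : StepFun d m) {s : ℝ≥0} (hs : ∀ i, s ≤ g.a i) :
    ∃ (N : ℕ) (p : ℕ → ℝ≥0) (v : ℕ → Matrix (Fin d) (Fin m) ℝ), Monotone p ∧ s ≤ p 0 ∧
      (∀ r, g.eval r = ∑ k ∈ Finset.range N,
        (Ioc (p k : ℝ) (p (k + 1))).indicator (fun _ => v k) r) ∧
      ∀ F : ℝ≥0 → EuclideanSpace ℝ (Fin m),
        (∑ i, WithLp.toLp 2 (g.c i *ᵥ (F (g.b i) - F (g.a i)).ofLp) :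
          EuclideanSpace ℝ (Fin d)) = ∑ k ∈ Finset.range N,
            WithLp.toLp 2 (v k *ᵥ (F (p (k + 1)) - F (p k)).ofLp) := by
  classical
  obtain ⟨N, p, hp, hpS, hex⟩ := exists_monotone_grid
    (insert s (Finset.univ.image g.a ∪ Finset.univ.image g.b)) (Finset.insert_nonempty _ _)
  have hab : ∀ i, ∃ α β : ℕ, α ≤ β ∧ β ≤ N ∧ p α = g.a i ∧ p β = g.b i := by
    intro i
    obtain ⟨α, hαN, hα⟩ := hex (g.a i) (by simp)
    obtain ⟨β, hβN, hβ⟩ := hex (g.b i) (by simp)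
    rcases le_total α β with h | h
    · exact ⟨α, β, h, hβN, hα, hβ⟩
    -- If the indices come in the wrong order, monotonicity of the grid forces the interval to be
    -- empty, and one index serves for both endpoints.
    · refine ⟨α, α, le_rfl, hαN, hα, ?_⟩
      have h1 := hp h
      have h2 := g.le i
      rw [hα, hβ] at h1
      rw [hα]
      exact le_antisymm h2 h1
  choose α β hαβ hβN hα hβ using hab
  have tele : ∀ {M : Type _} [AddCommGroup M] (F : ℝ≥0 → M) (i : Fin g.n),
      F (g.b i) - F (g.a i) = ∑ k ∈ Finset.range N,
        if k ∈ Finset.Ico (α i) (β i) then F (p (k + 1)) - F (p k) else 0 := by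
    intro M _ F i
    rw [← Finset.sum_filter, Finset.filter_mem_eq_inter, Finset.inter_eq_right.2,
      Finset.sum_Ico_sub (fun k => F (p k)) (hαβ i), hα, hβ]
    intro k hk
    have := hβN i
    simp only [Finset.mem_Ico, Finset.mem_range] at hk ⊢
    omega
  -- The indicator of (a,b] is an increment of x ↦ 1_{r ≤ x}, so the telescoping sum `tele` handles
  -- evaluation and integration alike.
  have hind : ∀ (a b : ℝ≥0) (_ : a ≤ b) (c : Matrix (Fin d) (Fin m) ℝ) (r : ℝ),
      (Ioc (a : ℝ) b).indicator (fun _ => c) r =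
        ((if r ≤ b then (1 : ℝ) else 0) - (if r ≤ a then (1 : ℝ) else 0)) • c := by
    intro a b hab c r
    have hab' : (a : ℝ) ≤ b := by exact_mod_cast hab
    by_cases h1 : r ≤ a
    · have h2 : r ≤ b := h1.trans hab'
      simp [h1, h2, indicator]
    · by_cases h2 : r ≤ b <;> simp [h1, h2, indicator, not_le.1 h1]
  refine ⟨N, p, fun k => ∑ i, if k ∈ Finset.Ico (α i) (β i) then g.c i else 0, hp, ?_, ?_, ?_⟩
  · have := hpS 0
    simp only [Finset.mem_insert, Finset.mem_union, Finset.mem_image, Finset.mem_univ,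
      true_and] at this
    rcases this with h | ⟨i, h⟩ | ⟨i, h⟩
    · exact h.ge
    · exact h ▸ hs i
    · exact h ▸ (hs i).trans (g.le i)
  · intro r
    unfold StepFun.eval
    simp_rw [hind _ _ (g.le _), hind _ _ (hp (Nat.le_succ _))]
    rw [Finset.sum_congr rfl fun i _ => by
      rw [tele (fun x : ℝ≥0 => if r ≤ (x : ℝ) then (1 : ℝ) else 0) i, Finset.sum_smul]]
    rw [Finset.sum_comm]
    refine Finset.sum_congr rfl fun k _ => ?_
    rw [Finset.smul_sum]
    refine Finset.sum_congr rfl fun i _ => ?_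
    split_ifs <;> simp
  · intro F
    rw [Finset.sum_congr rfl fun i _ => by rw [tele F i]]
    simp_rw [Matrix.sum_mulVec, WithLp.ofLp_sum, Matrix.mulVec_sum, WithLp.toLp_sum]
    rw [Finset.sum_comm]
    refine Finset.sum_congr rfl fun k _ => ?_
    refine Finset.sum_congr rfl fun i _ => ?_
    split_ifs <;> simp

/-- `s ↦ h(s)ᵀ ξ`. -/
noncomputable def dualVec {d m : ℕ} (A : Matrix (Fin d) (Fin m) ℝ) (ξ : EuclideanSpace ℝ (Fin d)) :
    EuclideanSpace ℝ (Fin m) :=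
  WithLp.toLp 2 (Aᵀ *ᵥ ξ.ofLp)

theorem inner_mulVec {d m : ℕ} (A : Matrix (Fin d) (Fin m) ℝ) (ξ : EuclideanSpace ℝ (Fin d))
    (x : EuclideanSpace ℝ (Fin m)) :
    inner ℝ ξ (WithLp.toLp 2 (A *ᵥ x.ofLp)) = inner ℝ (dualVec A ξ) x := by
  simp only [dualVec, PiLp.inner_apply, Matrix.mulVec, dotProduct, Matrix.transpose_apply,
    RCLike.inner_apply, conj_trivial, Finset.sum_mul, Finset.mul_sum]
  rw [Finset.sum_comm]
  refine Finset.sum_congr rfl fun i _ => Finset.sum_congr rfl fun j _ => by ring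

theorem frobenius_nonneg {d m : ℕ} (A : Matrix (Fin d) (Fin m) ℝ) : 0 ≤ frobenius A :=
  Real.sqrt_nonneg _

theorem frobenius_sq {d m : ℕ} (A : Matrix (Fin d) (Fin m) ℝ) :
    frobenius A ^ 2 = ∑ i, ∑ j, (A i j) ^ 2 :=
  Real.sq_sqrt (Finset.sum_nonneg fun _ _ => Finset.sum_nonneg fun _ _ => sq_nonneg _)

theorem norm_dualVec_single_sq {d m : ℕ} (A : Matrix (Fin d) (Fin m) ℝ) (i : Fin d) :
    ‖dualVec A (EuclideanSpace.single i 1)‖ ^ 2 = ∑ j, (A i j) ^ 2 := by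
  rw [EuclideanSpace.norm_sq_eq]
  refine Finset.sum_congr rfl fun j _ => ?_
  simp [dualVec]

theorem frobenius_sq_eq_sum {d m : ℕ} (A : Matrix (Fin d) (Fin m) ℝ) :
    frobenius A ^ 2 = ∑ i, ‖dualVec A (EuclideanSpace.single i 1)‖ ^ 2 := by
  simp_rw [norm_dualVec_single_sq, frobenius_sq]

theorem norm_dualVec_le {d m : ℕ} (A : Matrix (Fin d) (Fin m) ℝ) (ξ : EuclideanSpace ℝ (Fin d)) :
    ‖dualVec A ξ‖ ^ 2 ≤ ‖ξ‖ ^ 2 * frobenius A ^ 2 := by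
  rw [EuclideanSpace.norm_sq_eq, EuclideanSpace.norm_sq_eq, frobenius_sq, Finset.sum_comm,
    Finset.mul_sum]
  refine Finset.sum_le_sum fun j _ => ?_
  simp only [dualVec, Matrix.mulVec, dotProduct, Matrix.transpose_apply, Real.norm_eq_abs, sq_abs]
  have := Finset.sum_mul_sq_le_sq_mul_sq Finset.univ (fun i => A i j) (fun i => ξ i)
  linarith

theorem measurable_frobenius {α : Type*} [MeasurableSpace α] {d m : ℕ}
    {h : α → Matrix (Fin d) (Fin m) ℝ} (hh : ∀ i j, Measurable fun r => h r i j) :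
    Measurable fun r => frobenius (h r) := by
  unfold frobenius
  fun_prop

theorem frobenius_sq_add_le {d m : ℕ} (A B : Matrix (Fin d) (Fin m) ℝ) :
    frobenius (A + B) ^ 2 ≤ 2 * frobenius A ^ 2 + 2 * frobenius B ^ 2 := by
  simp_rw [frobenius_sq, Finset.mul_sum, ← Finset.sum_add_distrib]
  refine Finset.sum_le_sum fun i _ => Finset.sum_le_sum fun j _ => ?_
  simp only [Matrix.add_apply]
  nlinarith [sq_nonneg (A i j - B i j)]

theorem frobenius_neg {d m : ℕ} (A : Matrix (Fin d) (Fin m) ℝ) :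
    frobenius (-A) = frobenius A := by
  simp [frobenius]

@[simp] theorem frobenius_zero {d m : ℕ} : frobenius (0 : Matrix (Fin d) (Fin m) ℝ) = 0 := by
  simp [frobenius]

theorem dualVec_add {d m : ℕ} (A B : Matrix (Fin d) (Fin m) ℝ) (ξ : EuclideanSpace ℝ (Fin d)) :
    dualVec (A + B) ξ = dualVec A ξ + dualVec B ξ := by
  ext j
  simp [dualVec, Matrix.transpose_add, Matrix.add_mulVec]

/-- The grid intervals are disjoint, so at most one summand is nonzero at each time and there are no
cross terms. -/
theorem norm_sq_grid {m : ℕ} {p : ℕ → ℝ≥0} (hp : Monotone p) (u : ℕ → EuclideanSpace ℝ (Fin m))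
    (N : ℕ) (r : ℝ) :
    ‖∑ k ∈ Finset.range N, (Ioc (p k : ℝ) (p (k + 1))).indicator (fun _ => u k) r‖ ^ 2 =
      ∑ k ∈ Finset.range N, (Ioc (p k : ℝ) (p (k + 1))).indicator (fun _ => ‖u k‖ ^ 2) r := by
  induction N with
  | zero => simp
  | succ N ih =>
    rw [Finset.sum_range_succ, Finset.sum_range_succ]
    by_cases hr : r ≤ p N
    · have h0 : r ∉ Ioc (p N : ℝ) (p (N + 1)) := fun h => absurd h.1 (not_lt.2 hr)
      simp [h0, ih]
    · have hz : ∀ k ∈ Finset.range N, r ∉ Ioc (p k : ℝ) (p (k + 1)) := by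
        intro k hk h
        have h1 : (p (k + 1) : ℝ) ≤ p N := by
          exact_mod_cast hp (by simpa using Finset.mem_range.1 hk)
        exact hr (h.2.trans h1)
      rw [Finset.sum_eq_zero fun k hk => indicator_of_notMem (hz k hk) _,
        Finset.sum_eq_zero fun k hk => indicator_of_notMem (hz k hk) _]
      by_cases h0 : r ∈ Ioc (p N : ℝ) (p (N + 1)) <;> simp [h0]

theorem measurable_stepFun_eval {d m : ℕ} (g : StepFun d m) (i : Fin d) (j : Fin m) :
    Measurable fun r => g.eval r i j := by
  have : (fun r => g.eval r i j) = fun r => ∑ k,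
      (Ioc (g.a k : ℝ) (g.b k : ℝ)).indicator (fun _ => g.c k i j) r := by
    funext r
    rw [StepFun.eval, Matrix.sum_apply]
    refine Finset.sum_congr rfl fun k _ => ?_
    by_cases h : r ∈ Ioc (g.a k : ℝ) (g.b k : ℝ) <;> simp [h]
  rw [this]
  exact Finset.measurable_fun_sum _ fun k _ => measurable_const.indicator measurableSet_Ioc

end StepFunctions

/-! ### Gaussian law and isometry of elementary integrals. -/

section WienerSteps

variable {Ω : Type*} {mΩ : MeasurableSpace Ω} {P : Measure Ω} {𝓕 : Filtration ℝ≥0 mΩ} {d m : ℕ}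
  {W : ℝ≥0 → Ω → EuclideanSpace ℝ (Fin m)}

theorem IsBrownianMotion.measurable (hW : IsBrownianMotion P 𝓕 W) (t : ℝ≥0) : Measurable (W t) :=
  (hW.adapted t).mono (𝓕.le t) le_rfl

theorem IsBrownianMotion.integral_exp_increment (hW : IsBrownianMotion P 𝓕 W) {s t : ℝ≥0}
    (hst : s ≤ t) (v : EuclideanSpace ℝ (Fin m)) :
    ∫ w, Complex.exp ((inner ℝ v (W t w - W s w) : ℝ) * Complex.I) ∂P =
      Complex.exp (-((‖v‖ ^ 2 * (t - s) : ℝ) : ℂ) / 2) := by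
  have h1 : ∫ w, Complex.exp ((inner ℝ v (W t w - W s w) : ℝ) * Complex.I) ∂P =
      charFun (P.map (fun w => W t w - W s w)) v := by
    rw [charFun_apply, integral_map]
    · simp_rw [real_inner_comm]
    · exact ((hW.measurable t).sub (hW.measurable s)).aemeasurable
    · exact Continuous.aestronglyMeasurable (by fun_prop)
  have hst' : (0 : ℝ) ≤ t - s := sub_nonneg.2 (by exact_mod_cast hst)
  rw [h1, hW.law s t hst, charFun_map_smul, charFun_stdGaussian, norm_smul]
  congr 2
  have : (‖√((t : ℝ) - s)‖ * ‖v‖) ^ 2 = ‖v‖ ^ 2 * (t - s) := by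
    rw [mul_pow, Real.norm_eq_abs, sq_abs, Real.sq_sqrt hst', mul_comm]
  rw [← this]
  push_cast
  ring

/-- The characteristic function of a sum of increments after time `s`, on an event of `𝓕 s`. -/
theorem IsBrownianMotion.setIntegral_exp_increments [IsProbabilityMeasure P]
    (hW : IsBrownianMotion P 𝓕 W) {s : ℝ≥0} {p : ℕ → ℝ≥0} (hp : Monotone p) (hs : s ≤ p 0)
    (v : ℕ → EuclideanSpace ℝ (Fin m)) {A : Set Ω} (hA : MeasurableSet[𝓕 s] A) (N : ℕ) :
    ∫ w in A, Complex.exp ((∑ k ∈ Finset.range N,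
        inner ℝ (v k) (W (p (k + 1)) w - W (p k) w) : ℝ) * Complex.I) ∂P =
      P.real A * Complex.exp (-((∑ k ∈ Finset.range N,
        ‖v k‖ ^ 2 * ((p (k + 1) : ℝ) - p k) : ℝ) : ℂ) / 2) := by
  induction N with
  | zero => simp
  | succ N ih =>
    have hAm : MeasurableSet A := 𝓕.le s A hA
    have hmeas : ∀ k ≤ N, Measurable[𝓕 (p N)] (W (p k)) := fun k hk =>
      (hW.adapted (p k)).mono (𝓕.mono (hp hk)) le_rfl
    -- The past increments together with the indicator of `A` form an 𝓕(p N)-measurable factor, as s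
    -- ≤ p 0 ≤ p N. The last increment is independent of it, so the expectation factorises.
    let X : Ω → ℂ := A.indicator fun w => Complex.exp ((∑ k ∈ Finset.range N,
        inner ℝ (v k) (W (p (k + 1)) w - W (p k) w) : ℝ) * Complex.I)
    let Y : Ω → ℂ := fun w =>
      Complex.exp ((inner ℝ (v N) (W (p (N + 1)) w - W (p N) w) : ℝ) * Complex.I)
    have hX : Measurable[𝓕 (p N)] X := by
      refine Measurable.indicator ?_ (𝓕.mono (hs.trans (hp (Nat.zero_le N))) A hA)
      have : Measurable[𝓕 (p N)] fun w => ∑ k ∈ Finset.range N,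
          inner ℝ (v k) (W (p (k + 1)) w - W (p k) w) := by
        refine Finset.measurable_fun_sum _ fun k hk => ?_
        have hk' := Finset.mem_range.1 hk
        exact Measurable.inner measurable_const ((hmeas (k + 1) hk').sub (hmeas k hk'.le))
      exact Complex.measurable_exp.comp ((Complex.measurable_ofReal.comp this).mul_const _)
    have hXY : IndepFun Y X P := by
      have h0 := hW.indep (p N) (p (N + 1)) (hp (Nat.le_add_right N 1))
      refine (indep_of_indep_of_le_left (indep_of_indep_of_le_right h0 hX.comap_le) ?_ :
        Indep (MeasurableSpace.comap Y _) _ P)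
      have : Y = (fun x => Complex.exp ((inner ℝ (v N) x : ℝ) * Complex.I)) ∘
          fun w => W (p (N + 1)) w - W (p N) w := rfl
      rw [this, ← MeasurableSpace.comap_comp]
      refine MeasurableSpace.comap_mono (Measurable.comap_le ?_)
      exact Continuous.measurable (by fun_prop)
    have hXm : Measurable X := hX.mono (𝓕.le _) le_rfl
    have hYm : Measurable Y := by
      have := ((hW.measurable (p (N + 1))).sub (hW.measurable (p N)))
      exact Complex.measurable_exp.comp ((Complex.measurable_ofReal.comp
        (Measurable.inner measurable_const this)).mul_const _)
    have key := hXY.integral_fun_mul_eq_mul_integral hYm.aestronglyMeasurable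
      hXm.aestronglyMeasurable
    have hXi : ∫ w, X w ∂P = _ := (integral_indicator hAm).trans ih
    rw [hW.integral_exp_increment (hp (Nat.le_add_right N 1)), hXi] at key
    rw [← integral_indicator hAm]
    have hL : (A.indicator fun w => Complex.exp ((∑ k ∈ Finset.range (N + 1),
        inner ℝ (v k) (W (p (k + 1)) w - W (p k) w) : ℝ) * Complex.I)) = fun w => Y w * X w := by
      funext w
      by_cases hw : w ∈ A
      · simp only [X, Y, hw, indicator_of_mem, Finset.sum_range_succ]
        rw [← Complex.exp_add]
        push_cast
        ring_nf
      · simp [X, hw]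
    rw [hL, key, Finset.sum_range_succ, mul_left_comm, ← Complex.exp_add]
    push_cast
    ring_nf

/-- The quadratic form `∫ ‖g(r)ᵀ ξ‖² dr` of a step function. -/
noncomputable def StepFun.energy (g : StepFun d m) (ξ : EuclideanSpace ℝ (Fin d)) : ℝ :=
  ∫ r in Ici (0 : ℝ), ‖dualVec (g.eval r) ξ‖ ^ 2

theorem dualVec_sum {ι : Type*} (s : Finset ι) (A : ι → Matrix (Fin d) (Fin m) ℝ)
    (ξ : EuclideanSpace ℝ (Fin d)) : dualVec (∑ k ∈ s, A k) ξ = ∑ k ∈ s, dualVec (A k) ξ := by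
  classical
  induction s using Finset.induction_on with
  | empty => ext; simp [dualVec]
  | insert a s ha ih => rw [Finset.sum_insert ha, Finset.sum_insert ha, dualVec_add, ih]

theorem dualVec_indicator (s : Set ℝ) (A : Matrix (Fin d) (Fin m) ℝ)
    (ξ : EuclideanSpace ℝ (Fin d)) (r : ℝ) :
    dualVec (s.indicator (fun _ => A) r) ξ = s.indicator (fun _ => dualVec A ξ) r := by
  by_cases h : r ∈ s
  · simp [h]
  · simp only [h, not_false_eq_true, indicator_of_notMem]
    ext; simp [dualVec]

theorem integrable_indicator_Ioc_const (a b : ℝ≥0) (c : ℝ) :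
    Integrable ((Ioc (a : ℝ) b).indicator fun _ => c) (volume.restrict (Ici (0 : ℝ))) := by
  rw [integrable_indicator_iff measurableSet_Ioc]
  exact integrableOn_const (ne_of_lt ((Measure.restrict_apply_le _ _).trans_lt (by simp)))

/-- On a monotone grid the energy is the sum of the squared coefficients times the lengths. -/
theorem integral_norm_sq_grid {p : ℕ → ℝ≥0} (hp : Monotone p)
    (u : ℕ → EuclideanSpace ℝ (Fin m)) (N : ℕ) :
    (Integrable (fun r => ‖∑ k ∈ Finset.range N,
      (Ioc (p k : ℝ) (p (k + 1))).indicator (fun _ => u k) r‖ ^ 2)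
        (volume.restrict (Ici (0 : ℝ)))) ∧
    ∫ r in Ici (0 : ℝ), ‖∑ k ∈ Finset.range N,
      (Ioc (p k : ℝ) (p (k + 1))).indicator (fun _ => u k) r‖ ^ 2 =
      ∑ k ∈ Finset.range N, ‖u k‖ ^ 2 * ((p (k + 1) : ℝ) - p k) := by
  simp_rw [norm_sq_grid hp]
  refine ⟨integrable_finsetSum _ fun k _ => integrable_indicator_Ioc_const _ _ _, ?_⟩
  rw [integral_finsetSum _ fun k _ => integrable_indicator_Ioc_const _ _ _]
  refine Finset.sum_congr rfl fun k _ => ?_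
  rw [integral_indicator measurableSet_Ioc, setIntegral_const, measureReal_restrict_apply
    measurableSet_Ioc, inter_eq_left.2 (show Ioc (p k : ℝ) (p (k + 1)) ⊆ Ici 0 from
      fun r hr => (NNReal.coe_nonneg _).trans hr.1.le),
    Real.volume_real_Ioc_of_le (by exact_mod_cast hp (Nat.le_succ k)), smul_eq_mul, mul_comm]

theorem StepFun.integrable_energy (g : StepFun d m) (ξ : EuclideanSpace ℝ (Fin d)) :
    Integrable (fun r => ‖dualVec (g.eval r) ξ‖ ^ 2) (volume.restrict (Ici (0 : ℝ))) := by
  obtain ⟨N, p, v, hp, -, he, -⟩ := g.exists_grid (s := 0) fun _ => zero_le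
  simp_rw [he, dualVec_sum, dualVec_indicator]
  exact (integral_norm_sq_grid hp _ N).1

/-- The characteristic function of an elementary integral after time `s`, on an event of `𝓕 s`. -/
theorem IsBrownianMotion.setIntegral_exp_integral [IsProbabilityMeasure P]
    (hW : IsBrownianMotion P 𝓕 W) {s : ℝ≥0} (g : StepFun d m) (hs : ∀ i, s ≤ g.a i)
    (ξ : EuclideanSpace ℝ (Fin d)) {A : Set Ω} (hA : MeasurableSet[𝓕 s] A) :
    ∫ w in A, Complex.exp ((inner ℝ ξ (g.integral W w) : ℝ) * Complex.I) ∂P =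
      P.real A * Complex.exp (-(g.energy ξ : ℂ) / 2) := by
  obtain ⟨N, p, v, hp, hsp, he, hi⟩ := g.exists_grid hs
  have hE : g.energy ξ =
      ∑ k ∈ Finset.range N, ‖dualVec (v k) ξ‖ ^ 2 * ((p (k + 1) : ℝ) - p k) := by
    unfold StepFun.energy
    simp_rw [he, dualVec_sum, dualVec_indicator]
    exact (integral_norm_sq_grid hp _ N).2
  have hi' : ∀ w, g.integral W w = ∑ k ∈ Finset.range N,
      WithLp.toLp 2 (v k *ᵥ (W (p (k + 1)) w - W (p k) w).ofLp) := fun w => hi fun x => W x w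
  simp_rw [hi', inner_sum, inner_mulVec]
  rw [hE, hW.setIntegral_exp_increments hp hsp _ hA]

theorem StepFun.measurable_integral (hW : ∀ t, Measurable (W t)) (g : StepFun d m) :
    Measurable (g.integral W) := by
  unfold StepFun.integral
  refine Finset.measurable_fun_sum _ fun i _ => ?_
  have h : Continuous fun x : EuclideanSpace ℝ (Fin m) =>
      (WithLp.toLp 2 (g.c i *ᵥ x.ofLp) : EuclideanSpace ℝ (Fin d)) := by
    fun_prop
  exact h.measurable.comp ((hW _).sub (hW _))

theorem StepFun.energy_nonneg (g : StepFun d m) (ξ : EuclideanSpace ℝ (Fin d)) : 0 ≤ g.energy ξ :=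
  integral_nonneg fun _ => sq_nonneg _

theorem dualVec_smul (A : Matrix (Fin d) (Fin m) ℝ) (c : ℝ) (ξ : EuclideanSpace ℝ (Fin d)) :
    dualVec A (c • ξ) = c • dualVec A ξ := by
  ext; simp [dualVec, Matrix.mulVec_smul]

theorem StepFun.energy_smul (g : StepFun d m) (c : ℝ) (ξ : EuclideanSpace ℝ (Fin d)) :
    g.energy (c • ξ) = c ^ 2 * g.energy ξ := by
  simp_rw [StepFun.energy, dualVec_smul, norm_smul, mul_pow, Real.norm_eq_abs, sq_abs]
  rw [integral_const_mul]

/-- The components of an elementary integral are centred Gaussian variables. -/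
theorem IsBrownianMotion.map_inner_integral [IsProbabilityMeasure P]
    (hW : IsBrownianMotion P 𝓕 W) (g : StepFun d m) (ξ : EuclideanSpace ℝ (Fin d)) :
    P.map (fun w => inner ℝ ξ (g.integral W w)) =
      gaussianReal 0 (g.energy ξ).toNNReal := by
  have hm : Measurable fun w => inner ℝ ξ (g.integral W w) :=
    measurable_const.inner (StepFun.measurable_integral hW.measurable g)
  have := Measure.isProbabilityMeasure_map (μ := P) hm.aemeasurable
  apply Measure.ext_of_charFun
  funext c
  rw [charFun_gaussianReal, charFun_apply, integral_map hm.aemeasurable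
    (Continuous.aestronglyMeasurable (by fun_prop))]
  -- The one-dimensional characteristic function at c is the vector one at c • ξ, and the energy
  -- scales by c².
  have h := hW.setIntegral_exp_integral (s := 0) g (fun _ => zero_le) (c • ξ)
    (A := univ) MeasurableSet.univ
  rw [StepFun.energy_smul] at h
  simp only [Measure.restrict_univ, real_inner_smul_left, probReal_univ, Complex.ofReal_one,
    one_mul] at h
  simp only [RCLike.inner_apply, conj_trivial]
  rw [h, Real.coe_toNNReal _ (g.energy_nonneg ξ)]
  congr 1
  simp
  ring

/-- The variance of the centred law in `map_inner_integral` is its second moment. This is the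
isometry for one component; summing it over an orthonormal basis gives `eLpNorm_integral_sq`. -/
theorem IsBrownianMotion.lintegral_inner_sq [IsProbabilityMeasure P]
    (hW : IsBrownianMotion P 𝓕 W) (g : StepFun d m) (ξ : EuclideanSpace ℝ (Fin d)) :
    ∫⁻ w, ENNReal.ofReal (inner ℝ ξ (g.integral W w) ^ 2) ∂P =
      ∫⁻ r in Ici (0 : ℝ), ENNReal.ofReal (‖dualVec (g.eval r) ξ‖ ^ 2) := by
  have hm : Measurable fun w => inner ℝ ξ (g.integral W w) :=
    measurable_const.inner (StepFun.measurable_integral hW.measurable g)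
  rw [← ofReal_integral_eq_lintegral_ofReal (g.integrable_energy ξ)
    (ae_of_all _ fun _ => sq_nonneg _)]
  have h1 : ∫⁻ w, ENNReal.ofReal (inner ℝ ξ (g.integral W w) ^ 2) ∂P =
      ∫⁻ x, ENNReal.ofReal (x ^ 2) ∂(P.map fun w => inner ℝ ξ (g.integral W w)) := by
    rw [lintegral_map (by fun_prop) hm]
  rw [h1, hW.map_inner_integral]
  have h2 := variance_eq_integral (μ := gaussianReal 0 (g.energy ξ).toNNReal)
    (X := id) aemeasurable_id
  rw [variance_id_gaussianReal, Real.coe_toNNReal _ (g.energy_nonneg ξ)] at h2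
  have hid : MemLp id 2 (gaussianReal 0 (g.energy ξ).toNNReal) := memLp_id_gaussianReal 2
  have hint := hid.integrable_sq
  rw [← ofReal_integral_eq_lintegral_ofReal (by simpa using hint)
    (ae_of_all _ fun _ => sq_nonneg _)]
  congr 1
  have h3 : ∫ x, id x ∂(gaussianReal 0 (g.energy ξ).toNNReal) = 0 := by
    simp
  rw [h3] at h2
  simp only [id, sub_zero] at h2
  rw [← h2]
  rfl

/-- The isometry for elementary integrals. -/
theorem IsBrownianMotion.eLpNorm_integral_sq [IsProbabilityMeasure P]
    (hW : IsBrownianMotion P 𝓕 W) (g : StepFun d m) :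
    eLpNorm (g.integral W) 2 P ^ 2 =
      ∫⁻ r in Ici (0 : ℝ), ENNReal.ofReal (frobenius (g.eval r) ^ 2) := by
  have hm := StepFun.measurable_integral hW.measurable g
  have h1 : eLpNorm (g.integral W) 2 P ^ 2 = ∫⁻ w, ENNReal.ofReal (‖g.integral W w‖ ^ 2) ∂P := by
    have := eLpNorm_nnreal_pow_eq_lintegral (f := g.integral W) (μ := P) (p := 2) (by norm_num)
    norm_num at this
    rw [this]
    refine lintegral_congr fun w => ?_
    rw [ENNReal.ofReal_pow (norm_nonneg _), ofReal_norm]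
  rw [h1]
  have h2 : ∀ x : EuclideanSpace ℝ (Fin d), ENNReal.ofReal (‖x‖ ^ 2) =
      ∑ i, ENNReal.ofReal (inner ℝ (EuclideanSpace.single i (1 : ℝ)) x ^ 2) := by
    intro x
    rw [← ENNReal.ofReal_sum_of_nonneg fun _ _ => sq_nonneg _, EuclideanSpace.norm_sq_eq]
    simp [EuclideanSpace.inner_single_left]
  have h3 : ∀ A : Matrix (Fin d) (Fin m) ℝ, ENNReal.ofReal (frobenius A ^ 2) =
      ∑ i, ENNReal.ofReal (‖dualVec A (EuclideanSpace.single i (1 : ℝ))‖ ^ 2) := by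
    intro A
    rw [← ENNReal.ofReal_sum_of_nonneg fun _ _ => sq_nonneg _, frobenius_sq_eq_sum]
  simp_rw [h2, h3]
  rw [lintegral_finsetSum, lintegral_finsetSum']
  · exact Finset.sum_congr rfl fun i _ => hW.lintegral_inner_sq g _
  · intro i _
    exact (g.integrable_energy _).aestronglyMeasurable.aemeasurable.ennreal_ofReal
  · intro i _
    exact ((measurable_const.inner hm).pow_const 2).ennreal_ofReal

/-- The exponential moments of an elementary integral. -/
theorem IsBrownianMotion.lintegral_exp_inner [IsProbabilityMeasure P]
    (hW : IsBrownianMotion P 𝓕 W) (g : StepFun d m) (ξ : EuclideanSpace ℝ (Fin d)) :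
    ∫⁻ w, ENNReal.ofReal (Real.exp (inner ℝ ξ (g.integral W w))) ∂P =
      ENNReal.ofReal (Real.exp (g.energy ξ / 2)) := by
  have hm : Measurable fun w => inner ℝ ξ (g.integral W w) :=
    measurable_const.inner (StepFun.measurable_integral hW.measurable g)
  have h := mgf_gaussianReal (hW.map_inner_integral g ξ) 1
  have hint : Integrable (fun w => Real.exp (inner ℝ ξ (g.integral W w))) P := by
    have := integrable_exp_mul_gaussianReal (μ := 0)
      (v := (g.energy ξ).toNNReal) 1
    rw [← hW.map_inner_integral g ξ, integrable_map_measure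
      (Continuous.aestronglyMeasurable (by fun_prop)) hm.aemeasurable] at this
    simpa [Function.comp_def] using this
  rw [← ofReal_integral_eq_lintegral_ofReal hint (ae_of_all _ fun _ => (Real.exp_pos _).le)]
  simp only [mgf, one_mul, zero_add, one_pow, mul_one,
    Real.coe_toNNReal _ (g.energy_nonneg ξ)] at h
  rw [h]

end WienerSteps

/-! ### Wiener integrals: linearity, localisation in time, independence, moments. -/

section WienerIntegral

variable {Ω : Type*} {mΩ : MeasurableSpace Ω} {P : Measure Ω} {𝓕 : Filtration ℝ≥0 mΩ} {d m : ℕ}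
  {W : ℝ≥0 → Ω → EuclideanSpace ℝ (Fin m)}

/-- The part of a step function after time `s`. -/
def StepFun.above (g : StepFun d m) (s : ℝ≥0) : StepFun d m where
  n := g.n
  a i := max (g.a i) s
  b i := max (g.b i) s
  le i := max_le_max_right s (g.le i)
  c := g.c

/-- The part of a step function up to time `s`. -/
def StepFun.below (g : StepFun d m) (s : ℝ≥0) : StepFun d m where
  n := g.n
  a i := min (g.a i) s
  b i := min (g.b i) s
  le i := min_le_min_right s (g.le i)
  c := g.c

/-- The sum of two step functions. -/
def StepFun.add (g g' : StepFun d m) : StepFun d m where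
  n := g.n + g'.n
  a := Fin.append g.a g'.a
  b := Fin.append g.b g'.b
  le i := by
    refine Fin.addCases (fun i => ?_) (fun i => ?_) i
    · simpa using g.le i
    · simpa using g'.le i
  c := Fin.append g.c g'.c

/-- The negative of a step function. -/
def StepFun.neg (g : StepFun d m) : StepFun d m where
  n := g.n
  a := g.a
  b := g.b
  le := g.le
  c i := -g.c i

theorem StepFun.eval_above (g : StepFun d m) (s : ℝ≥0) (r : ℝ) :
    (g.above s).eval r = (Ioi (s : ℝ)).indicator g.eval r := by
  by_cases hr : r ∈ Ioi (s : ℝ)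
  · rw [indicator_of_mem hr]
    refine Finset.sum_congr rfl fun i _ => ?_
    have hr' : (s : ℝ) < r := hr
    simp only [StepFun.above, NNReal.coe_max, indicator, mem_Ioc, max_lt_iff, le_max_iff,
      hr', hr'.not_ge, and_true, or_false]
  · rw [indicator_of_notMem hr]
    refine Finset.sum_eq_zero fun i _ => ?_
    simp only [StepFun.above, NNReal.coe_max]
    refine indicator_of_notMem (fun h => hr ?_) _
    exact (le_max_right _ _).trans_lt h.1

theorem StepFun.eval_below (g : StepFun d m) (s : ℝ≥0) (r : ℝ) :
    (g.below s).eval r = (Iic (s : ℝ)).indicator g.eval r := by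
  by_cases hr : r ∈ Iic (s : ℝ)
  · rw [indicator_of_mem hr]
    refine Finset.sum_congr rfl fun i _ => ?_
    have hr' : r ≤ (s : ℝ) := hr
    simp only [StepFun.below, NNReal.coe_min, indicator, mem_Ioc, min_lt_iff, le_min_iff,
      hr', hr'.not_gt, and_true, or_false]
  · rw [indicator_of_notMem hr]
    refine Finset.sum_eq_zero fun i _ => ?_
    simp only [StepFun.below, NNReal.coe_min]
    refine indicator_of_notMem (fun h => hr ?_) _
    exact h.2.trans (min_le_right _ _)

theorem StepFun.eval_add (g g' : StepFun d m) (r : ℝ) :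
    (g.add g').eval r = g.eval r + g'.eval r := by
  refine (Fin.sum_univ_add fun i : Fin (g.n + g'.n) =>
    (Ioc ((Fin.append g.a g'.a i : ℝ≥0) : ℝ) (Fin.append g.b g'.b i : ℝ≥0)).indicator
      (fun _ => Fin.append g.c g'.c i) r).trans ?_
  simp [StepFun.eval]

theorem StepFun.eval_neg (g : StepFun d m) (r : ℝ) : g.neg.eval r = -g.eval r := by
  simp only [StepFun.eval, StepFun.neg]
  rw [← Finset.sum_neg_distrib]
  refine Finset.sum_congr rfl fun i _ => ?_
  by_cases h : r ∈ Ioc (g.a i : ℝ) (g.b i) <;> simp [h]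

theorem StepFun.integral_add (g g' : StepFun d m) (w : Ω) :
    (g.add g').integral W w = g.integral W w + g'.integral W w := by
  refine (Fin.sum_univ_add fun i : Fin (g.n + g'.n) =>
    (WithLp.toLp 2 (Fin.append g.c g'.c i *ᵥ (W (Fin.append g.b g'.b i) w -
      W (Fin.append g.a g'.a i) w).ofLp) : EuclideanSpace ℝ (Fin d))).trans ?_
  simp [StepFun.integral]

theorem StepFun.integral_neg (g : StepFun d m) (w : Ω) :
    g.neg.integral W w = -g.integral W w := by
  simp only [StepFun.integral, StepFun.neg]
  rw [← Finset.sum_neg_distrib]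
  refine Finset.sum_congr rfl fun i _ => ?_
  rw [Matrix.neg_mulVec, WithLp.toLp_neg]

theorem StepFun.integral_eq_below_add_above (g : StepFun d m) (s : ℝ≥0) (w : Ω) :
    g.integral W w = (g.below s).integral W w + (g.above s).integral W w := by
  refine Eq.trans ?_ (Finset.sum_add_distrib (s := Finset.univ)
    (f := fun i : Fin g.n => (WithLp.toLp 2 (g.c i *ᵥ (W (min (g.b i) s) w -
      W (min (g.a i) s) w).ofLp) : EuclideanSpace ℝ (Fin d)))
    (g := fun i : Fin g.n => WithLp.toLp 2 (g.c i *ᵥ (W (max (g.b i) s) w -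
      W (max (g.a i) s) w).ofLp)))
  refine Finset.sum_congr rfl fun i _ => ?_
  rw [← WithLp.toLp_add, ← Matrix.mulVec_add, ← WithLp.ofLp_add]
  congr 3
  have h := g.le i
  rcases le_total (g.a i) s with h1 | h1 <;> rcases le_total (g.b i) s with h2 | h2
  · simp [h1, h2]
  · simp [h1, h2]
  · have : g.a i = g.b i := le_antisymm h (h2.trans h1)
    simp [this]
  · simp [h1, h2]

/-- Add the approximating step functions; the errors are controlled by |a+b|² ≤ 2|a|² + 2|b|² in
time and by Minkowski in L²(P). Measurability of one integrand is enough to split the lower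
integral. -/
theorem IsWienerIntegral.add {h h' : ℝ → Matrix (Fin d) (Fin m) ℝ}
    {X X' : Ω → EuclideanSpace ℝ (Fin d)} (hWm : ∀ t, Measurable (W t))
    (hX : Measurable X) (hX' : Measurable X')
    (hh : ∀ i j, Measurable fun r => h r i j)
    (H : IsWienerIntegral P W h X) (H' : IsWienerIntegral P W h' X') :
    IsWienerIntegral P W (fun r => h r + h' r) (fun w => X w + X' w) := by
  obtain ⟨g, h1, h2⟩ := H
  obtain ⟨g', h1', h2'⟩ := H'
  refine ⟨fun k => (g k).add (g' k), ?_, ?_⟩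
  · have hlim := (ENNReal.Tendsto.const_mul (a := 2) h1 (Or.inr (by simp))).add
      (ENNReal.Tendsto.const_mul (a := 2) h1' (Or.inr (by simp)))
    simp only [mul_zero, add_zero] at hlim
    refine tendsto_of_tendsto_of_tendsto_of_le_of_le tendsto_const_nhds hlim
      (fun _ => zero_le) fun k => ?_
    have hm : Measurable fun r => ENNReal.ofReal (frobenius ((g k).eval r - h r) ^ 2) :=
      ((measurable_frobenius fun i j =>
        (measurable_stepFun_eval (g k) i j).sub (hh i j)).pow_const 2).ennreal_ofReal
    simp only
    rw [← lintegral_const_mul' _ _ (by simp), ← lintegral_const_mul' _ _ (by simp),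
      ← lintegral_add_left (hm.const_mul _)]
    refine lintegral_mono fun r => ?_
    have e : (g k).eval r + (g' k).eval r - (h r + h' r) =
      ((g k).eval r - h r) + ((g' k).eval r - h' r) := by abel
    rw [StepFun.eval_add, e]
    refine (ENNReal.ofReal_le_ofReal (frobenius_sq_add_le _ _)).trans ?_
    rw [ENNReal.ofReal_add (by positivity) (by positivity), ENNReal.ofReal_mul (by simp),
      ENNReal.ofReal_mul (by simp)]
    simp
  · have hlim := h2.add h2'
    rw [add_zero] at hlim
    refine tendsto_of_tendsto_of_tendsto_of_le_of_le tendsto_const_nhds hlim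
      (fun _ => zero_le) fun k => ?_
    have e : (fun w => ((g k).add (g' k)).integral W w - (X w + X' w)) =
        (fun w => (g k).integral W w - X w) + fun w => (g' k).integral W w - X' w := by
      funext w
      simp only [StepFun.integral_add, Pi.add_apply]
      abel
    simp only [e]
    exact eLpNorm_add_le
      ((StepFun.measurable_integral hWm _).sub hX).aestronglyMeasurable
      ((StepFun.measurable_integral hWm _).sub hX').aestronglyMeasurable (by norm_num)

theorem IsWienerIntegral.neg {h : ℝ → Matrix (Fin d) (Fin m) ℝ}
    {X : Ω → EuclideanSpace ℝ (Fin d)} (H : IsWienerIntegral P W h X) :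
    IsWienerIntegral P W (fun r => -h r) (fun w => -X w) := by
  obtain ⟨g, h1, h2⟩ := H
  refine ⟨fun k => (g k).neg, ?_, ?_⟩
  · refine h1.congr fun k => lintegral_congr fun r => ?_
    rw [StepFun.eval_neg, ← frobenius_neg ((g k).eval r - h r)]
    congr 3
    rw [neg_sub, sub_neg_eq_add, add_comm, sub_eq_add_neg]
  · refine h2.congr fun k => ?_
    rw [← eLpNorm_neg]
    congr 1
    funext w
    simp only [StepFun.integral_neg, Pi.neg_apply]
    abel

/-- Replacing the approximating step functions. -/
theorem IsWienerIntegral.tendsto_of_decomposition [IsProbabilityMeasure P]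
    (hW : IsBrownianMotion P 𝓕 W) {h : ℝ → Matrix (Fin d) (Fin m) ℝ}
    {X : Ω → EuclideanSpace ℝ (Fin d)} (hX : Measurable X) {g g₁ g₂ : ℕ → StepFun d m}
    (h1 : Tendsto (fun k => ∫⁻ r in Ici (0 : ℝ),
      ENNReal.ofReal (frobenius ((g k).eval r - h r) ^ 2)) atTop (𝓝 0))
    (h2 : Tendsto (fun k => eLpNorm (fun w => (g k).integral W w - X w) 2 P) atTop (𝓝 0))
    (hadd : ∀ k w, (g k).integral W w = (g₁ k).integral W w + (g₂ k).integral W w)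
    (hg₁ : ∀ k, ∀ r ∈ Ici (0 : ℝ),
      frobenius ((g₁ k).eval r - h r) ≤ frobenius ((g k).eval r - h r))
    (hg₂ : ∀ k, ∀ r ∈ Ici (0 : ℝ), frobenius ((g₂ k).eval r) ≤ frobenius ((g k).eval r - h r)) :
    Tendsto (fun k => ∫⁻ r in Ici (0 : ℝ),
      ENNReal.ofReal (frobenius ((g₁ k).eval r - h r) ^ 2)) atTop (𝓝 0) ∧
    Tendsto (fun k => eLpNorm (fun w => (g₁ k).integral W w - X w) 2 P) atTop (𝓝 0) := by
  constructor
  · refine tendsto_of_tendsto_of_tendsto_of_le_of_le tendsto_const_nhds h1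
      (fun _ => zero_le) fun k => ?_
    refine setLIntegral_mono' measurableSet_Ici fun r hr => ?_
    exact ENNReal.ofReal_le_ofReal (pow_le_pow_left₀ (frobenius_nonneg _) (hg₁ k r hr) 2)
  -- The discarded part is pointwise at most the approximation error, so by the isometry its
  -- integral tends to 0 in L²(P).
  · have h3 : Tendsto (fun k => eLpNorm ((g₂ k).integral W) 2 P ^ 2) atTop (𝓝 0) := by
      refine tendsto_of_tendsto_of_tendsto_of_le_of_le tendsto_const_nhds h1
        (fun _ => zero_le) fun k => ?_
      simp only
      rw [hW.eLpNorm_integral_sq]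
      refine setLIntegral_mono' measurableSet_Ici fun r hr => ?_
      exact ENNReal.ofReal_le_ofReal (pow_le_pow_left₀ (frobenius_nonneg _) (hg₂ k r hr) 2)
    have h4 : Tendsto (fun k => eLpNorm ((g₂ k).integral W) 2 P) atTop (𝓝 0) := by
      have := h3.ennrpow_const (1 / 2)
      rw [ENNReal.zero_rpow_of_pos (by norm_num)] at this
      refine this.congr fun k => ?_
      rw [← ENNReal.rpow_natCast, ← ENNReal.rpow_mul]
      norm_num
    have hlim := h2.add h4
    rw [add_zero] at hlim
    refine tendsto_of_tendsto_of_tendsto_of_le_of_le tendsto_const_nhds hlim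
      (fun _ => zero_le) fun k => ?_
    have e : (fun w => (g₁ k).integral W w - X w) =
        (fun w => (g k).integral W w - X w) - (g₂ k).integral W := by
      funext w
      simp only [hadd, Pi.sub_apply]
      abel
    simp only [e]
    exact eLpNorm_sub_le
      ((StepFun.measurable_integral hW.measurable _).sub hX).aestronglyMeasurable
      (StepFun.measurable_integral hW.measurable _).aestronglyMeasurable (by norm_num)

/-- Where `h` vanishes, a step function is pure approximation error, so its part before `s` may be
thrown away. The approximants that remain involve only increments after `s`, as independence of 𝓕 s
requires. -/
theorem IsWienerIntegral.exists_above [IsProbabilityMeasure P]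
    (hW : IsBrownianMotion P 𝓕 W) {h : ℝ → Matrix (Fin d) (Fin m) ℝ}
    {X : Ω → EuclideanSpace ℝ (Fin d)} (hX : Measurable X) (H : IsWienerIntegral P W h X)
    {s : ℝ≥0} (hs : ∀ r ≤ (s : ℝ), h r = 0) :
    ∃ g : ℕ → StepFun d m, (∀ k i, s ≤ (g k).a i) ∧
      Tendsto (fun k => eLpNorm (fun w => (g k).integral W w - X w) 2 P) atTop (𝓝 0) := by
  obtain ⟨g, h1, h2⟩ := H
  refine ⟨fun k => (g k).above s, fun k i => le_max_right _ _,
    (IsWienerIntegral.tendsto_of_decomposition (g₂ := fun k => (g k).below s)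
      hW hX h1 h2 (fun k w => ?_) (fun k r _ => ?_) (fun k r _ => ?_)).2⟩
  · rw [add_comm]
    exact (g k).integral_eq_below_add_above s w
  · rw [StepFun.eval_above]
    by_cases hr : r ≤ (s : ℝ)
    · rw [indicator_of_notMem (by simpa using hr), hs r hr]
      simpa using frobenius_nonneg _
    · rw [indicator_of_mem (by simpa using hr)]
  · rw [StepFun.eval_below]
    by_cases hr : r ≤ (s : ℝ)
    · rw [indicator_of_mem (by simpa using hr), hs r hr]
      simp
    · rw [indicator_of_notMem (by simpa using hr)]
      simpa using frobenius_nonneg _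

/-- The mirror image of `exists_above`, with approximants that are measurable at time `s`. -/
theorem IsWienerIntegral.exists_below [IsProbabilityMeasure P]
    (hW : IsBrownianMotion P 𝓕 W) {h : ℝ → Matrix (Fin d) (Fin m) ℝ}
    {X : Ω → EuclideanSpace ℝ (Fin d)} (hX : Measurable X) (H : IsWienerIntegral P W h X)
    {s : ℝ≥0} (hs : ∀ r, (s : ℝ) < r → h r = 0) :
    ∃ g : ℕ → StepFun d m, (∀ k i, (g k).b i ≤ s) ∧
      Tendsto (fun k => eLpNorm (fun w => (g k).integral W w - X w) 2 P) atTop (𝓝 0) := by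
  obtain ⟨g, h1, h2⟩ := H
  refine ⟨fun k => (g k).below s, fun k i => min_le_right _ _,
    (IsWienerIntegral.tendsto_of_decomposition (g₂ := fun k => (g k).above s)
      hW hX h1 h2 (fun k w => ?_) (fun k r _ => ?_) (fun k r _ => ?_)).2⟩
  · exact (g k).integral_eq_below_add_above s w
  · rw [StepFun.eval_below]
    by_cases hr : r ≤ (s : ℝ)
    · rw [indicator_of_mem (by simpa using hr)]
    · rw [indicator_of_notMem (by simpa using hr), hs r (not_le.1 hr)]
      simpa using frobenius_nonneg _
  · rw [StepFun.eval_above]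
    by_cases hr : r ≤ (s : ℝ)
    · rw [indicator_of_notMem (by simpa using hr)]
      simpa using frobenius_nonneg _
    · rw [indicator_of_mem (by simpa using hr), hs r (not_le.1 hr)]
      simp

theorem exists_subseq_ae [IsProbabilityMeasure P] (hWm : ∀ t, Measurable (W t))
    {X : Ω → EuclideanSpace ℝ (Fin d)} (hX : Measurable X) {g : ℕ → StepFun d m}
    (h2 : Tendsto (fun k => eLpNorm (fun w => (g k).integral W w - X w) 2 P) atTop (𝓝 0)) :
    ∃ ns : ℕ → ℕ, StrictMono ns ∧
      ∀ᵐ w ∂P, Tendsto (fun k => (g (ns k)).integral W w) atTop (𝓝 (X w)) :=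
  (tendstoInMeasure_of_tendsto_eLpNorm (by norm_num)
    (fun k => (StepFun.measurable_integral hWm (g k)).aestronglyMeasurable)
    hX.aestronglyMeasurable h2).exists_seq_tendsto_ae

/-- A Wiener integral over `(s,∞)` is independent of `𝓕 s`. -/
theorem IsWienerIntegral.indep [IsProbabilityMeasure P]
    (hW : IsBrownianMotion P 𝓕 W) {h : ℝ → Matrix (Fin d) (Fin m) ℝ}
    {X : Ω → EuclideanSpace ℝ (Fin d)} (hX : Measurable X) (H : IsWienerIntegral P W h X)
    {s : ℝ≥0} (hs : ∀ r ≤ (s : ℝ), h r = 0) :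
    Indep (MeasurableSpace.comap X inferInstance) (𝓕 s) P := by
  obtain ⟨g, hg, h2⟩ := H.exists_above hW hX hs
  obtain ⟨ns, -, hns⟩ := exists_subseq_ae hW.measurable hX h2
  have hlim : ∀ (A : Set Ω) (ξ : EuclideanSpace ℝ (Fin d)), Tendsto (fun k =>
      ∫ w in A, Complex.exp ((inner ℝ ξ ((g (ns k)).integral W w) : ℝ) * Complex.I) ∂P)
      atTop (𝓝 (∫ w in A, Complex.exp ((inner ℝ ξ (X w) : ℝ) * Complex.I) ∂P)) := by
    intro A ξ
    have hc : Continuous fun x : EuclideanSpace ℝ (Fin d) =>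
      Complex.exp ((inner ℝ ξ x : ℝ) * Complex.I) := by fun_prop
    refine tendsto_integral_of_dominated_convergence (fun _ => 1) (fun k => ?_)
      (integrable_const _) (fun k => ?_) ?_
    · exact (hc.measurable.comp
        (StepFun.measurable_integral hW.measurable _)).aestronglyMeasurable
    · exact ae_of_all _ fun w => (Complex.norm_exp_ofReal_mul_I _).le
    · filter_upwards [ae_restrict_of_ae hns] with w hw
      exact (hc.tendsto _).comp hw
  -- The factorisation holds for each approximant with the same event `A`, and both sides pass to
  -- the limit.
  have key : ∀ (A : Set Ω), MeasurableSet[𝓕 s] A → ∀ ξ : EuclideanSpace ℝ (Fin d),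
      ∫ w in A, Complex.exp ((inner ℝ ξ (X w) : ℝ) * Complex.I) ∂P =
        P.real A * ∫ w, Complex.exp ((inner ℝ ξ (X w) : ℝ) * Complex.I) ∂P := by
    intro A hA ξ
    have h3 := (hlim univ ξ).const_mul (P.real A : ℂ)
    simp only [Measure.restrict_univ] at h3
    refine tendsto_nhds_unique (hlim A ξ) (h3.congr fun k => ?_)
    have e1 := hW.setIntegral_exp_integral (g (ns k)) (hg (ns k)) ξ hA
    have e2 := hW.setIntegral_exp_integral (g (ns k)) (hg (ns k)) ξ
      (A := univ) (@MeasurableSet.univ _ (𝓕 s))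
    rw [e1]
    simp only [Measure.restrict_univ, probReal_univ, Complex.ofReal_one, one_mul] at e2
    rw [e2]
  rw [Indep_iff]
  rintro _ A ⟨B, hB, rfl⟩ hA
  have hAm := 𝓕.le s A hA
  -- Both sides are finite measures and `key` equates their characteristic functions. Evaluated on
  -- `B`, the identity is the independence of {X ∈ B} and `A`.
  have hmeas : (P.restrict A).map X = P A • P.map X := by
    have : IsFiniteMeasure (P A • P.map X) := by
      refine ⟨?_⟩
      rw [Measure.smul_apply, smul_eq_mul]
      exact ENNReal.mul_lt_top (measure_lt_top _ _) (measure_lt_top _ _)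
    apply Measure.ext_of_charFun
    funext ξ
    have hcm : ∀ μ : Measure (EuclideanSpace ℝ (Fin d)), AEStronglyMeasurable
        (fun x => Complex.exp ((inner ℝ x ξ : ℝ) * Complex.I)) μ :=
      fun μ => Continuous.aestronglyMeasurable (by fun_prop)
    rw [charFun_apply, charFun_apply, integral_smul_measure,
      integral_map hX.aemeasurable (hcm _), integral_map hX.aemeasurable (hcm _)]
    have := key A hA ξ
    simp_rw [real_inner_comm] at this ⊢
    rw [this]
    simp [Measure.real]
  have := congrArg (fun μ => μ B) hmeas
  simp only [Measure.smul_apply, smul_eq_mul] at this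
  rw [Measure.map_apply hX hB, Measure.map_apply hX hB, Measure.restrict_apply (hX hB)] at this
  rw [this, mul_comm]

/-- A Wiener integral over `(0,s]` is `𝓕 s`-measurable up to a null set. -/
theorem IsWienerIntegral.aestronglyMeasurable [IsProbabilityMeasure P]
    (hW : IsBrownianMotion P 𝓕 W) {h : ℝ → Matrix (Fin d) (Fin m) ℝ}
    {X : Ω → EuclideanSpace ℝ (Fin d)} (hX : Measurable X) (H : IsWienerIntegral P W h X)
    {s : ℝ≥0} (hs : ∀ r, (s : ℝ) < r → h r = 0) :
    AEStronglyMeasurable[𝓕 s] X P := by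
  obtain ⟨g, hg, h2⟩ := H.exists_below hW hX hs
  obtain ⟨ns, -, hns⟩ := exists_subseq_ae hW.measurable hX h2
  have hm : ∀ k, Measurable[𝓕 s] ((g (ns k)).integral W) := by
    intro k
    unfold StepFun.integral
    refine Finset.measurable_fun_sum _ fun i _ => ?_
    have hc : Continuous fun x : EuclideanSpace ℝ (Fin m) =>
        (WithLp.toLp 2 ((g (ns k)).c i *ᵥ x.ofLp) : EuclideanSpace ℝ (Fin d)) := by
      fun_prop
    have hb := hg (ns k) i
    exact hc.measurable.comp (((hW.adapted _).mono (𝓕.mono hb) le_rfl).sub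
      ((hW.adapted _).mono (𝓕.mono (((g (ns k)).le i).trans hb)) le_rfl))
  have hlim : ∀ m' : MeasurableSpace Ω, (∀ k, Measurable[m'] ((g (ns k)).integral W)) →
      StronglyMeasurable[m'] fun w => limUnder atTop fun k => (g (ns k)).integral W w :=
    fun _ h => StronglyMeasurable.limUnder fun k => (h k).stronglyMeasurable
  -- The pointwise limit, with a default value where the subsequence diverges, is a version of `X`
  -- that is measurable at time `s`.
  refine ⟨fun w => limUnder atTop fun k => (g (ns k)).integral W w, hlim _ hm, ?_⟩
  filter_upwards [hns] with w hw
  exact hw.limUnder_eq.symm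

/-- For a zero integrand the approximants are nothing but error and can be replaced by the zero step
function. With linearity this yields the almost sure uniqueness of Wiener integrals. -/
theorem IsWienerIntegral.ae_eq_zero [IsProbabilityMeasure P]
    (hW : IsBrownianMotion P 𝓕 W) {h : ℝ → Matrix (Fin d) (Fin m) ℝ}
    {X : Ω → EuclideanSpace ℝ (Fin d)} (hX : Measurable X) (H : IsWienerIntegral P W h X)
    (hh : ∀ r, h r = 0) : X =ᵐ[P] 0 := by
  obtain ⟨g, h1, h2⟩ := H
  let z : StepFun d m := ⟨0, Fin.elim0, Fin.elim0, fun i => i.elim0, Fin.elim0⟩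
  have hz : ∀ r, z.eval r = 0 := fun r => by simp [z, StepFun.eval]
  have hz' : ∀ w, z.integral W w = 0 := fun w => by simp [z, StepFun.integral]
  have h3 := (IsWienerIntegral.tendsto_of_decomposition hW hX h1 h2 (g₁ := fun _ => z) (g₂ := g)
    (fun k w => by rw [hz', zero_add]) (fun k r _ => by
      rw [hz, hh]; simpa using frobenius_nonneg _) (fun k r _ => by rw [hh, sub_zero])).2
  simp only [hz', zero_sub] at h3
  have h4 := tendsto_nhds_unique h3 tendsto_const_nhds
  have h5 := (eLpNorm_eq_zero_iff hX.neg.aestronglyMeasurable (by norm_num)).1 h4.symm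
  filter_upwards [h5] with w hw
  simpa using hw

/-- Exponential moments of a Wiener integral. -/
theorem IsWienerIntegral.lintegral_exp_inner_le [IsProbabilityMeasure P]
    (hW : IsBrownianMotion P 𝓕 W) {h : ℝ → Matrix (Fin d) (Fin m) ℝ}
    (hh : ∀ i j, Measurable fun r => h r i j)
    {X : Ω → EuclideanSpace ℝ (Fin d)} (hX : Measurable X) (H : IsWienerIntegral P W h X)
    {S : ℝ} (hS : 0 ≤ S)
    (hbound : ∫⁻ r in Ici (0 : ℝ), ENNReal.ofReal (frobenius (h r) ^ 2) ≤ ENNReal.ofReal S)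
    (ξ : EuclideanSpace ℝ (Fin d)) :
    ∫⁻ w, ENNReal.ofReal (Real.exp (inner ℝ ξ (X w))) ∂P ≤
      ENNReal.ofReal (Real.exp (‖ξ‖ ^ 2 * (1 + S))) := by
  obtain ⟨g, h1, h2⟩ := H
  obtain ⟨ns, hmono, hns⟩ := exists_subseq_ae hW.measurable hX h2
  have hc : Continuous fun x : EuclideanSpace ℝ (Fin d) =>
      ENNReal.ofReal (Real.exp (inner ℝ ξ x)) :=
    ENNReal.continuous_ofReal.comp (by fun_prop)
  have h3 : ∫⁻ w, ENNReal.ofReal (Real.exp (inner ℝ ξ (X w))) ∂P ≤ liminf (fun k =>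
      ∫⁻ w, ENNReal.ofReal (Real.exp (inner ℝ ξ ((g (ns k)).integral W w))) ∂P) atTop := by
    -- Fatou's lemma along an almost surely convergent subsequence.
    refine le_trans (lintegral_mono_ae ?_) (lintegral_liminf_le fun k =>
      hc.measurable.comp (StepFun.measurable_integral hW.measurable _))
    filter_upwards [hns] with w hw
    exact ((hc.tendsto _).comp hw).liminf_eq.ge
  refine h3.trans (liminf_le_of_frequently_le' (Eventually.frequently ?_))
  -- Once the squared L² error is below 1, the energy is at most ‖ξ‖²(2 + 2S); the Gaussian factor
  -- 1/2 leaves ‖ξ‖²(1 + S).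
  have h4 := (h1.comp hmono.tendsto_atTop).eventually (gt_mem_nhds zero_lt_one)
  filter_upwards [h4] with k hk
  rw [hW.lintegral_exp_inner]
  refine ENNReal.ofReal_le_ofReal (Real.exp_le_exp.2 ?_)
  have hm : Measurable fun r => ENNReal.ofReal (frobenius (h r) ^ 2) :=
    ((measurable_frobenius hh).pow_const 2).ennreal_ofReal
  have h5 : ENNReal.ofReal ((g (ns k)).energy ξ) ≤
      ENNReal.ofReal (‖ξ‖ ^ 2 * (2 * 1 + 2 * S)) := by
    rw [StepFun.energy, ofReal_integral_eq_lintegral_ofReal ((g (ns k)).integrable_energy ξ)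
      (ae_of_all _ fun _ => sq_nonneg _)]
    calc ∫⁻ r in Ici (0 : ℝ), ENNReal.ofReal (‖dualVec ((g (ns k)).eval r) ξ‖ ^ 2)
        ≤ ∫⁻ r in Ici (0 : ℝ), ENNReal.ofReal (‖ξ‖ ^ 2) *
          (2 * ENNReal.ofReal (frobenius ((g (ns k)).eval r - h r) ^ 2) +
            2 * ENNReal.ofReal (frobenius (h r) ^ 2)) := by
          refine lintegral_mono fun r => ?_
          refine (ENNReal.ofReal_le_ofReal (norm_dualVec_le _ _)).trans ?_
          rw [ENNReal.ofReal_mul (sq_nonneg _)]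
          gcongr
          have e := frobenius_sq_add_le ((g (ns k)).eval r - h r) (h r)
          rw [sub_add_cancel] at e
          refine (ENNReal.ofReal_le_ofReal e).trans ?_
          rw [ENNReal.ofReal_add (by positivity) (by positivity), ENNReal.ofReal_mul (by simp),
            ENNReal.ofReal_mul (by simp)]
          simp
      _ = ENNReal.ofReal (‖ξ‖ ^ 2) *
          (2 * (∫⁻ r in Ici (0 : ℝ), ENNReal.ofReal (frobenius ((g (ns k)).eval r - h r) ^ 2)) +
            2 * ∫⁻ r in Ici (0 : ℝ), ENNReal.ofReal (frobenius (h r) ^ 2)) := by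
          rw [lintegral_const_mul' _ _ (by simp), lintegral_add_right _ (hm.const_mul _),
            lintegral_const_mul' _ _ (by simp), lintegral_const_mul' _ _ (by simp)]
      _ ≤ ENNReal.ofReal (‖ξ‖ ^ 2) * (2 * 1 + 2 * ENNReal.ofReal S) := by
          gcongr
          exact hk.le
      _ = ENNReal.ofReal (‖ξ‖ ^ 2 * (2 * 1 + 2 * S)) := by
          rw [ENNReal.ofReal_mul (by positivity), ENNReal.ofReal_add (by positivity)
            (by positivity), ENNReal.ofReal_mul (by simp), ENNReal.ofReal_mul (by simp)]
          simp
  rw [ENNReal.ofReal_le_ofReal_iff (by positivity)] at h5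
  linarith

end WienerIntegral

/-! ### The Gaussian Volterra process: moments, measurability, splitting. -/

section VolterraProcess

variable {Ω : Type*} {mΩ : MeasurableSpace Ω} {P : Measure Ω} {𝓕 : Filtration ℝ≥0 mΩ} {d m : ℕ}
  {W : ℝ≥0 → Ω → EuclideanSpace ℝ (Fin m)} {K : ℝ → ℝ → Matrix (Fin d) (Fin m) ℝ}

/-- The norm is at most d times the largest coordinate, and e^{|u|} ≤ e^u + e^{-u}. Moments of the
norm thus reduce to Laplace transforms of linear forms; the summand 1 covers d = 0. -/
theorem exp_mul_norm_le (a : ℝ) (ha : 0 ≤ a) (x : EuclideanSpace ℝ (Fin d)) :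
    Real.exp (a * ‖x‖) ≤ 1 + ∑ i, (Real.exp (inner ℝ (EuclideanSpace.single i (a * d)) x) +
      Real.exp (inner ℝ (EuclideanSpace.single i (-(a * d))) x)) := by
  rcases Nat.eq_zero_or_pos d with rfl | hd
  · have : x = 0 := Subsingleton.elim _ _
    simp [this]
  have : Nonempty (Fin d) := ⟨⟨0, hd⟩⟩
  obtain ⟨i, hi⟩ := Finite.exists_max fun i => |x i|
  have h1 : ‖x‖ ≤ d * |x i| := by
    have h2 : ‖x‖ ≤ ∑ j, |x j| := by
      have e : x = ∑ j, EuclideanSpace.single j (x j) := by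
        ext k
        simp [Finset.sum_apply, Pi.single_apply]
      calc ‖x‖ = ‖∑ j, EuclideanSpace.single j (x j)‖ := by rw [← e]
        _ ≤ ∑ j, ‖(EuclideanSpace.single j (x j) : EuclideanSpace ℝ (Fin d))‖ := norm_sum_le _ _
        _ = ∑ j, |x j| := by simp
    refine h2.trans ((Finset.sum_le_sum fun j _ => hi j).trans ?_)
    simp
  have h3 : Real.exp (a * ‖x‖) ≤ Real.exp (a * d * |x i|) := by
    rw [Real.exp_le_exp, mul_assoc]
    exact mul_le_mul_of_nonneg_left h1 ha
  have h4 : Real.exp (a * d * |x i|) ≤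
      Real.exp (inner ℝ (EuclideanSpace.single i (a * d)) x) +
        Real.exp (inner ℝ (EuclideanSpace.single i (-(a * d))) x) := by
    simp only [EuclideanSpace.inner_single_left, conj_trivial]
    rcases abs_cases (x i) with ⟨h, -⟩ | ⟨h, -⟩ <;> rw [h]
    · linarith [Real.exp_pos (-(a * d) * x i)]
    · rw [mul_neg, ← neg_mul]
      linarith [Real.exp_pos (a * d * x i)]
  have h5 := Finset.single_le_sum (s := Finset.univ)
    (f := fun i => Real.exp (inner ℝ (EuclideanSpace.single i (a * d)) x) +
      Real.exp (inner ℝ (EuclideanSpace.single i (-(a * d))) x))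
    (fun j _ => by positivity) (Finset.mem_univ i)
  linarith

theorem measurable_kernel_indicator {Tb : ℝ} (hK : IsVolterraKernel Tb K) (s t b : ℝ) (i : Fin d)
    (j : Fin m) : Measurable fun r => (Ioc t b).indicator (fun r => K s r) r i j := by
  have : (fun r => (Ioc t b).indicator (fun r => K s r) r i j) =
      (Ioc t b).indicator fun r => K s r i j := by
    funext r
    by_cases h : r ∈ Ioc t b <;> simp [h]
  rw [this]
  exact ((hK.measurable i j).comp (measurable_const.prodMk measurable_id)).indicator
    measurableSet_Ioc

/-- The window of integration lies in [0,s], so the supremum in the kernel condition serves for all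
`s`, `t` and `b` at once. -/
theorem IsVolterraKernel.exists_bound {Tb : ℝ} (hK : IsVolterraKernel Tb K) :
    ∃ S : ℝ, 0 ≤ S ∧ ∀ s ∈ Icc 0 Tb, ∀ t b : ℝ, 0 ≤ t →
      ∫⁻ r in Ici (0 : ℝ), ENNReal.ofReal
        (frobenius ((Ioc t (min s b)).indicator (fun r => K s r) r) ^ 2) ≤ ENNReal.ofReal S := by
  refine ⟨(⨆ t ∈ Icc (0 : ℝ) Tb, ∫⁻ r in Icc 0 t,
    ENNReal.ofReal (frobenius (K t r) ^ 2)).toReal, ENNReal.toReal_nonneg, fun s hs t b ht => ?_⟩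
  rw [ENNReal.ofReal_toReal hK.sq_integrable.ne]
  refine le_trans ?_ (le_iSup₂ (f := fun t (_ : t ∈ Icc (0 : ℝ) Tb) =>
    ∫⁻ r in Icc 0 t, ENNReal.ofReal (frobenius (K t r) ^ 2)) s hs)
  have e : ∀ r, ENNReal.ofReal
      (frobenius ((Ioc t (min s b)).indicator (fun r => K s r) r) ^ 2) =
      (Ioc t (min s b)).indicator (fun r => ENNReal.ofReal (frobenius (K s r) ^ 2)) r := by
    intro r
    by_cases h : r ∈ Ioc t (min s b) <;> simp [h]
  simp_rw [e]
  rw [lintegral_indicator measurableSet_Ioc, Measure.restrict_restrict measurableSet_Ioc]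
  refine lintegral_mono_set fun r hr => ?_
  exact ⟨hr.2, hr.1.2.trans (min_le_left _ _)⟩

variable {Tb t b : ℝ} {J : ℝ → Ω → EuclideanSpace ℝ (Fin d)}

/-- Exponential moments of the Volterra process, uniformly in time. -/
theorem IsVolterraIntegral.exists_exp_moment [IsProbabilityMeasure P]
    (hW : IsBrownianMotion P 𝓕 W) (hK : IsVolterraKernel Tb K)
    (hJ : IsVolterraIntegral P W K Tb t b J) (ht : 0 ≤ t) (a : ℝ) (ha : 0 ≤ a) :
    ∃ C : ℝ, 0 ≤ C ∧ ∀ s, ∫⁻ w, ENNReal.ofReal (Real.exp (a * ‖J s w‖)) ∂P ≤ ENNReal.ofReal C := by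
  obtain ⟨S, hS, hbound⟩ := hK.exists_bound
  refine ⟨1 + ∑ i : Fin d, (Real.exp ((a * d) ^ 2 * (1 + S)) + Real.exp ((a * d) ^ 2 * (1 + S))),
    by positivity, fun s => ?_⟩
  by_cases hs : s ∈ Icc t Tb
  · have key : ∀ c : ℝ, c ^ 2 = (a * d) ^ 2 → ∀ i : Fin d,
        ∫⁻ w, ENNReal.ofReal (Real.exp (inner ℝ (EuclideanSpace.single i c) (J s w))) ∂P ≤
          ENNReal.ofReal (Real.exp ((a * d) ^ 2 * (1 + S))) := by
      intro c hc i
      have := (hJ.wiener s hs).lintegral_exp_inner_le hW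
        (measurable_kernel_indicator hK s t (min s b)) (hJ.measurable s) hS
        (hbound s ⟨ht.trans hs.1, hs.2⟩ t b ht) (EuclideanSpace.single i c)
      simpa [hc] using this
    have hm : ∀ ξ : EuclideanSpace ℝ (Fin d), Measurable fun w =>
        ENNReal.ofReal (Real.exp (inner ℝ ξ (J s w))) := fun ξ =>
      (Real.measurable_exp.comp (measurable_const.inner (hJ.measurable s))).ennreal_ofReal
    calc ∫⁻ w, ENNReal.ofReal (Real.exp (a * ‖J s w‖)) ∂P
        ≤ ∫⁻ w, (1 + ∑ i, (ENNReal.ofReal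
              (Real.exp (inner ℝ (EuclideanSpace.single i (a * d)) (J s w))) +
            ENNReal.ofReal
              (Real.exp (inner ℝ (EuclideanSpace.single i (-(a * d))) (J s w))))) ∂P := by
          refine lintegral_mono fun w => ?_
          refine (ENNReal.ofReal_le_ofReal (exp_mul_norm_le a ha _)).trans_eq ?_
          rw [ENNReal.ofReal_add (by positivity) (by positivity),
            ENNReal.ofReal_sum_of_nonneg (fun i _ => by positivity)]
          simp_rw [ENNReal.ofReal_add (Real.exp_pos _).le (Real.exp_pos _).le]
          simp
      _ = 1 + ∑ i, ((∫⁻ w, ENNReal.ofReal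
              (Real.exp (inner ℝ (EuclideanSpace.single i (a * d)) (J s w))) ∂P) +
            ∫⁻ w, ENNReal.ofReal
              (Real.exp (inner ℝ (EuclideanSpace.single i (-(a * d))) (J s w))) ∂P) := by
          rw [lintegral_add_left measurable_const, lintegral_finsetSum _ fun i _ => by
            exact (hm _).add (hm _)]
          simp_rw [lintegral_add_left (hm _)]
          simp
      _ ≤ 1 + ∑ i : Fin d, (ENNReal.ofReal (Real.exp ((a * d) ^ 2 * (1 + S))) +
            ENNReal.ofReal (Real.exp ((a * d) ^ 2 * (1 + S)))) := by
          gcongr with i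
          · exact key _ rfl i
          · exact key _ (by ring) i
      _ = _ := by
          rw [ENNReal.ofReal_add (by positivity) (by positivity),
            ENNReal.ofReal_sum_of_nonneg (fun i _ => by positivity)]
          simp_rw [ENNReal.ofReal_add (Real.exp_pos _).le (Real.exp_pos _).le]
          simp
  · simp only [hJ.zero_off s hs, norm_zero, mul_zero, Real.exp_zero, ENNReal.ofReal_one,
      lintegral_const, measure_univ, mul_one]
    rw [← ENNReal.ofReal_one]
    refine ENNReal.ofReal_le_ofReal ?_
    have : 0 ≤ ∑ i : Fin d,
      (Real.exp ((a * d) ^ 2 * (1 + S)) + Real.exp ((a * d) ^ 2 * (1 + S))) := by positivity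
    linarith

/-- A process continuous in time and measurable in ω is jointly measurable. Composing with the
projection onto [t,Tb] makes the paths continuous on all of ℝ, and an indicator then restores the
zero values outside. -/
theorem IsVolterraIntegral.measurable_uncurry (hJ : IsVolterraIntegral P W K Tb t b J) :
    Measurable (Function.uncurry J) := by
  by_cases htb : t ≤ Tb
  · let J' : ℝ → Ω → EuclideanSpace ℝ (Fin d) := fun s w => J (projIcc t Tb htb s) w
    have h1 : Measurable (Function.uncurry J') := by
      refine measurable_uncurry_of_continuous_of_measurable (fun w => ?_)
        (fun s => hJ.measurable _)
      exact (continuousOn_iff_continuous_domRestrict.1 (hJ.continuous w)).comp continuous_projIcc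
    have h2 : Function.uncurry J = (Icc t Tb ×ˢ univ).indicator (Function.uncurry J') := by
      funext ⟨s, w⟩
      by_cases hs : s ∈ Icc t Tb
      · simp [indicator, hs, J', projIcc_of_mem htb hs, Function.uncurry]
      · simp [indicator, hs, hJ.zero_off s hs w, Function.uncurry]
    rw [h2]
    exact h1.indicator (measurableSet_Icc.prod MeasurableSet.univ)
  · have : Function.uncurry J = fun _ => 0 := by
      funext ⟨s, w⟩
      refine hJ.zero_off s (fun h => htb (h.1.trans h.2)) w
    rw [this]
    exact measurable_const

theorem IsVolterraIntegral.exists_norm_le (hJ : IsVolterraIntegral P W K Tb t b J) (w : Ω) :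
    ∃ R : ℝ, ∀ s, ‖J s w‖ ≤ R := by
  obtain ⟨R, hR⟩ := isCompact_Icc.exists_bound_of_continuousOn (hJ.continuous w)
  refine ⟨max R 0, fun s => ?_⟩
  by_cases hs : s ∈ Icc t Tb
  · exact (hR s hs).trans (le_max_left _ _)
  · simp [hJ.zero_off s hs w]

theorem IsVolterraIntegral.indep [IsProbabilityMeasure P]
    (hW : IsBrownianMotion P 𝓕 W) (hJ : IsVolterraIntegral P W K Tb t b J) (ht : 0 ≤ t) (s : ℝ) :
    Indep (MeasurableSpace.comap (J s) inferInstance) (𝓕 t.toNNReal) P := by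
  by_cases hs : s ∈ Icc t Tb
  · refine (hJ.wiener s hs).indep hW (hJ.measurable s) fun r hr => ?_
    rw [Real.coe_toNNReal t ht] at hr
    exact indicator_of_notMem (fun h => absurd h.1 (not_lt.2 hr)) _
  · have : J s = fun _ => 0 := funext fun w => hJ.zero_off s hs w
    rw [this, MeasurableSpace.comap_const]
    exact indep_bot_left _

theorem IsVolterraIntegral.aestronglyMeasurable [IsProbabilityMeasure P]
    (hW : IsBrownianMotion P 𝓕 W) (hJ : IsVolterraIntegral P W K Tb t b J) (hb : 0 ≤ b) (s : ℝ) :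
    AEStronglyMeasurable[𝓕 b.toNNReal] (J s) P := by
  by_cases hs : s ∈ Icc t Tb
  · refine (hJ.wiener s hs).aestronglyMeasurable hW (hJ.measurable s) fun r hr => ?_
    rw [Real.coe_toNNReal b hb] at hr
    exact indicator_of_notMem (fun h => absurd (h.2.trans (min_le_right _ _)) (not_le.2 hr)) _
  · have : J s = fun _ => 0 := funext fun w => hJ.zero_off s hs w
    rw [this]
    exact aestronglyMeasurable_const

/-- The Volterra integral splits at an intermediate time `T`. -/
theorem volterraIntegral_split [IsProbabilityMeasure P] {T : ℝ}
    (hW : IsBrownianMotion P 𝓕 W) (hK : IsVolterraKernel Tb K) (htT : t ≤ T)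
    {J J₁ J₂ : ℝ → Ω → EuclideanSpace ℝ (Fin d)}
    (hJ : IsVolterraIntegral P W K Tb t Tb J) (hJ₁ : IsVolterraIntegral P W K Tb t T J₁)
    (hJ₂ : IsVolterraIntegral P W K Tb T Tb J₂) (s : ℝ) :
    ∀ᵐ w ∂P, J s w = J₁ s w + J₂ s w := by
  by_cases hs : s ∈ Icc t Tb
  · have hWm := hW.measurable
    by_cases hsT : s < T
    · have h0 : ∀ w, J₂ s w = 0 := fun w => hJ₂.zero_off s (fun h => absurd h.1 (not_le.2 hsT)) w
      -- Before `T` both integrals run over (t,s], so their difference has zero integrand.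
      have h1 := IsWienerIntegral.add hWm (hJ.measurable s) (hJ₁.measurable s).neg
        (measurable_kernel_indicator hK s t _) (hJ.wiener s hs) (hJ₁.wiener s hs).neg
      filter_upwards [h1.ae_eq_zero hW ((hJ.measurable s).add (hJ₁.measurable s).neg) fun r => by
        rw [min_eq_left hs.2, min_eq_left hsT.le, add_neg_cancel]] with w hw
      rw [h0, add_zero]
      exact add_neg_eq_zero.1 hw
    · have hsT := not_lt.1 hsT
      have hs2 : s ∈ Icc T Tb := ⟨hsT, hs.2⟩
      -- From `T` on, (t,s] is the disjoint union of (t,T] and (T,s], and again the difference has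
      -- zero integrand.
      have h1 := IsWienerIntegral.add hWm (hJ₁.measurable s) (hJ₂.measurable s)
        (measurable_kernel_indicator hK s t _) (hJ₁.wiener s hs) (hJ₂.wiener s hs2)
      have h2 := IsWienerIntegral.add hWm (hJ.measurable s)
        ((hJ₁.measurable s).add (hJ₂.measurable s)).neg
        (measurable_kernel_indicator hK s t _) (hJ.wiener s hs) h1.neg
      filter_upwards [h2.ae_eq_zero hW ((hJ.measurable s).add
        ((hJ₁.measurable s).add (hJ₂.measurable s)).neg) fun r => by
          rw [min_eq_left hs.2, min_eq_right hsT]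
          by_cases hr : r ≤ T
          · have h3 : r ∉ Ioc T s := fun h => absurd h.1 (not_lt.2 hr)
            have h4 : r ∈ Ioc t s ↔ r ∈ Ioc t T :=
              ⟨fun h => ⟨h.1, hr⟩, fun h => ⟨h.1, h.2.trans hsT⟩⟩
            by_cases h5 : r ∈ Ioc t T
            · rw [indicator_of_mem h5, indicator_of_notMem h3, indicator_of_mem (h4.2 h5)]
              simp
            · rw [indicator_of_notMem h5, indicator_of_notMem h3,
                indicator_of_notMem (fun h => h5 (h4.1 h))]
              simp
          · have hr' := not_le.1 hr
            have h3 : r ∉ Ioc t T := fun h => hr h.2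
            have h4 : r ∈ Ioc t s ↔ r ∈ Ioc T s :=
              ⟨fun h => ⟨hr', h.2⟩, fun h => ⟨htT.trans_lt h.1, h.2⟩⟩
            by_cases h5 : r ∈ Ioc T s
            · rw [indicator_of_mem h5, indicator_of_notMem h3, indicator_of_mem (h4.2 h5)]
              simp
            · rw [indicator_of_notMem h5, indicator_of_notMem h3,
                indicator_of_notMem (fun h => h5 (h4.1 h))]
              simp] with w hw
      exact add_neg_eq_zero.1 hw
  · refine ae_of_all _ fun w => ?_
    rw [hJ.zero_off s hs, hJ₁.zero_off s hs,
      hJ₂.zero_off s fun h => hs ⟨htT.trans h.1, h.2⟩, add_zero]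

end VolterraProcess

/-! ### Taylor's formula with quadratic remainder. -/

section Taylor

/-- Second-order Taylor estimate. -/
theorem norm_sub_sub_fderiv_le {E V : Type*} [NormedAddCommGroup E] [NormedSpace ℝ E]
    [NormedAddCommGroup V] [NormedSpace ℝ V] {ψ : E → V} (hψ : ContDiff ℝ 2 ψ) {x y : E} {N : ℝ}
    (h : ∀ z ∈ segment ℝ x (x + y), ‖iteratedFDeriv ℝ 2 ψ z‖ ≤ N) :
    ‖ψ (x + y) - ψ x - fderiv ℝ ψ x y‖ ≤ N * ‖y‖ ^ 2 := by
  replace h : ∀ z ∈ segment ℝ x (x + y), ‖fderiv ℝ (fderiv ℝ ψ) z‖ ≤ N := fun z hz => by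
    rw [← norm_iteratedFDeriv_zero (𝕜 := ℝ) (f := fderiv ℝ (fderiv ℝ ψ)) (x := z),
      norm_iteratedFDeriv_fderiv, norm_iteratedFDeriv_fderiv]
    exact h z hz
  have hN : 0 ≤ N := (norm_nonneg (fderiv ℝ (fderiv ℝ ψ) x)).trans (h x (left_mem_segment ℝ x _))
  have h1 : ContDiff ℝ 1 (fderiv ℝ ψ) := hψ.fderiv_right (by norm_num)
  have hconv := convex_segment (𝕜 := ℝ) x (x + y)
  -- The mean value inequality is used twice on the segment, for the derivative and then for `ψ`; it
  -- gives N in place of the sharp N/2.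
  have h2 : ∀ z ∈ segment ℝ x (x + y), ‖fderiv ℝ ψ z - fderiv ℝ ψ x‖ ≤ N * ‖y‖ := by
    intro z hz
    have h3 := hconv.norm_image_sub_le_of_norm_fderiv_le (f := fderiv ℝ ψ)
      (fun z _ => (h1.differentiable (by norm_num)) z) h (left_mem_segment ℝ x _) hz
    refine h3.trans (mul_le_mul_of_nonneg_left ?_ hN)
    obtain ⟨c, hc, rfl⟩ := (segment_eq_image' ℝ x (x + y)) ▸ hz
    simp only [add_sub_cancel_left, norm_smul, Real.norm_eq_abs, abs_of_nonneg hc.1]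
    exact mul_le_of_le_one_left (norm_nonneg _) hc.2
  have h4 := hconv.norm_image_sub_le_of_norm_fderiv_le' (f := ψ) (φ := fderiv ℝ ψ x)
    (fun z _ => (hψ.differentiable (by norm_num)) z) h2 (left_mem_segment ℝ x _)
    (right_mem_segment ℝ x _)
  rw [add_sub_cancel_left] at h4
  refine h4.trans_eq ?_
  ring

end Taylor

/-! ### Taylor families with exponential growth. -/

section Families

variable {d : ℕ}

/-- A measurable family of functions with measurable first and second derivatives, exponential
growth and locally uniform Taylor estimates. -/
structure TaylorFamily (g : ℝ → EuclideanSpace ℝ (Fin d) → ℝ)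
    (g₁ : ℝ → EuclideanSpace ℝ (Fin d) → EuclideanSpace ℝ (Fin d) →L[ℝ] ℝ)
    (g₂ : ℝ → EuclideanSpace ℝ (Fin d) →
      EuclideanSpace ℝ (Fin d) →L[ℝ] EuclideanSpace ℝ (Fin d) →L[ℝ] ℝ) (C κ : ℝ) : Prop where
  measurable₀ : Measurable (Function.uncurry g)
  measurable₁ : Measurable (Function.uncurry g₁)
  measurable₂ : Measurable (Function.uncurry g₂)
  bound₀ : ∀ s x, ‖g s x‖ ≤ C * Real.exp (κ * ‖x‖)
  bound₁ : ∀ s x, ‖g₁ s x‖ ≤ C * Real.exp (κ * ‖x‖)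
  bound₂ : ∀ s x, ‖g₂ s x‖ ≤ C * Real.exp (κ * ‖x‖)
  taylor₀ : ∀ s x y, ‖y‖ ≤ 1 →
    ‖g s (x + y) - g s x - g₁ s x y‖ ≤ C * Real.exp (κ * ‖x‖) * ‖y‖ ^ 2
  taylor₁ : ∀ s x y, ‖y‖ ≤ 1 →
    ‖g₁ s (x + y) - g₁ s x - g₂ s x y‖ ≤ C * Real.exp (κ * ‖x‖) * ‖y‖ ^ 2

theorem abs_coord_le_norm (x : EuclideanSpace ℝ (Fin d)) (i : Fin d) : x i ≤ ‖x‖ :=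
  (le_abs_self _).trans (PiLp.norm_apply_le x i)

/-- The growth condition of `CExp`, uniformly in the order of the derivative. -/
theorem CExp.exists_bound {n : ℕ} {F : Set ℝ} {f : ℝ → EuclideanSpace ℝ (Fin d) → ℝ} {Tb : ℝ}
    (hf : CExp n F f) (hF : F ⊆ Icc 0 Tb) :
    ∃ C κ : ℝ, 0 ≤ C ∧ 0 ≤ κ ∧ ∀ k ≤ n, ∀ s ∈ F, ∀ x,
      ‖iteratedFDeriv ℝ k (f s) x‖ ≤ C * Real.exp (κ * ‖x‖) := by
  have h := fun k hk => (hf.2 k hk).2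
  choose! C κ hC hκ hb using h
  -- Sums over the orders replace maxima. The factor e^{κs} is absorbed by s ≤ Tb, and d counts the
  -- coordinates, each bounded by the norm.
  refine ⟨∑ k ∈ Finset.range (n + 1), |C k| * (1 + Real.exp (|κ k| * Tb) * d),
    ∑ k ∈ Finset.range (n + 1), |κ k|, by positivity, by positivity, fun k hk s hs x => ?_⟩
  have hk' : k ∈ Finset.range (n + 1) := Finset.mem_range.2 (Nat.lt_succ_of_le hk)
  have h1 := Finset.single_le_sum (f := fun k => |C k| * (1 + Real.exp (|κ k| * Tb) * d))
    (fun k _ => by positivity) hk'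
  have h2 := Finset.single_le_sum (f := fun k => |κ k|) (fun k _ => abs_nonneg _) hk'
  refine (hb k hk s hs x).trans ?_
  rw [abs_of_pos (hC k hk), abs_of_pos (hκ k hk)] at h1
  rw [abs_of_pos (hκ k hk)] at h2
  have h3 : C k * (1 + Real.exp (κ k * s) * ∑ i, Real.exp (κ k * x i)) ≤
      C k * (1 + Real.exp (κ k * Tb) * d) * Real.exp (κ k * ‖x‖) := by
    rw [mul_assoc]
    refine mul_le_mul_of_nonneg_left ?_ (hC k hk).le
    have h4 : ∑ i, Real.exp (κ k * x i) ≤ d * Real.exp (κ k * ‖x‖) := by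
      refine (Finset.sum_le_sum fun i _ => Real.exp_le_exp.2
        (mul_le_mul_of_nonneg_left (abs_coord_le_norm x i) (hκ k hk).le)).trans ?_
      simp
    have h5 : Real.exp (κ k * s) ≤ Real.exp (κ k * Tb) :=
      Real.exp_le_exp.2 (mul_le_mul_of_nonneg_left (hF hs).2 (hκ k hk).le)
    have h6 : (1 : ℝ) ≤ Real.exp (κ k * ‖x‖) :=
      Real.one_le_exp (mul_nonneg (hκ k hk).le (norm_nonneg _))
    have h7 : Real.exp (κ k * s) * ∑ i, Real.exp (κ k * x i) ≤
        Real.exp (κ k * Tb) * (d * Real.exp (κ k * ‖x‖)) :=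
      mul_le_mul h5 h4 (Finset.sum_nonneg fun _ _ => (Real.exp_pos _).le) (Real.exp_pos _).le
    linarith
  refine h3.trans (mul_le_mul h1 (Real.exp_le_exp.2
    (mul_le_mul_of_nonneg_right h2 (norm_nonneg _))) (Real.exp_pos _).le (by positivity))

open scoped Classical in
/-- The family `f` set to zero off its time support. -/
noncomputable def cutFamily (Tb : ℝ) (f : ℝ → EuclideanSpace ℝ (Fin d) → ℝ) (s : ℝ) :
    EuclideanSpace ℝ (Fin d) → ℝ :=
  if s ∈ timeSupport Tb f then f s else 0

/-- At a time of [0,Tb] off the support `f s` is already zero, so the cut acts only outside [0,Tb].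
-/
theorem cutFamily_eq {Tb : ℝ} {f : ℝ → EuclideanSpace ℝ (Fin d) → ℝ} {s : ℝ}
    (hs : s ∈ Icc 0 Tb) : cutFamily Tb f s = f s := by
  by_cases h : s ∈ timeSupport Tb f
  · simp [cutFamily, h]
  · simp only [cutFamily, h, if_false]
    funext x
    by_contra hx
    exact h ⟨hs, x, fun h0 => hx h0.symm⟩

/-- On the support `f s` is continuous, so a nonzero value is already seen on a countable dense set
of points. -/
theorem measurableSet_timeSupport {n : ℕ} {Tb : ℝ} {f : ℝ → EuclideanSpace ℝ (Fin d) → ℝ}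
    (hf_meas : Measurable fun p : ℝ × EuclideanSpace ℝ (Fin d) => f p.1 p.2)
    (hf : CExp n (timeSupport Tb f) f) : MeasurableSet (timeSupport Tb f) := by
  have : timeSupport Tb f = Icc 0 Tb ∩
      ⋃ k : ℕ, {s | f s (TopologicalSpace.denseSeq (EuclideanSpace ℝ (Fin d)) k) ≠ 0} := by
    ext s
    constructor
    · rintro ⟨hs, x, hx⟩
      refine ⟨hs, ?_⟩
      have hc : Continuous (f s) := (hf.1 s ⟨hs, x, hx⟩).continuous
      have ho : IsOpen {y | f s y ≠ 0} := isOpen_ne_fun hc continuous_const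
      obtain ⟨k, hk⟩ := (TopologicalSpace.denseRange_denseSeq
        (EuclideanSpace ℝ (Fin d))).exists_mem_open ho ⟨x, hx⟩
      exact mem_iUnion.2 ⟨k, hk⟩
    · rintro ⟨hs, hx⟩
      obtain ⟨k, hk⟩ := mem_iUnion.1 hx
      exact ⟨hs, _, hk⟩
  rw [this]
  refine measurableSet_Icc.inter (MeasurableSet.iUnion fun k => ?_)
  exact (measurableSet_eq_fun (hf_meas.comp (measurable_id.prodMk measurable_const))
    measurable_const).compl

theorem measurable_of_continuousOn_prod {V : Type*} [NormedAddCommGroup V] [MeasurableSpace V]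
    [BorelSpace V] {F : Set ℝ} (hF : MeasurableSet F) {h : ℝ → EuclideanSpace ℝ (Fin d) → V}
    (hc : ContinuousOn (fun p : ℝ × EuclideanSpace ℝ (Fin d) => h p.1 p.2) (F ×ˢ univ))
    (h0 : ∀ s ∉ F, ∀ x, h s x = 0) : Measurable (Function.uncurry h) := by
  classical
  have : Function.uncurry h = (F ×ˢ univ).piecewise (fun p => h p.1 p.2) fun _ => 0 := by
    funext ⟨s, x⟩
    by_cases hs : s ∈ F
    · simp [piecewise, hs, Function.uncurry]
    · simp [piecewise, hs, Function.uncurry, h0 s hs x]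
  rw [this]
  exact hc.measurable_piecewise continuousOn_const (hF.prod MeasurableSet.univ)

/-- Currying is a continuous isometry, so joint continuity of iterated derivatives passes to
iterated derivatives of `fderiv`. -/
theorem continuousOn_fderiv_of_iteratedFDeriv {V : Type*} [NormedAddCommGroup V]
    [NormedSpace ℝ V] {F : Set ℝ} {h : ℝ → EuclideanSpace ℝ (Fin d) → V} {n : ℕ}
    (hc : ContinuousOn (fun p : ℝ × EuclideanSpace ℝ (Fin d) =>
      iteratedFDeriv ℝ (n + 1) (h p.1) p.2) (F ×ˢ univ)) :
    ContinuousOn (fun p : ℝ × EuclideanSpace ℝ (Fin d) =>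
      iteratedFDeriv ℝ n (fderiv ℝ (h p.1)) p.2) (F ×ˢ univ) := by
  have h1 := (continuousMultilinearCurryRightEquiv' ℝ n
    (EuclideanSpace ℝ (Fin d)) V).continuous.comp_continuousOn hc
  refine h1.congr fun p _ => ?_
  simp only [Function.comp_apply]
  rw [iteratedFDeriv_succ_eq_comp_right]
  simp

theorem continuousOn_of_iteratedFDeriv_zero {V : Type*} [NormedAddCommGroup V]
    [NormedSpace ℝ V] {F : Set ℝ} {h : ℝ → EuclideanSpace ℝ (Fin d) → V}
    (hc : ContinuousOn (fun p : ℝ × EuclideanSpace ℝ (Fin d) =>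
      iteratedFDeriv ℝ 0 (h p.1) p.2) (F ×ˢ univ)) :
    ContinuousOn (fun p : ℝ × EuclideanSpace ℝ (Fin d) => h p.1 p.2) (F ×ˢ univ) := by
  have h1 := (continuousMultilinearCurryFin0 ℝ
    (EuclideanSpace ℝ (Fin d)) V).continuous.comp_continuousOn hc
  refine h1.congr fun p _ => ?_
  simp

/-- A family in `C^{0,3}_exp` is a Taylor family after cutting it off in time. -/
theorem CExp.exists_taylorFamily {Tb : ℝ} {f : ℝ → EuclideanSpace ℝ (Fin d) → ℝ}
    (hf_meas : Measurable fun p : ℝ × EuclideanSpace ℝ (Fin d) => f p.1 p.2)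
    (hf : CExp 3 (timeSupport Tb f) f) :
    ∃ C κ : ℝ, 0 ≤ C ∧ 0 ≤ κ ∧ TaylorFamily (cutFamily Tb f)
      (fun s => fderiv ℝ (cutFamily Tb f s))
      (fun s => fderiv ℝ (fderiv ℝ (cutFamily Tb f s))) C κ := by
  obtain ⟨C, κ, hC, hκ, hb⟩ := hf.exists_bound (Tb := Tb) fun s hs => hs.1
  have hF := measurableSet_timeSupport hf_meas hf
  have hin : ∀ s ∈ timeSupport Tb f, cutFamily Tb f s = f s := fun s hs => cutFamily_eq hs.1
  have hout : ∀ s ∉ timeSupport Tb f, cutFamily Tb f s = 0 := fun s hs => by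
    simp [cutFamily, hs]
  have hout1 : ∀ s ∉ timeSupport Tb f, fderiv ℝ (cutFamily Tb f s) = 0 := fun s hs => by
    rw [hout s hs]; simp
  have hout2 : ∀ s ∉ timeSupport Tb f, fderiv ℝ (fderiv ℝ (cutFamily Tb f s)) = 0 := fun s hs => by
    rw [hout1 s hs]; simp
  -- The factor e^κ pays for moving by a vector of norm at most 1 along the Taylor segment; the same
  -- constant is then used for all bounds.
  have hC' : C ≤ C * Real.exp κ := le_mul_of_one_le_right hC (Real.one_le_exp hκ)
  have hb' : ∀ k ≤ 3, ∀ s ∈ timeSupport Tb f, ∀ x,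
      ‖iteratedFDeriv ℝ k (f s) x‖ ≤ C * Real.exp κ * Real.exp (κ * ‖x‖) := fun k hk s hs x =>
    (hb k hk s hs x).trans (mul_le_mul_of_nonneg_right hC' (Real.exp_pos _).le)
  have hseg : ∀ k ≤ 3, ∀ s ∈ timeSupport Tb f, ∀ x y, ‖y‖ ≤ 1 → ∀ z ∈ segment ℝ x (x + y),
      ‖iteratedFDeriv ℝ k (f s) z‖ ≤ C * Real.exp κ * Real.exp (κ * ‖x‖) := by
    intro k hk s hs x y hy z hz
    refine (hb k hk s hs z).trans ?_
    rw [mul_assoc, ← Real.exp_add]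
    refine mul_le_mul_of_nonneg_left (Real.exp_le_exp.2 ?_) hC
    obtain ⟨c, hc, rfl⟩ := (segment_eq_image' ℝ x (x + y)) ▸ hz
    have h1 : ‖x + c • (x + y - x)‖ ≤ ‖x‖ + 1 := by
      refine (norm_add_le _ _).trans (add_le_add le_rfl ?_)
      rw [add_sub_cancel_left, norm_smul, Real.norm_eq_abs, abs_of_nonneg hc.1]
      exact mul_le_one₀ hc.2 (norm_nonneg _) hy
    nlinarith [mul_le_mul_of_nonneg_left h1 hκ]
  have e2 : ∀ (s : ℝ) (x : EuclideanSpace ℝ (Fin d)),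
      ‖fderiv ℝ (fderiv ℝ (f s)) x‖ = ‖iteratedFDeriv ℝ 2 (f s) x‖ := fun s x => by
    rw [← norm_iteratedFDeriv_fderiv, ← norm_iteratedFDeriv_fderiv, norm_iteratedFDeriv_zero]
  have hpos : ∀ x : EuclideanSpace ℝ (Fin d), 0 ≤ C * Real.exp κ * Real.exp (κ * ‖x‖) :=
    fun x => by positivity
  refine ⟨C * Real.exp κ, κ, by positivity, hκ, ?_, ?_, ?_, ?_, ?_, ?_, ?_, ?_⟩
  · refine measurable_of_continuousOn_prod hF ?_ fun s hs x => by rw [hout s hs]; rfl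
    refine (continuousOn_of_iteratedFDeriv_zero (hf.2 0 (by norm_num)).1).congr fun p hp => ?_
    simp only [hin p.1 hp.1]
  · refine measurable_of_continuousOn_prod hF ?_ fun s hs x => by rw [hout1 s hs]; rfl
    refine (continuousOn_of_iteratedFDeriv_zero (h := fun s => fderiv ℝ (f s))
      (continuousOn_fderiv_of_iteratedFDeriv (hf.2 1 (by norm_num)).1)).congr fun p hp => ?_
    simp only [hin p.1 hp.1]
  · refine measurable_of_continuousOn_prod hF ?_ fun s hs x => by rw [hout2 s hs]; rfl
    refine (continuousOn_of_iteratedFDeriv_zero (h := fun s => fderiv ℝ (fderiv ℝ (f s)))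
      (continuousOn_fderiv_of_iteratedFDeriv (h := fun s => fderiv ℝ (f s))
      (continuousOn_fderiv_of_iteratedFDeriv (hf.2 2 (by norm_num)).1))).congr fun p hp => ?_
    simp only [hin p.1 hp.1]
  · intro s x
    by_cases hs : s ∈ timeSupport Tb f
    · rw [hin s hs, ← norm_iteratedFDeriv_zero (𝕜 := ℝ)]
      exact hb' 0 (by norm_num) s hs x
    · simpa [hout s hs] using hpos x
  · intro s x
    by_cases hs : s ∈ timeSupport Tb f
    · rw [hin s hs, ← norm_iteratedFDeriv_zero (𝕜 := ℝ), norm_iteratedFDeriv_fderiv]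
      exact hb' 1 (by norm_num) s hs x
    · simpa [hout1 s hs] using hpos x
  · intro s x
    by_cases hs : s ∈ timeSupport Tb f
    · rw [hin s hs, e2]
      exact hb' 2 (by norm_num) s hs x
    · rw [hout2 s hs]
      exact (norm_zero (E := EuclideanSpace ℝ (Fin d) →L[ℝ]
        EuclideanSpace ℝ (Fin d) →L[ℝ] ℝ)).le.trans (hpos x)
  · intro s x y hy
    by_cases hs : s ∈ timeSupport Tb f
    · rw [hin s hs]
      refine norm_sub_sub_fderiv_le ((hf.1 s hs).of_le (by norm_num)) fun z hz => ?_
      exact hseg 2 (by norm_num) s hs x y hy z hz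
    · rw [hout s hs]
      simpa using mul_nonneg (hpos x) (sq_nonneg ‖y‖)
  · intro s x y hy
    by_cases hs : s ∈ timeSupport Tb f
    · rw [hin s hs]
      -- Taylor's formula for the gradient, where the third derivative of f enters.
      refine norm_sub_sub_fderiv_le ((hf.1 s hs).fderiv_right (by norm_num)) fun z hz => ?_
      rw [norm_iteratedFDeriv_fderiv]
      exact hseg 3 (by norm_num) s hs x y hy z hz
    · rw [hout1 s hs]
      simpa using mul_nonneg (hpos x) (sq_nonneg ‖y‖)

end Families

/-! ### Averaging over an independent noise. -/

section Averaging

variable {Ω : Type*} {mΩ : MeasurableSpace Ω} {P : Measure Ω} {d : ℕ} {V : Type*}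
  [NormedAddCommGroup V] [NormedSpace ℝ V]

/-- `(s,x) ↦ E[h_s(x + I_s)]`. -/
noncomputable def average (P : Measure Ω) (I : ℝ → Ω → EuclideanSpace ℝ (Fin d))
    (h : ℝ → EuclideanSpace ℝ (Fin d) → V) (s : ℝ) (x : EuclideanSpace ℝ (Fin d)) : V :=
  ∫ w, h s (x + I s w) ∂P

variable [MeasurableSpace V] [BorelSpace V] [SecondCountableTopology V]
  {I : ℝ → Ω → EuclideanSpace ℝ (Fin d)} {h : ℝ → EuclideanSpace ℝ (Fin d) → V}

theorem measurable_average [SFinite P] (hI : Measurable (Function.uncurry I))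
    (hh : Measurable (Function.uncurry h)) :
    Measurable (Function.uncurry (average P I h)) := by
  have h1 : Measurable fun q : (ℝ × EuclideanSpace ℝ (Fin d)) × Ω =>
      h q.1.1 (q.1.2 + I q.1.1 q.2) :=
    hh.comp (measurable_fst.fst.prodMk (measurable_fst.snd.add
      (hI.comp (measurable_fst.fst.prodMk measurable_snd))))
  exact (StronglyMeasurable.integral_prod_right' h1.stronglyMeasurable).measurable

theorem measurable_section (hh : Measurable (Function.uncurry h)) (s : ℝ) : Measurable (h s) :=
  hh.comp (measurable_const.prodMk measurable_id)

theorem integrable_exp_of_lintegral_le {X : Ω → EuclideanSpace ℝ (Fin d)} (hX : Measurable X)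
    {κ C : ℝ} (hC : ∫⁻ w, ENNReal.ofReal (Real.exp (κ * ‖X w‖)) ∂P ≤ ENNReal.ofReal C) :
    Integrable (fun w => Real.exp (κ * ‖X w‖)) P := by
  refine ⟨(Real.measurable_exp.comp (hX.norm.const_mul κ)).aestronglyMeasurable, ?_⟩
  rw [hasFiniteIntegral_iff_ofReal (ae_of_all _ fun _ => (Real.exp_pos _).le)]
  exact hC.trans_lt ENNReal.ofReal_lt_top

theorem integral_exp_le {X : Ω → EuclideanSpace ℝ (Fin d)} (hX : Measurable X)
    {κ C : ℝ} (h0 : 0 ≤ C)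
    (hC : ∫⁻ w, ENNReal.ofReal (Real.exp (κ * ‖X w‖)) ∂P ≤ ENNReal.ofReal C) :
    ∫ w, Real.exp (κ * ‖X w‖) ∂P ≤ C := by
  rw [← ENNReal.ofReal_le_ofReal_iff h0, ofReal_integral_eq_lintegral_ofReal
    (integrable_exp_of_lintegral_le hX hC) (ae_of_all _ fun _ => (Real.exp_pos _).le)]
  exact hC

theorem exp_norm_add_le {κ : ℝ} (hκ : 0 ≤ κ) (x y : EuclideanSpace ℝ (Fin d)) :
    Real.exp (κ * ‖x + y‖) ≤ Real.exp (κ * ‖x‖) * Real.exp (κ * ‖y‖) := by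
  rw [← Real.exp_add, Real.exp_le_exp, ← mul_add]
  exact mul_le_mul_of_nonneg_left (norm_add_le _ _) hκ

theorem integrable_comp_add {κ C D : ℝ} (hκ : 0 ≤ κ) (hC : 0 ≤ C) {X : Ω → EuclideanSpace ℝ (Fin d)}
    (hX : Measurable X)
    (hD : ∫⁻ w, ENNReal.ofReal (Real.exp (κ * ‖X w‖)) ∂P ≤ ENNReal.ofReal D)
    {h : EuclideanSpace ℝ (Fin d) → V} (hh : Measurable h)
    (hb : ∀ x, ‖h x‖ ≤ C * Real.exp (κ * ‖x‖)) (x : EuclideanSpace ℝ (Fin d)) :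
    Integrable (fun w => h (x + X w)) P := by
  refine Integrable.mono' ((integrable_exp_of_lintegral_le hX hD).const_mul
    (C * Real.exp (κ * ‖x‖))) (hh.comp (measurable_const.add hX)).aestronglyMeasurable
    (ae_of_all _ fun w => ?_)
  refine (hb _).trans ?_
  rw [mul_assoc]
  exact mul_le_mul_of_nonneg_left (exp_norm_add_le hκ _ _) hC

/-- The exponential weight is submultiplicative, so averaging over the shift costs only the moment
`D`. The integrand is arbitrary in order to cover values, derivatives and Taylor remainders alike.
-/
theorem norm_integral_comp_add_le {κ C D : ℝ} (hκ : 0 ≤ κ) (hC : 0 ≤ C) (hD0 : 0 ≤ D)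
    {X : Ω → EuclideanSpace ℝ (Fin d)} (hX : Measurable X)
    (hD : ∫⁻ w, ENNReal.ofReal (Real.exp (κ * ‖X w‖)) ∂P ≤ ENNReal.ofReal D)
    {x : EuclideanSpace ℝ (Fin d)} {h : Ω → V}
    (hb : ∀ w, ‖h w‖ ≤ C * Real.exp (κ * ‖x + X w‖)) :
    ‖∫ w, h w ∂P‖ ≤ C * D * Real.exp (κ * ‖x‖) := by
  have hi := integrable_exp_of_lintegral_le hX hD
  refine (norm_integral_le_of_norm_le (hi.const_mul (C * Real.exp (κ * ‖x‖)))
    (ae_of_all _ fun w => ?_)).trans ?_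
  · refine (hb w).trans ?_
    rw [mul_assoc]
    exact mul_le_mul_of_nonneg_left (exp_norm_add_le hκ _ _) hC
  · rw [integral_const_mul]
    have := mul_le_mul_of_nonneg_left (integral_exp_le hX hD0 hD)
      (mul_nonneg hC (Real.exp_pos (κ * ‖x‖)).le)
    linarith

/-- Averaging over a process with uniformly bounded exponential moments preserves Taylor
families. -/
theorem TaylorFamily.average {g : ℝ → EuclideanSpace ℝ (Fin d) → ℝ}
    {g₁ : ℝ → EuclideanSpace ℝ (Fin d) → EuclideanSpace ℝ (Fin d) →L[ℝ] ℝ}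
    {g₂ : ℝ → EuclideanSpace ℝ (Fin d) →
      EuclideanSpace ℝ (Fin d) →L[ℝ] EuclideanSpace ℝ (Fin d) →L[ℝ] ℝ} {C κ D : ℝ}
    [SFinite P]
    (hg : TaylorFamily g g₁ g₂ C κ) (hC : 0 ≤ C) (hκ : 0 ≤ κ) (hD0 : 0 ≤ D)
    (hI : Measurable (Function.uncurry I))
    (hD : ∀ s, ∫⁻ w, ENNReal.ofReal (Real.exp (κ * ‖I s w‖)) ∂P ≤ ENNReal.ofReal D) :
    TaylorFamily (average P I g) (average P I g₁) (average P I g₂) (C * D) κ := by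
  have hIs : ∀ s, Measurable (I s) := fun s => hI.comp (measurable_const.prodMk measurable_id)
  have i0 := fun s => integrable_comp_add hκ hC (hIs s) (hD s)
    (measurable_section hg.measurable₀ s) (hg.bound₀ s)
  have i1 := fun s => integrable_comp_add hκ hC (hIs s) (hD s)
    (measurable_section hg.measurable₁ s) (hg.bound₁ s)
  have i2 := fun s => integrable_comp_add hκ hC (hIs s) (hD s)
    (measurable_section hg.measurable₂ s) (hg.bound₂ s)
  refine ⟨measurable_average hI hg.measurable₀, measurable_average hI hg.measurable₁,
    measurable_average hI hg.measurable₂, fun s x => ?_, fun s x => ?_, fun s x => ?_,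
    fun s x y hy => ?_, fun s x y hy => ?_⟩
  · exact norm_integral_comp_add_le hκ hC hD0 (hIs s) (hD s) fun w => hg.bound₀ s _
  · exact norm_integral_comp_add_le hκ hC hD0 (hIs s) (hD s) fun w => hg.bound₁ s _
  · exact norm_integral_comp_add_le hκ hC hD0 (hIs s) (hD s) fun w => hg.bound₂ s _
  -- The remainder of the average is the average of the remainder, so the pointwise estimate carries
  -- over.
  · have e : VolDeriv.average P I g s (x + y) - VolDeriv.average P I g s x -
        VolDeriv.average P I g₁ s x y =
        ∫ w, (g s (x + I s w + y) - g s (x + I s w) - g₁ s (x + I s w) y) ∂P := by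
      have j0 := i0 s (x + y)
      simp_rw [add_right_comm x y] at j0
      rw [integral_sub (show Integrable (fun w => g s (x + I s w + y) - g s (x + I s w)) P from
          j0.sub (i0 s x)) ((i1 s x).apply_continuousLinearMap y),
        integral_sub j0 (i0 s x), ← ContinuousLinearMap.integral_apply (i1 s x)]
      simp only [VolDeriv.average, add_right_comm x y]
    rw [e]
    refine (norm_integral_comp_add_le (C := C * ‖y‖ ^ 2) hκ (by positivity) hD0 (hIs s) (hD s)
      fun w => (hg.taylor₀ s _ y hy).trans_eq (by ring)).trans_eq (by ring)
  · have e : VolDeriv.average P I g₁ s (x + y) - VolDeriv.average P I g₁ s x -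
        VolDeriv.average P I g₂ s x y =
        ∫ w, (g₁ s (x + I s w + y) - g₁ s (x + I s w) - g₂ s (x + I s w) y) ∂P := by
      have j0 := i1 s (x + y)
      simp_rw [add_right_comm x y] at j0
      rw [integral_sub (show Integrable (fun w => g₁ s (x + I s w + y) - g₁ s (x + I s w)) P from
          j0.sub (i1 s x)) ((i2 s x).apply_continuousLinearMap y),
        integral_sub j0 (i1 s x), ← ContinuousLinearMap.integral_apply (i2 s x)]
      simp only [VolDeriv.average, add_right_comm x y]
    rw [e]
    refine (norm_integral_comp_add_le (C := C * ‖y‖ ^ 2) hκ (by positivity) hD0 (hIs s) (hD s)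
      fun w => (hg.taylor₁ s _ y hy).trans_eq (by ring)).trans_eq (by ring)

end Averaging

/-! ### Conditional expectation: parameter integrals and freezing. -/

section CondExp

variable {Ω : Type*} {m mΩ : MeasurableSpace Ω} {P : Measure Ω} [IsProbabilityMeasure P]

theorem ae_norm_condExp_indicator_le (B : Set Ω) :
    ∀ᵐ w ∂P, ‖(P[B.indicator fun _ => (1 : ℝ) | m]) w‖ ≤ 1 := by
  exact ae_bdd_abs_condExp_of_ae_bdd_abs (m := m) (μ := P) (R := (1 : ℝ))
    (f := B.indicator fun _ => (1 : ℝ)) (ae_of_all _ fun w => by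
      by_cases h : w ∈ B <;> simp [h])

/-- Conditional expectation is self-adjoint, tested on an indicator. -/
theorem setIntegral_condExp_eq (hm : m ≤ mΩ) {B : Set Ω} (hB : MeasurableSet[mΩ] B) {y : Ω → ℝ}
    (hy : Integrable y P) :
    ∫ w in B, (P[y | m]) w ∂P =
      ∫ w, (P[B.indicator fun _ => (1 : ℝ) | m]) w * y w ∂P := by
  have hb1 : Integrable (B.indicator fun _ => (1 : ℝ)) P := (integrable_const _).indicator hB
  have hbm : StronglyMeasurable[m] (P[B.indicator fun _ => (1 : ℝ) | m]) :=
    stronglyMeasurable_condExp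
  have hbm' := (hbm.mono hm).aestronglyMeasurable (μ := P)
  have hbd := ae_norm_condExp_indicator_le (m := m) (P := P) B
  have i1 : Integrable ((P[B.indicator fun _ => (1 : ℝ) | m]) * y) P :=
    hy.bdd_mul hbm' hbd
  have i2 : Integrable ((B.indicator fun _ => (1 : ℝ)) * P[y | m]) P :=
    integrable_condExp.bdd_mul hb1.aestronglyMeasurable
      (c := 1) (ae_of_all _ fun w => by by_cases h : w ∈ B <;> simp [h])
  have e1 := condExp_mul_of_stronglyMeasurable_left hbm i1 hy
  have e2 := condExp_mul_of_stronglyMeasurable_right stronglyMeasurable_condExp i2 hb1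
  calc ∫ w in B, (P[y | m]) w ∂P
      = ∫ w, ((B.indicator fun _ => (1 : ℝ)) * P[y | m]) w ∂P := by
        rw [← integral_indicator hB]
        refine integral_congr_ae (ae_of_all _ fun w => ?_)
        by_cases h : w ∈ B <;> simp [h]
    _ = ∫ w, (P[(B.indicator fun _ => (1 : ℝ)) * P[y | m] | m]) w ∂P := (integral_condExp hm).symm
    _ = ∫ w, (P[(P[B.indicator fun _ => (1 : ℝ) | m]) * y | m]) w ∂P :=
        integral_congr_ae (e2.trans e1.symm)
    _ = _ := by rw [integral_condExp hm]; rfl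

/-- Conditional expectation commutes with integration over a parameter. -/
theorem condExp_integral_comm (hm : m ≤ mΩ) {μ : Measure ℝ} [SFinite μ] {y z : ℝ → Ω → ℝ}
    (hy : Integrable (Function.uncurry y) (μ.prod P))
    (hz : Integrable (Function.uncurry z) (μ.prod P))
    (hyz : ∀ᵐ s ∂μ, z s =ᵐ[P] P[y s | m]) :
    P[fun w => ∫ s, y s w ∂μ | m] =ᵐ[P] fun w => ∫ s, z s w ∂μ := by
  have hY : Integrable (fun w => ∫ s, y s w ∂μ) P := hy.integral_prod_right
  have hZ : Integrable (fun w => ∫ s, z s w ∂μ) P := hz.integral_prod_right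
  -- Testing on every event, not only on those of `m`, makes it unnecessary to know that the time
  -- integral of z is `m`-measurable. Self-adjointness moves the conditioning onto 1_B, giving a
  -- bounded factor free of `s`, and Fubini applies.
  refine Integrable.ae_eq_of_forall_setIntegral_eq _ _ integrable_condExp hZ fun B hB _ => ?_
  rw [setIntegral_condExp_eq hm hB hY]
  have hbm : AEStronglyMeasurable (P[B.indicator fun _ => (1 : ℝ) | m]) P :=
    (stronglyMeasurable_condExp.mono hm).aestronglyMeasurable
  have hbd := ae_norm_condExp_indicator_le (m := m) (P := P) B
  set b := P[B.indicator fun _ => (1 : ℝ) | m]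
  have i1 : Integrable (fun q : ℝ × Ω => b q.2 * Function.uncurry y q) (μ.prod P) := by
    refine hy.bdd_mul (c := 1) hbm.comp_snd ?_
    exact Measure.quasiMeasurePreserving_snd.ae hbd
  have i2 : Integrable (Function.uncurry z) (μ.prod (P.restrict B)) := by
    have := hz.restrict (s := univ ×ˢ B)
    rwa [← Measure.prod_restrict, Measure.restrict_univ] at this
  calc ∫ w, b w * ∫ s, y s w ∂μ ∂P = ∫ w, ∫ s, b w * y s w ∂μ ∂P := by
        simp_rw [integral_const_mul]
    _ = ∫ s, ∫ w, b w * y s w ∂P ∂μ := (integral_integral_swap i1).symm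
    _ = ∫ s, ∫ w in B, z s w ∂P ∂μ := by
        refine integral_congr_ae ?_
        filter_upwards [hyz, hy.prod_right_ae] with s hs hys
        rw [← setIntegral_condExp_eq hm hB (show Integrable (y s) P from hys)]
        exact integral_congr_ae (ae_restrict_of_ae hs.symm)
    _ = ∫ w in B, ∫ s, z s w ∂μ ∂P := integral_integral_swap i2

/-- The freezing lemma: the conditional expectation of a function of an `m`-measurable variable
plus an independent one. -/
theorem condExp_comp_add_of_indep {d : ℕ} (hm : m ≤ mΩ) {X I : Ω → EuclideanSpace ℝ (Fin d)}
    (hX : AEStronglyMeasurable[m] X P) (hI : Measurable[mΩ] I)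
    (hind : Indep (MeasurableSpace.comap I inferInstance) m P)
    {h : EuclideanSpace ℝ (Fin d) → ℝ} (hh : Measurable h)
    (hint : Integrable (fun w => h (X w + I w)) P) :
    P[fun w => h (X w + I w) | m] =ᵐ[P] fun w => ∫ w', h (X w + I w') ∂P := by
  obtain ⟨X', hX', hXX'⟩ := hX
  have hX'm : Measurable[m] X' := hX'.measurable
  let Φ : EuclideanSpace ℝ (Fin d) → ℝ := fun x => ∫ w', h (x + I w') ∂P
  have hΦ : Measurable Φ := by
    have : Measurable fun q : EuclideanSpace ℝ (Fin d) × Ω => h (q.1 + I q.2) :=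
      hh.comp (measurable_fst.add (hI.comp measurable_snd))
    exact (StronglyMeasurable.integral_prod_right' this.stronglyMeasurable).measurable
  have hint' : Integrable (fun w => h (X' w + I w)) P := by
    refine hint.congr ?_
    filter_upwards [hXX'] with w hw
    rw [hw]
  have key : ∀ A : Set Ω, MeasurableSet[m] A → IntegrableOn (fun w => Φ (X' w)) A P ∧
      ∫ w in A, Φ (X' w) ∂P = ∫ w in A, h (X' w + I w) ∂P := by
    intro A hA
    -- Carrying the indicator of `A` along with `X'` keeps the pair `m`-measurable, hence
    -- independent of `I`. Fubini for the product law then gives the identity on `A`.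
    let Z : Ω → EuclideanSpace ℝ (Fin d) × ℝ := fun w => (X' w, A.indicator (fun _ => (1 : ℝ)) w)
    have hZ : Measurable[m] Z := hX'm.prodMk (measurable_const.indicator hA)
    have hZ' : Measurable[mΩ] Z := hZ.mono hm le_rfl
    have hZI : IndepFun Z I P := by
      refine Indep.symm ?_
      exact indep_of_indep_of_le_right hind hZ.comap_le
    have hprod := (indepFun_iff_map_prod_eq_prod_map_map hZ'.aemeasurable hI.aemeasurable).1 hZI
    let G : (EuclideanSpace ℝ (Fin d) × ℝ) × EuclideanSpace ℝ (Fin d) → ℝ :=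
      fun q => q.1.2 * h (q.1.1 + q.2)
    have hG : Measurable G :=
      measurable_fst.snd.mul (hh.comp (measurable_fst.fst.add measurable_snd))
    have hGeq : (fun w => G (Z w, I w)) = A.indicator fun w => h (X' w + I w) := by
      funext w
      by_cases hw : w ∈ A <;> simp [G, Z, hw]
    have hGi : Integrable G ((P.map Z).prod (P.map I)) := by
      rw [← hprod, integrable_map_measure hG.aestronglyMeasurable
        (hZ'.prodMk hI).aemeasurable]
      change Integrable (fun w => G (Z w, I w)) P
      rw [hGeq]
      exact hint'.indicator (hm A hA)
    have hinner : ∀ w, ∫ i, G (Z w, i) ∂(P.map I) = A.indicator (fun w => Φ (X' w)) w := by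
      intro w
      have hGw : Measurable fun i => G (Z w, i) :=
        hG.comp (measurable_const.prodMk measurable_id)
      rw [integral_map hI.aemeasurable hGw.aestronglyMeasurable]
      by_cases hw : w ∈ A <;> simp [G, Z, hw, Φ]
    have hGm : AEStronglyMeasurable (fun z => ∫ i, G (z, i) ∂(P.map I)) (P.map Z) :=
      hGi.integral_prod_left.aestronglyMeasurable
    constructor
    · have h1 := hGi.integral_prod_left
      rw [integrable_map_measure hGm hZ'.aemeasurable] at h1
      simp only [Function.comp_def, hinner] at h1
      exact (integrable_indicator_iff (hm A hA)).1 h1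
    · rw [← integral_indicator (hm A hA), ← integral_indicator (hm A hA), ← hGeq]
      have e1 : ∫ w, G (Z w, I w) ∂P = ∫ q, G q ∂((P.map Z).prod (P.map I)) := by
        rw [← hprod, integral_map (hZ'.prodMk hI).aemeasurable hG.aestronglyMeasurable]
      rw [e1, integral_prod _ hGi, integral_map hZ'.aemeasurable hGm]
      exact integral_congr_ae (ae_of_all _ fun w => (hinner w).symm)
  have h1 : (fun w => Φ (X' w)) =ᵐ[P] P[fun w => h (X' w + I w) | m] := by
    refine ae_eq_condExp_of_forall_setIntegral_eq hm hint' (fun A hA _ => (key A hA).1)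
      (fun A hA _ => (key A hA).2) ?_
    exact (hΦ.comp hX'm).stronglyMeasurable.aestronglyMeasurable
  have h2 : P[fun w => h (X w + I w) | m] =ᵐ[P] P[fun w => h (X' w + I w) | m] := by
    refine condExp_congr_ae ?_
    filter_upwards [hXX'] with w hw
    rw [hw]
  refine h2.trans (h1.symm.trans ?_)
  filter_upwards [hXX'] with w hw
  rw [hw]

end CondExp

/-! ### Exponential integrals and their moments. -/

section Moments

variable {Ω : Type*} {mΩ : MeasurableSpace Ω} {P : Measure Ω} {d : ℕ}
  {μ : Measure ℝ} {J : ℝ → Ω → EuclideanSpace ℝ (Fin d)} {Λ : ℝ → ℝ}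

/-- A jointly measurable process with exponential moments of every order, uniformly in time, and
with bounded paths. -/
structure ExpBounded (P : Measure Ω) (J : ℝ → Ω → EuclideanSpace ℝ (Fin d)) : Prop where
  measurable : Measurable (Function.uncurry J)
  moment : ∀ a : ℝ, 0 ≤ a → ∃ C : ℝ, 0 ≤ C ∧
    ∀ s, ∫⁻ w, ENNReal.ofReal (Real.exp (a * ‖J s w‖)) ∂P ≤ ENNReal.ofReal C
  bounded : ∀ w, ∃ R : ℝ, ∀ s, ‖J s w‖ ≤ R

theorem ExpBounded.measurable_apply (hJ : ExpBounded P J) (s : ℝ) : Measurable (J s) :=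
  hJ.measurable.comp (measurable_const.prodMk measurable_id)

theorem ExpBounded.measurable_path (hJ : ExpBounded P J) (w : Ω) : Measurable fun s => J s w :=
  hJ.measurable.comp (measurable_id.prodMk measurable_const)

theorem ExpBounded.integrable_path (hJ : ExpBounded P J) (hΛ : Integrable Λ μ) {κ : ℝ}
    (hκ : 0 ≤ κ) (w : Ω) : Integrable (fun s => Λ s * Real.exp (κ * ‖J s w‖)) μ := by
  obtain ⟨R, hR⟩ := hJ.bounded w
  refine hΛ.mul_bdd (c := Real.exp (κ * R))
    (Real.measurable_exp.comp ((hJ.measurable_path w).norm.const_mul κ)).aestronglyMeasurable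
    (ae_of_all _ fun s => ?_)
  rw [Real.norm_eq_abs, abs_of_pos (Real.exp_pos _), Real.exp_le_exp]
  exact mul_le_mul_of_nonneg_left (hR s) hκ

/-- The exponential moment is bounded uniformly in time, so integrating out ω first leaves a
constant multiple of the integrable weight. -/
theorem ExpBounded.integrable_prod [SFinite P] [SFinite μ] (hJ : ExpBounded P J)
    (hΛ : Integrable Λ μ) {κ : ℝ} (hκ : 0 ≤ κ) :
    Integrable (fun q : ℝ × Ω => Λ q.1 * Real.exp (κ * ‖J q.1 q.2‖)) (μ.prod P) := by
  obtain ⟨C, hC0, hC⟩ := hJ.moment κ hκ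
  have hm : Measurable fun q : ℝ × Ω => Real.exp (κ * ‖J q.1 q.2‖) :=
    Real.measurable_exp.comp (hJ.measurable.norm.const_mul κ)
  have hm1 : AEStronglyMeasurable
      (fun q : ℝ × Ω => Λ q.1 * Real.exp (κ * ‖J q.1 q.2‖)) (μ.prod P) :=
    hΛ.aestronglyMeasurable.comp_fst.mul hm.aestronglyMeasurable
  refine (integrable_prod_iff hm1).2 ⟨ae_of_all _ fun s => ?_, ?_⟩
  · exact (integrable_exp_of_lintegral_le (hJ.measurable_apply s) (hC s)).const_mul (Λ s)
  · have hm2 : AEStronglyMeasurable (fun s => ∫ w, ‖Λ s * Real.exp (κ * ‖J s w‖)‖ ∂P) μ :=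
      AEStronglyMeasurable.integral_prod_right' (f := fun q : ℝ × Ω =>
        ‖Λ q.1 * Real.exp (κ * ‖J q.1 q.2‖)‖) hm1.norm
    refine (hΛ.norm.mul_const C).mono' hm2 (ae_of_all _ fun s => ?_)
    rw [Real.norm_of_nonneg (integral_nonneg fun _ => norm_nonneg _)]
    simp_rw [norm_mul, Real.norm_of_nonneg (Real.exp_pos _).le]
    rw [integral_const_mul]
    exact mul_le_mul_of_nonneg_left (integral_exp_le (hJ.measurable_apply s) hC0 (hC s))
      (norm_nonneg _)

/-- Jensen's inequality for powers, with a weight. -/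
theorem pow_integral_le_of_weight (hΛ : Integrable Λ μ) (hΛ0 : ∀ s, 0 ≤ Λ s) {e : ℝ → ℝ}
    (he0 : ∀ s, 0 ≤ e s) {n : ℕ} (h1 : Integrable (fun s => Λ s * e s) μ)
    (hn : Integrable (fun s => Λ s * e s ^ n) μ) :
    (∫ s, Λ s * e s ∂μ) ^ n ≤
      (1 + ∫ s, Λ s ∂μ) ^ n * (1 + ∫ s, Λ s * e s ^ n ∂μ) := by
  set A := ∫ s, Λ s ∂μ
  have hA0 : 0 ≤ A := integral_nonneg hΛ0
  set M := ∫ s, Λ s * e s ∂μ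
  have hM0 : 0 ≤ M := integral_nonneg fun s => mul_nonneg (hΛ0 s) (he0 s)
  have hE0 : 0 ≤ ∫ s, Λ s * e s ^ n ∂μ :=
    integral_nonneg fun s => mul_nonneg (hΛ0 s) (pow_nonneg (he0 s) n)
  rcases Nat.eq_zero_or_pos n with rfl | hn0
  · simpa using hE0
  rcases hA0.eq_or_lt with hA | hA
  · have h2 := (integral_eq_zero_iff_of_nonneg hΛ0 hΛ).1 hA.symm
    have : M = 0 := by
      refine integral_eq_zero_of_ae ?_
      filter_upwards [h2] with s hs
      simp [hs]
    rw [this, zero_pow hn0.ne']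
    positivity
  · set c := M / A
    have hc0 : 0 ≤ c := div_nonneg hM0 hA0
    -- The convex power lies above its tangent at the weighted mean c, by Bernoulli's inequality for
    -- x/c. Integrated against the weight, the linear term cancels.
    have tangent : ∀ x : ℝ, 0 ≤ x → c ^ n + n * c ^ (n - 1) * (x - c) ≤ x ^ n := by
      intro x hx
      rcases hc0.eq_or_lt with h0 | h0
      · rw [← h0, zero_pow hn0.ne']
        rcases Nat.lt_or_ge 1 n with h1n | h1n
        · rw [zero_pow (by omega)]
          simpa using pow_nonneg hx n
        · have : n = 1 := by omega
          simp [this]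
      · have h3 := one_add_mul_le_pow (a := x / c - 1)
          (by have := div_nonneg hx hc0; linarith) n
        have h4 := mul_le_mul_of_nonneg_left h3 (pow_nonneg hc0 n)
        rw [add_sub_cancel, ← mul_pow, mul_div_cancel₀ _ h0.ne'] at h4
        refine le_trans (le_of_eq ?_) h4
        obtain ⟨k, rfl⟩ : ∃ k, n = k + 1 := ⟨n - 1, by omega⟩
        simp only [Nat.add_sub_cancel]
        field_simp
        ring
    have h5 : A * c ^ n ≤ ∫ s, Λ s * e s ^ n ∂μ := by
      have h6 : ∫ s, (c ^ n * Λ s + n * c ^ (n - 1) * (Λ s * e s - c * Λ s)) ∂μ = A * c ^ n := by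
        rw [integral_add (hΛ.const_mul _) ((show Integrable (fun s => Λ s * e s - c * Λ s) μ from
            h1.sub (hΛ.const_mul c)).const_mul _),
          integral_const_mul, integral_const_mul, integral_sub h1 (hΛ.const_mul c),
          integral_const_mul]
        change c ^ n * A + n * c ^ (n - 1) * (M - c * A) = A * c ^ n
        rw [div_mul_cancel₀ _ hA.ne', sub_self]
        ring
      rw [← h6]
      refine integral_mono ((hΛ.const_mul _).add ((h1.sub (hΛ.const_mul c)).const_mul _)) hn
        fun s => ?_
      have := mul_le_mul_of_nonneg_left (tangent (e s) (he0 s)) (hΛ0 s)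
      simp only
      linarith
    have h7 : M ^ n = A ^ n * c ^ n := by
      rw [← mul_pow, mul_div_cancel₀ _ hA.ne']
    rw [h7]
    have h8 : c ^ n ≤ (A * c ^ n) / A := by rw [mul_div_cancel_left₀ _ hA.ne']
    obtain ⟨k, rfl⟩ : ∃ k, n = k + 1 := ⟨n - 1, by omega⟩
    -- The added ones in the bound absorb the missing power of A and allow for total weight zero.
    calc A ^ (k + 1) * c ^ (k + 1) = A ^ k * (A * c ^ (k + 1)) := by ring
      _ ≤ (1 + A) ^ (k + 1) * (1 + ∫ s, Λ s * e s ^ (k + 1) ∂μ) := by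
        refine mul_le_mul ?_ (by linarith) (by positivity) (by positivity)
        calc A ^ k ≤ (1 + A) ^ k := pow_le_pow_left₀ hA0 (by linarith) k
          _ ≤ (1 + A) ^ (k + 1) := pow_le_pow_right₀ (by linarith) (Nat.le_succ k)

/-- `∫ Λ_s e^{κ‖J_s‖} ds`. -/
noncomputable def expIntegral (μ : Measure ℝ) (Λ : ℝ → ℝ) (κ : ℝ)
    (J : ℝ → Ω → EuclideanSpace ℝ (Fin d)) (w : Ω) : ℝ :=
  ∫ s, Λ s * Real.exp (κ * ‖J s w‖) ∂μ

theorem expIntegral_nonneg (hΛ0 : ∀ s, 0 ≤ Λ s) (κ : ℝ) (w : Ω) : 0 ≤ expIntegral μ Λ κ J w :=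
  integral_nonneg fun s => mul_nonneg (hΛ0 s) (Real.exp_pos _).le

/-- Jensen trades the k-th power of the time integral for a time integral with rate kκ, whose mean
is finite since moments of every order are; the binomial formula does the rest. -/
theorem ExpBounded.integrable_one_add_expIntegral_pow [IsProbabilityMeasure P] [SFinite μ]
    (hJ : ExpBounded P J) (hΛ : Integrable Λ μ) (hΛ0 : ∀ s, 0 ≤ Λ s) {κ : ℝ} (hκ : 0 ≤ κ) (c : ℝ)
    (n : ℕ) :
    Integrable (fun w => (1 + c * expIntegral μ Λ κ J w) ^ n) P := by
  have hm : AEStronglyMeasurable (expIntegral μ Λ κ J) P :=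
    (hJ.integrable_prod hΛ hκ).integral_prod_right.aestronglyMeasurable
  have key : ∀ k : ℕ, Integrable (fun w => expIntegral μ Λ κ J w ^ k) P := by
    intro k
    have hk : Integrable (fun w => (1 + ∫ s, Λ s ∂μ) ^ k *
        (1 + expIntegral μ Λ (k * κ) J w)) P :=
      ((integrable_const 1).add (hJ.integrable_prod hΛ (κ := k * κ)
        (by positivity)).integral_prod_right).const_mul _
    refine hk.mono' (hm.pow k) (ae_of_all _ fun w => ?_)
    have hpow : ∀ s, Real.exp (κ * ‖J s w‖) ^ k = Real.exp (k * κ * ‖J s w‖) := fun s => by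
      rw [← Real.exp_nat_mul, mul_assoc]
    rw [Real.norm_of_nonneg (pow_nonneg (expIntegral_nonneg hΛ0 _ _) k)]
    have h2 : Integrable (fun s => Λ s * Real.exp (κ * ‖J s w‖) ^ k) μ := by
      simp_rw [hpow]
      exact hJ.integrable_path hΛ (by positivity) w
    have := pow_integral_le_of_weight hΛ hΛ0 (e := fun s => Real.exp (κ * ‖J s w‖))
      (fun s => (Real.exp_pos _).le) (hJ.integrable_path hΛ hκ w) h2
    simp_rw [hpow] at this
    exact this
  have e : (fun w => (1 + c * expIntegral μ Λ κ J w) ^ n) = fun w =>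
      ∑ k ∈ Finset.range (n + 1), c ^ k * (n.choose k) * expIntegral μ Λ κ J w ^ k := by
    funext w
    rw [add_comm, add_pow]
    refine Finset.sum_congr rfl fun k _ => ?_
    rw [mul_pow, one_pow]
    ring
  rw [e]
  exact integrable_finsetSum _ fun k _ => (key k).const_mul _

end Moments

/-! ### Scalar Taylor estimates for φ with polynomial growth. -/

section Scalar

/-- The derivatives of `φ` up to order three are bounded by `A (1 + |x|)^n`. -/
structure PolyBounded (φ : ℝ → ℝ) (A : ℝ) (n : ℕ) : Prop where
  contDiff : ContDiff ℝ 3 φ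
  nonneg : 0 ≤ A
  bound : ∀ k ≤ 3, ∀ x, |iteratedDeriv k φ x| ≤ A * (1 + |x|) ^ n

theorem CPoly.exists_polyBounded {φ : ℝ → ℝ} (hφ : CPoly 3 φ) : ∃ A n, PolyBounded φ A n := by
  have h := hφ.2
  choose! C κ hC hκ hb using h
  -- Both 1 and |x|^κ are at most (1+|x|)^n once n ≥ κ, hence the factor 2; an integer exponent
  -- makes binomial expansions available.
  refine ⟨∑ k ∈ Finset.range 4, 2 * |C k|, ⌈∑ k ∈ Finset.range 4, |κ k|⌉₊, hφ.1, by positivity,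
    fun k hk x => ?_⟩
  have hk' : k ∈ Finset.range 4 := Finset.mem_range.2 (Nat.lt_succ_of_le hk)
  have h1 := Finset.single_le_sum (f := fun k => 2 * |C k|) (fun k _ => by positivity) hk'
  have h2 := (Finset.single_le_sum (f := fun k => |κ k|) (fun k _ => abs_nonneg _) hk').trans
    (Nat.le_ceil _)
  refine (hb k hk x).trans (le_trans ?_ (mul_le_mul_of_nonneg_right h1 (by positivity)))
  have h3 : |x| ^ κ k ≤ (1 + |x|) ^ ⌈∑ k ∈ Finset.range 4, |κ k|⌉₊ := by
    rw [← Real.rpow_natCast]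
    exact (Real.rpow_le_rpow (abs_nonneg x) (by linarith [abs_nonneg x]) (hκ k hk).le).trans
      (Real.rpow_le_rpow_of_exponent_le (by linarith [abs_nonneg x]) ((le_abs_self _).trans h2))
  have h4 : (1 : ℝ) ≤ (1 + |x|) ^ ⌈∑ k ∈ Finset.range 4, |κ k|⌉₊ :=
    one_le_pow₀ (by linarith [abs_nonneg x])
  rw [abs_of_pos (hC k hk)]
  nlinarith [hC k hk]

variable {φ : ℝ → ℝ} {A : ℝ} {n : ℕ}

theorem PolyBounded.continuous_deriv (hφ : PolyBounded φ A n) : Continuous (deriv φ) :=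
  hφ.contDiff.continuous_deriv (by norm_num)

theorem PolyBounded.le_of_abs_le (hφ : PolyBounded φ A n) {k : ℕ} (hk : k ≤ 3) {x Q : ℝ}
    (hx : 1 + |x| ≤ Q) : |iteratedDeriv k φ x| ≤ A * Q ^ n :=
  (hφ.bound k hk x).trans
    (mul_le_mul_of_nonneg_left (pow_le_pow_left₀ (by positivity) hx n) hφ.nonneg)

theorem abs_sub_sub_deriv_le {ψ : ℝ → ℝ} (hψ : ContDiff ℝ 2 ψ) {a b S R : ℝ} (ha : |a| ≤ R)
    (hb : |b| ≤ R) (h : ∀ z, |z| ≤ R → |iteratedDeriv 2 ψ z| ≤ S) :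
    |ψ b - ψ a - deriv ψ a * (b - a)| ≤ S * (b - a) ^ 2 := by
  have h1 := norm_sub_sub_fderiv_le (x := a) (y := b - a) (N := S) hψ fun z hz => by
    rw [norm_iteratedFDeriv_eq_norm_iteratedDeriv, Real.norm_eq_abs]
    refine h z ?_
    rw [add_sub_cancel] at hz
    have : segment ℝ a b ⊆ Icc (-R) R :=
      (convex_Icc _ _).segment_subset (abs_le.1 ha) (abs_le.1 hb)
    exact abs_le.2 (this hz)
  rw [add_sub_cancel, fderiv_eq_smul_deriv, smul_eq_mul, Real.norm_eq_abs, Real.norm_eq_abs,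
    sq_abs, mul_comm (b - a)] at h1
  exact h1

variable {N r ρ a b p a₁ b₁ q : ℝ}

/-- First order expansion of `φ` along an approximate increment. -/
theorem PolyBounded.abs_taylor_le (hφ : PolyBounded φ A n) (hN : 0 ≤ N) (hr : 0 ≤ r) (hr1 : r ≤ 1)
    (ha : |a| ≤ N) (hp : |p| ≤ N * r) (hb : |b - a - p| ≤ N * r ^ 2) :
    |φ b - φ a - deriv φ a * p| ≤ 5 * A * (1 + 3 * N) ^ (n + 2) * r ^ 2 := by
  have hA := hφ.nonneg
  have hr2 : r ^ 2 ≤ r := by nlinarith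
  have hba : |b - a| ≤ 2 * N * r := by
    calc |b - a| = |(b - a - p) + p| := by ring_nf
      _ ≤ N * r ^ 2 + N * r := (abs_add_le _ _).trans (add_le_add hb hp)
      _ ≤ _ := by nlinarith
  have hb3 : |b| ≤ 3 * N := by
    calc |b| = |(b - a) + a| := by ring_nf
      _ ≤ 2 * N * r + N := (abs_add_le _ _).trans (add_le_add hba ha)
      _ ≤ _ := by nlinarith
  -- Since |a| ≤ N and |b - a| ≤ 2N, `Q` bounds 1 + |z| for all z between a and b, so `S` bounds
  -- every derivative of φ needed there. The final constant comes from 4N² + N ≤ 5Q².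
  set Q := 1 + 3 * N with hQ
  have hQ0 : 0 ≤ Q := by positivity
  set S := A * Q ^ n with hS
  have hS0 : 0 ≤ S := by positivity
  have h1 : |φ b - φ a - deriv φ a * (b - a)| ≤ S * (b - a) ^ 2 :=
    abs_sub_sub_deriv_le (hφ.contDiff.of_le (by norm_num)) (ha.trans (by linarith)) hb3
      fun z hz => hφ.le_of_abs_le (by norm_num) (by linarith)
  have h2 : |deriv φ a| ≤ S := by
    simpa using hφ.le_of_abs_le (k := 1) (x := a) (Q := Q) (by norm_num) (by linarith)
  have h3 : (b - a) ^ 2 ≤ (2 * N * r) ^ 2 := by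
    rw [← sq_abs]; exact pow_le_pow_left₀ (abs_nonneg _) hba 2
  calc |φ b - φ a - deriv φ a * p|
      = |(φ b - φ a - deriv φ a * (b - a)) + deriv φ a * (b - a - p)| := by ring_nf
    _ ≤ S * (b - a) ^ 2 + |deriv φ a| * |b - a - p| := by
        refine (abs_add_le _ _).trans (add_le_add h1 (abs_mul _ _).le)
    _ ≤ S * (2 * N * r) ^ 2 + S * (N * r ^ 2) :=
        add_le_add (mul_le_mul_of_nonneg_left h3 hS0) (mul_le_mul h2 hb (abs_nonneg _) hS0)
    _ = S * (4 * N ^ 2 + N) * r ^ 2 := by ring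
    _ ≤ S * (5 * Q ^ 2) * r ^ 2 := by
        refine mul_le_mul_of_nonneg_right (mul_le_mul_of_nonneg_left ?_ hS0) (sq_nonneg r)
        rw [hQ]; nlinarith
    _ = _ := by rw [hS]; ring

/-- First order expansion of `φ'(G) G₁` along an approximate increment. -/
theorem PolyBounded.abs_taylor_mul_le (hφ : PolyBounded φ A n) (hN : 0 ≤ N) (hr : 0 ≤ r)
    (hr1 : r ≤ 1) (hρ : 0 ≤ ρ) (ha : |a| ≤ N) (hp : |p| ≤ N * r) (hb : |b - a - p| ≤ N * r ^ 2)
    (ha₁ : |a₁| ≤ N * ρ) (hq : |q| ≤ N * r * ρ) (hb₁ : |b₁ - a₁ - q| ≤ N * r ^ 2 * ρ) :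
    |deriv φ b * b₁ - deriv φ a * a₁ - (iteratedDeriv 2 φ a * (p * a₁) + deriv φ a * q)| ≤
      18 * A * (1 + 3 * N) ^ (n + 3) * (r ^ 2 * ρ) := by
  have hA := hφ.nonneg
  have hr2 : r ^ 2 ≤ r := by nlinarith
  have hNρ : 0 ≤ N * ρ := mul_nonneg hN hρ
  have hba : |b - a| ≤ 2 * N * r := by
    calc |b - a| = |(b - a - p) + p| := by ring_nf
      _ ≤ N * r ^ 2 + N * r := (abs_add_le _ _).trans (add_le_add hb hp)
      _ ≤ _ := by nlinarith
  have hb3 : |b| ≤ 3 * N := by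
    calc |b| = |(b - a) + a| := by ring_nf
      _ ≤ 2 * N * r + N := (abs_add_le _ _).trans (add_le_add hba ha)
      _ ≤ _ := by nlinarith
  have hba₁ : |b₁ - a₁| ≤ 2 * N * r * ρ := by
    calc |b₁ - a₁| = |(b₁ - a₁ - q) + q| := by ring_nf
      _ ≤ N * r ^ 2 * ρ + N * r * ρ := (abs_add_le _ _).trans (add_le_add hb₁ hq)
      _ ≤ _ := by nlinarith [mul_le_mul_of_nonneg_left hr2 hNρ]
  have hb₁3 : |b₁| ≤ 3 * N * ρ := by
    calc |b₁| = |(b₁ - a₁) + a₁| := by ring_nf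
      _ ≤ 2 * N * r * ρ + N * ρ := (abs_add_le _ _).trans (add_le_add hba₁ ha₁)
      _ ≤ _ := by nlinarith [mul_le_mul_of_nonneg_left hr1 hNρ]
  set Q := 1 + 3 * N with hQ
  have hQ0 : 0 ≤ Q := by positivity
  set S := A * Q ^ n with hS
  have hS0 : 0 ≤ S := by positivity
  have h1 : |deriv φ b - deriv φ a - iteratedDeriv 2 φ a * (b - a)| ≤ S * (2 * N * r) ^ 2 := by
    have hd : ContDiff ℝ 2 (deriv φ) := by
      have := hφ.contDiff
      rw [show (3 : WithTop ℕ∞) = 2 + 1 by norm_num, contDiff_succ_iff_deriv] at this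
      exact this.2.2
    have := abs_sub_sub_deriv_le hd (S := S) (a := a) (b := b) (ha.trans (by linarith)) hb3
      fun z hz => by
        rw [← iteratedDeriv_succ']
        exact hφ.le_of_abs_le (by norm_num) (by linarith)
    rw [show deriv (deriv φ) = iteratedDeriv 2 φ by rw [iteratedDeriv_succ', iteratedDeriv_one]]
      at this
    refine this.trans (mul_le_mul_of_nonneg_left ?_ hS0)
    rw [← sq_abs]; exact pow_le_pow_left₀ (abs_nonneg _) hba 2
  have h2 : |deriv φ a| ≤ S := by
    simpa using hφ.le_of_abs_le (k := 1) (x := a) (Q := Q) (by norm_num) (by linarith)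
  have h3 : |iteratedDeriv 2 φ a| ≤ S := hφ.le_of_abs_le (by norm_num) (by linarith)
  have habs : ∀ u v w z : ℝ, |u + v + w + z| ≤ |u| + |v| + |w| + |z| := fun u v w z =>
    (abs_add_le _ _).trans (add_le_add ((abs_add_le _ _).trans
      (add_le_add (abs_add_le _ _) le_rfl)) le_rfl)
  -- The four errors are the Taylor remainder of φ', replacing b - a by p, replacing b₁ by a₁ in the
  -- product, and the remainder of b₁. They add up to 12N³ + 5N² + N ≤ 18Q³, and all carry r²ρ.
  calc |deriv φ b * b₁ - deriv φ a * a₁ - (iteratedDeriv 2 φ a * (p * a₁) + deriv φ a * q)|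
      = |(deriv φ b - deriv φ a - iteratedDeriv 2 φ a * (b - a)) * b₁ +
          iteratedDeriv 2 φ a * ((b - a - p) * b₁) + iteratedDeriv 2 φ a * (p * (b₁ - a₁)) +
          deriv φ a * (b₁ - a₁ - q)| := by ring_nf
    _ ≤ S * (2 * N * r) ^ 2 * (3 * N * ρ) + S * (N * r ^ 2 * (3 * N * ρ)) +
          S * (N * r * (2 * N * r * ρ)) + S * (N * r ^ 2 * ρ) := by
        refine (habs _ _ _ _).trans ?_
        simp only [abs_mul]
        gcongr
    _ = S * (12 * N ^ 3 + 5 * N ^ 2 + N) * (r ^ 2 * ρ) := by ring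
    _ ≤ S * (18 * Q ^ 3) * (r ^ 2 * ρ) := by
        refine mul_le_mul_of_nonneg_right (mul_le_mul_of_nonneg_left ?_ hS0) (by positivity)
        rw [hQ]; nlinarith [pow_nonneg hN 3, pow_nonneg hN 2]
    _ = _ := by rw [hS]; ring

end Scalar

/-! ### Families with a time-dependent weight. -/

section Families

variable {Ω : Type*} {mΩ : MeasurableSpace Ω} {P : Measure Ω} {d : ℕ}
  {μ : Measure ℝ} {x : ℝ → Ω → EuclideanSpace ℝ (Fin d)} {Λ : ℝ → ℝ} {κ : ℝ}

/-- A bounded shift multiplies the exponential moment of order a by at most e^{aR}. It serves both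
for the initial path and for its perturbations. -/
theorem ExpBounded.add_path (hx : ExpBounded P x) {y : ℝ → EuclideanSpace ℝ (Fin d)}
    (hy : Measurable y) {R : ℝ} (hR : ∀ s, ‖y s‖ ≤ R) :
    ExpBounded P fun s w => y s + x s w where
  measurable := (hy.comp measurable_fst).add hx.measurable
  moment a ha := by
    obtain ⟨C, hC0, hC⟩ := hx.moment a ha
    refine ⟨Real.exp (a * R) * C, by positivity, fun s => ?_⟩
    rw [ENNReal.ofReal_mul (Real.exp_pos _).le]
    refine le_trans ?_ (mul_le_mul_right (hC s) _)
    rw [← lintegral_const_mul' _ _ ENNReal.ofReal_ne_top]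
    refine lintegral_mono fun w => ?_
    rw [← ENNReal.ofReal_mul (Real.exp_pos _).le]
    refine ENNReal.ofReal_le_ofReal ((exp_norm_add_le ha _ _).trans ?_)
    exact mul_le_mul_of_nonneg_right
      (Real.exp_le_exp.2 (mul_le_mul_of_nonneg_left (hR s) ha)) (Real.exp_pos _).le
  bounded w := by
    obtain ⟨R', hR'⟩ := hx.bounded w
    exact ⟨R + R', fun s => (norm_add_le _ _).trans (add_le_add (hR s) (hR' s))⟩

/-- A jointly measurable family of functions with `|h_s(x)| ≤ Λ_s e^{κ‖x‖}`. -/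
structure WeightedFamily (h : ℝ → EuclideanSpace ℝ (Fin d) → ℝ) (Λ : ℝ → ℝ) (κ : ℝ) : Prop where
  measurable : Measurable (Function.uncurry h)
  bound : ∀ s x, ‖h s x‖ ≤ Λ s * Real.exp (κ * ‖x‖)

variable {h : ℝ → EuclideanSpace ℝ (Fin d) → ℝ}

theorem WeightedFamily.integrable_path (hh : WeightedFamily h Λ κ) (hx : ExpBounded P x)
    (hΛ : Integrable Λ μ) (hκ : 0 ≤ κ) (w : Ω) : Integrable (fun s => h s (x s w)) μ :=
  (hx.integrable_path hΛ hκ w).mono' (hh.measurable.comp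
    (measurable_id.prodMk (hx.measurable_path w))).aestronglyMeasurable
    (ae_of_all _ fun s => hh.bound s _)

theorem WeightedFamily.integrable_prod [SFinite P] [SFinite μ] (hh : WeightedFamily h Λ κ)
    (hx : ExpBounded P x) (hΛ : Integrable Λ μ) (hκ : 0 ≤ κ) :
    Integrable (Function.uncurry fun s w => h s (x s w)) (μ.prod P) :=
  (hx.integrable_prod hΛ hκ).mono' (hh.measurable.comp
    (measurable_fst.prodMk hx.measurable)).aestronglyMeasurable
    (ae_of_all _ fun _ => hh.bound _ _)

theorem WeightedFamily.integrable_integral [SFinite P] [SFinite μ] (hh : WeightedFamily h Λ κ)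
    (hx : ExpBounded P x) (hΛ : Integrable Λ μ) (hκ : 0 ≤ κ) :
    Integrable (fun w => ∫ s, h s (x s w) ∂μ) P :=
  (hh.integrable_prod hx hΛ hκ).integral_prod_right

theorem WeightedFamily.abs_integral_le (hh : WeightedFamily h Λ κ) (hx : ExpBounded P x)
    (hΛ : Integrable Λ μ) (hκ : 0 ≤ κ) (w : Ω) :
    |∫ s, h s (x s w) ∂μ| ≤ expIntegral μ Λ κ x w :=
  norm_integral_le_of_norm_le (hx.integrable_path hΛ hκ w) (ae_of_all _ fun s => hh.bound s _)

theorem expIntegral_mono {Λ' : ℝ → ℝ} (hx : ExpBounded P x) (hΛ : Integrable Λ μ)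
    (hΛ' : Integrable Λ' μ) (hκ : 0 ≤ κ) (hle : ∀ s, Λ s ≤ Λ' s) (w : Ω) :
    expIntegral μ Λ κ x w ≤ expIntegral μ Λ' κ x w :=
  integral_mono (hx.integrable_path hΛ hκ w) (hx.integrable_path hΛ' hκ w) fun s =>
    mul_le_mul_of_nonneg_right (hle s) (Real.exp_pos _).le

theorem expIntegral_mul_const (c : ℝ) (w : Ω) :
    expIntegral μ (fun s => Λ s * c) κ x w = expIntegral μ Λ κ x w * c := by
  rw [expIntegral, expIntegral, ← integral_mul_const]
  simp_rw [mul_right_comm]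

end Families

/-! ### Directional integrals and their remainders along one path. -/

section Pathwise

variable {Ω : Type*} {mΩ : MeasurableSpace Ω} {P : Measure Ω} {d : ℕ}
  {μ : Measure ℝ} {x : ℝ → Ω → EuclideanSpace ℝ (Fin d)} {C κ : ℝ}
  {g : ℝ → EuclideanSpace ℝ (Fin d) → ℝ}
  {g₁ : ℝ → EuclideanSpace ℝ (Fin d) → EuclideanSpace ℝ (Fin d) →L[ℝ] ℝ}
  {g₂ : ℝ → EuclideanSpace ℝ (Fin d) →
      EuclideanSpace ℝ (Fin d) →L[ℝ] EuclideanSpace ℝ (Fin d) →L[ℝ] ℝ}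
  {y z : ℝ → EuclideanSpace ℝ (Fin d)} {α β : ℝ → ℝ} {r ρ : ℝ}

theorem TaylorFamily.nonneg (hg : TaylorFamily g g₁ g₂ C κ) : 0 ≤ C := by
  have h := (norm_nonneg _).trans (hg.bound₀ 0 0)
  exact (mul_nonneg_iff_of_pos_right (Real.exp_pos _)).1 h

theorem TaylorFamily.weighted₀ (hg : TaylorFamily g g₁ g₂ C κ) :
    WeightedFamily g (fun _ => C) κ := ⟨hg.measurable₀, hg.bound₀⟩

/-- Keeping the size of the direction in the weight, instead of bounding it by a constant, admits
directions that are unbounded but dominated by an integrable α. -/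
theorem TaylorFamily.weighted₁ (hg : TaylorFamily g g₁ g₂ C κ) (hy : Measurable y)
    (hα : ∀ s, ‖y s‖ ≤ α s) :
    WeightedFamily (fun s θ => g₁ s θ (y s)) (fun s => C * α s) κ := by
  refine ⟨?_, fun s θ => ?_⟩
  · exact (isBoundedBilinearMap_apply (𝕜 := ℝ) (E := EuclideanSpace ℝ (Fin d))
      (F := ℝ)).continuous.measurable.comp (hg.measurable₁.prodMk (hy.comp measurable_fst))
  · refine (ContinuousLinearMap.le_opNorm _ _).trans ?_
    have h0 : 0 ≤ C * Real.exp (κ * ‖θ‖) := mul_nonneg hg.nonneg (Real.exp_pos _).le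
    exact (mul_le_mul (hg.bound₁ s θ) (hα s) (norm_nonneg _) h0).trans_eq (by ring)

theorem TaylorFamily.weighted₂ (hg : TaylorFamily g g₁ g₂ C κ) (hy : Measurable y)
    (hα : ∀ s, ‖y s‖ ≤ α s) (hz : Measurable z) (hβ : ∀ s, ‖z s‖ ≤ β s) :
    WeightedFamily (fun s θ => g₂ s θ (y s) (z s)) (fun s => C * (α s * β s)) κ := by
  refine ⟨?_, fun s θ => ?_⟩
  · have h1 : Measurable fun q : ℝ × EuclideanSpace ℝ (Fin d) => g₂ q.1 q.2 (y q.1) :=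
      (isBoundedBilinearMap_apply (𝕜 := ℝ) (E := EuclideanSpace ℝ (Fin d))
        (F := EuclideanSpace ℝ (Fin d) →L[ℝ] ℝ)).continuous.measurable.comp
        (hg.measurable₂.prodMk (hy.comp measurable_fst))
    exact (isBoundedBilinearMap_apply (𝕜 := ℝ) (E := EuclideanSpace ℝ (Fin d))
      (F := ℝ)).continuous.measurable.comp (h1.prodMk (hz.comp measurable_fst))
  · refine (ContinuousLinearMap.le_opNorm₂ _ _ _).trans ?_
    have h0 : 0 ≤ C * Real.exp (κ * ‖θ‖) := mul_nonneg hg.nonneg (Real.exp_pos _).le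
    have h1 := mul_le_mul (hg.bound₂ s θ) (hα s) (norm_nonneg _) h0
    refine (mul_le_mul h1 (hβ s) (norm_nonneg _) ?_).trans_eq (by ring)
    exact mul_nonneg h0 ((norm_nonneg _).trans (hα s))

variable [IsFiniteMeasure μ]

theorem TaylorFamily.abs_integral_taylor₀_le (hg : TaylorFamily g g₁ g₂ C κ) (hκ : 0 ≤ κ)
    (hx : ExpBounded P x) (hy : Measurable y) (hr : r ≤ 1) (hyr : ∀ s, ‖y s‖ ≤ r) (w : Ω) :
    |(∫ s, g s (y s + x s w) ∂μ) - (∫ s, g s (x s w) ∂μ) - ∫ s, g₁ s (x s w) (y s) ∂μ| ≤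
      expIntegral μ (fun _ => C) κ x w * r ^ 2 := by
  have i0 := hg.weighted₀.integrable_path (μ := μ) (hx.add_path hy hyr) (integrable_const C) hκ w
  have i1 := hg.weighted₀.integrable_path (μ := μ) hx (integrable_const C) hκ w
  have i2 := (hg.weighted₁ hy hyr).integrable_path (μ := μ) hx (integrable_const _) hκ w
  rw [← integral_sub i0 i1, ← integral_sub
    (show Integrable (fun s => g s (y s + x s w) - g s (x s w)) μ from i0.sub i1) i2, expIntegral,
    ← integral_mul_const, ← Real.norm_eq_abs]
  refine norm_integral_le_of_norm_le
    ((hx.integrable_path (μ := μ) (integrable_const C) hκ w).mul_const _)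
    (ae_of_all _ fun s => ?_)
  rw [add_comm]
  refine (hg.taylor₀ s _ _ ((hyr s).trans hr)).trans (mul_le_mul_of_nonneg_left
    (pow_le_pow_left₀ (norm_nonneg _) (hyr s) 2) (mul_nonneg hg.nonneg (Real.exp_pos _).le))

theorem TaylorFamily.abs_integral_taylor₁_le (hg : TaylorFamily g g₁ g₂ C κ) (hκ : 0 ≤ κ)
    (hx : ExpBounded P x) (hy : Measurable y) (hr : r ≤ 1) (hyr : ∀ s, ‖y s‖ ≤ r)
    (hz : Measurable z) (hzρ : ∀ s, ‖z s‖ ≤ ρ) (w : Ω) :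
    |(∫ s, g₁ s (y s + x s w) (z s) ∂μ) - (∫ s, g₁ s (x s w) (z s) ∂μ) -
      ∫ s, g₂ s (x s w) (y s) (z s) ∂μ| ≤ expIntegral μ (fun _ => C) κ x w * r ^ 2 * ρ := by
  have i0 := (hg.weighted₁ hz hzρ).integrable_path (μ := μ) (hx.add_path hy hyr)
    (integrable_const _) hκ w
  have i1 := (hg.weighted₁ hz hzρ).integrable_path (μ := μ) hx (integrable_const _) hκ w
  have i2 := (hg.weighted₂ hy hyr hz hzρ).integrable_path (μ := μ) hx (integrable_const _) hκ w
  rw [← integral_sub i0 i1, ← integral_sub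
    (show Integrable (fun s => g₁ s (y s + x s w) (z s) - g₁ s (x s w) (z s)) μ from
      i0.sub i1) i2, mul_assoc, expIntegral, ← integral_mul_const,
    ← Real.norm_eq_abs]
  refine norm_integral_le_of_norm_le
    ((hx.integrable_path (μ := μ) (integrable_const C) hκ w).mul_const _)
    (ae_of_all _ fun s => ?_)
  rw [add_comm, ← sub_apply, ← sub_apply]
  have h0 : 0 ≤ C * Real.exp (κ * ‖x s w‖) := mul_nonneg hg.nonneg (Real.exp_pos _).le
  have h1 := (hg.taylor₁ s (x s w) _ ((hyr s).trans hr)).trans (mul_le_mul_of_nonneg_left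
    (pow_le_pow_left₀ (norm_nonneg _) (hyr s) 2) h0)
  refine (ContinuousLinearMap.le_opNorm _ _).trans ((mul_le_mul h1 (hzρ s) (norm_nonneg _)
    (mul_nonneg h0 (sq_nonneg r))).trans_eq (by ring))

end Pathwise

/-! ### Integrability of the first and second variations. -/

section Frechet

variable {Ω : Type*} {mΩ : MeasurableSpace Ω} {P : Measure Ω} [IsProbabilityMeasure P] {d : ℕ}
  {μ : Measure ℝ} [IsFiniteMeasure μ] {x : ℝ → Ω → EuclideanSpace ℝ (Fin d)} {C κ A : ℝ} {n : ℕ}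
  {g : ℝ → EuclideanSpace ℝ (Fin d) → ℝ}
  {g₁ : ℝ → EuclideanSpace ℝ (Fin d) → EuclideanSpace ℝ (Fin d) →L[ℝ] ℝ}
  {g₂ : ℝ → EuclideanSpace ℝ (Fin d) →
      EuclideanSpace ℝ (Fin d) →L[ℝ] EuclideanSpace ℝ (Fin d) →L[ℝ] ℝ}
  {φ : ℝ → ℝ} {y z : ℝ → EuclideanSpace ℝ (Fin d)} {α β Λ : ℝ → ℝ}

/-- `E[φ(∫ g_s(x_s) ds)]`. -/
noncomputable def expectedValue (P : Measure Ω) (μ : Measure ℝ)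
    (g : ℝ → EuclideanSpace ℝ (Fin d) → ℝ) (φ : ℝ → ℝ)
    (x : ℝ → Ω → EuclideanSpace ℝ (Fin d)) : ℝ :=
  ∫ w, φ (∫ s, g s (x s w) ∂μ) ∂P

/-- The integrand of the first derivative of `expectedValue` in the direction `y`. -/
noncomputable def firstVariation (μ : Measure ℝ) (g : ℝ → EuclideanSpace ℝ (Fin d) → ℝ)
    (g₁ : ℝ → EuclideanSpace ℝ (Fin d) → EuclideanSpace ℝ (Fin d) →L[ℝ] ℝ) (φ : ℝ → ℝ)
    (x : ℝ → Ω → EuclideanSpace ℝ (Fin d)) (y : ℝ → EuclideanSpace ℝ (Fin d)) (w : Ω) : ℝ :=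
  deriv φ (∫ s, g s (x s w) ∂μ) * ∫ s, g₁ s (x s w) (y s) ∂μ

/-- The integrand of the second derivative of `expectedValue` in the directions `y`, `z`. -/
noncomputable def secondVariation (μ : Measure ℝ) (g : ℝ → EuclideanSpace ℝ (Fin d) → ℝ)
    (g₁ : ℝ → EuclideanSpace ℝ (Fin d) → EuclideanSpace ℝ (Fin d) →L[ℝ] ℝ)
    (g₂ : ℝ → EuclideanSpace ℝ (Fin d) →
      EuclideanSpace ℝ (Fin d) →L[ℝ] EuclideanSpace ℝ (Fin d) →L[ℝ] ℝ) (φ : ℝ → ℝ)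
    (x : ℝ → Ω → EuclideanSpace ℝ (Fin d)) (y z : ℝ → EuclideanSpace ℝ (Fin d)) (w : Ω) : ℝ :=
  iteratedDeriv 2 φ (∫ s, g s (x s w) ∂μ) *
      ((∫ s, g₁ s (x s w) (y s) ∂μ) * ∫ s, g₁ s (x s w) (z s) ∂μ) +
    deriv φ (∫ s, g s (x s w) ∂μ) * ∫ s, g₂ s (x s w) (y s) (z s) ∂μ

theorem PolyBounded.aestronglyMeasurable_comp (hφ : PolyBounded φ A n) {k : ℕ} (hk : k ≤ 3)
    (hg : TaylorFamily g g₁ g₂ C κ) (hκ : 0 ≤ κ) (hx : ExpBounded P x) :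
    AEStronglyMeasurable (fun w => iteratedDeriv k φ (∫ s, g s (x s w) ∂μ)) P :=
  (hφ.contDiff.continuous_iteratedDeriv k (by exact_mod_cast hk)).comp_aestronglyMeasurable
    (hg.weighted₀.integrable_integral hx (integrable_const C) hκ).aestronglyMeasurable

theorem PolyBounded.abs_comp_le (hφ : PolyBounded φ A n) {k : ℕ} (hk : k ≤ 3)
    (hg : TaylorFamily g g₁ g₂ C κ) (hκ : 0 ≤ κ) (hx : ExpBounded P x) (hΛ : Integrable Λ μ)
    (hΛC : ∀ s, C ≤ Λ s) (w : Ω) :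
    |iteratedDeriv k φ (∫ s, g s (x s w) ∂μ)| ≤ A * (1 + expIntegral μ Λ κ x w) ^ n :=
  hφ.le_of_abs_le hk (add_le_add le_rfl
    ((hg.weighted₀.abs_integral_le hx (integrable_const C) hκ w).trans
      (expIntegral_mono hx (integrable_const C) hΛ hκ hΛC w)))

theorem integrable_comp (hφ : PolyBounded φ A n)
    (hg : TaylorFamily g g₁ g₂ C κ) (hκ : 0 ≤ κ) (hx : ExpBounded P x) :
    Integrable (fun w => φ (∫ s, g s (x s w) ∂μ)) P := by
  have h1 := hφ.aestronglyMeasurable_comp (μ := μ) (k := 0) (by norm_num) hg hκ hx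
  have h2 := hφ.abs_comp_le (μ := μ) (k := 0) (by norm_num) hg hκ hx (integrable_const C)
    fun _ => le_rfl
  simp only [iteratedDeriv_zero] at h1 h2
  refine ((hx.integrable_one_add_expIntegral_pow (μ := μ) (integrable_const C)
    (fun _ => hg.nonneg) hκ 1 n).const_mul A).mono' h1 (ae_of_all _ fun w => ?_)
  simpa using h2 w

/-- The dominating function for products of `φ^{(k)}(∫ g_s(x_s) ds)` with a variable bounded by a
power of an exponential integral. -/
theorem PolyBounded.integrable_dominating (hφ : PolyBounded φ A n) (hκ : 0 ≤ κ)
    (hx : ExpBounded P x) (hΛ : Integrable Λ μ) (hΛ0 : ∀ s, 0 ≤ Λ s) (k : ℕ) :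
    Integrable (fun w => A * (1 + expIntegral μ Λ κ x w) ^ n *
      expIntegral μ Λ κ x w ^ k) P := by
  have hm : AEStronglyMeasurable (expIntegral μ Λ κ x) P :=
    (hx.integrable_prod hΛ hκ).integral_prod_right.aestronglyMeasurable
  have h1 := (hx.integrable_one_add_expIntegral_pow hΛ hΛ0 hκ 1 (n + k)).const_mul A
  refine h1.mono' ((((aestronglyMeasurable_const (b := (1 : ℝ))).add hm).pow n |>.const_mul A).mul
    (hm.pow k)) (ae_of_all _ fun w => ?_)
  have h0 := expIntegral_nonneg (μ := μ) (J := x) hΛ0 κ w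
  have hA := hφ.nonneg
  rw [Real.norm_of_nonneg (by positivity), one_mul, pow_add, ← mul_assoc]
  exact mul_le_mul_of_nonneg_left (pow_le_pow_left₀ h0 (by linarith) k) (by positivity)

/-- A weight Λ above both C and Cα bounds the two factors by the same exponential integral. The
direction enters only through α, so the bound can dominate a whole family of directions. -/
theorem abs_firstVariation_le (hφ : PolyBounded φ A n) (hg : TaylorFamily g g₁ g₂ C κ)
    (hκ : 0 ≤ κ) (hx : ExpBounded P x) (hΛ : Integrable Λ μ) (hΛC : ∀ s, C ≤ Λ s)
    (hy : Measurable y) (hα : ∀ s, ‖y s‖ ≤ α s) (hαΛ : ∀ s, C * α s ≤ Λ s)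
    (hαi : Integrable α μ) (w : Ω) :
    |firstVariation μ g g₁ φ x y w| ≤
      A * (1 + expIntegral μ Λ κ x w) ^ n * expIntegral μ Λ κ x w := by
  have h0 := expIntegral_nonneg (μ := μ) (J := x) (fun s => hg.nonneg.trans (hΛC s)) κ w
  have h1 := hφ.abs_comp_le (k := 1) (by norm_num) hg hκ hx hΛ hΛC w
  rw [iteratedDeriv_one] at h1
  rw [firstVariation, abs_mul]
  have hA := hφ.nonneg
  exact mul_le_mul h1 (((hg.weighted₁ hy hα).abs_integral_le hx (hαi.const_mul C) hκ w).trans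
    (expIntegral_mono hx (hαi.const_mul C) hΛ hκ hαΛ w)) (abs_nonneg _) (by positivity)

theorem integrable_firstVariation (hφ : PolyBounded φ A n) (hg : TaylorFamily g g₁ g₂ C κ)
    (hκ : 0 ≤ κ) (hx : ExpBounded P x) (hy : Measurable y) (hα : ∀ s, ‖y s‖ ≤ α s)
    (hαi : Integrable α μ) : Integrable (firstVariation μ g g₁ φ x y) P := by
  have hα0 : ∀ s, 0 ≤ α s := fun s => (norm_nonneg _).trans (hα s)
  have hC := hg.nonneg
  have hΛ : Integrable (fun s => C + C * α s) μ := (integrable_const C).add (hαi.const_mul C)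
  have h1 := hφ.integrable_dominating hκ hx hΛ (fun s => by have := hα0 s; positivity) 1
  have h2 := hφ.aestronglyMeasurable_comp (μ := μ) (k := 1) (by norm_num) hg hκ hx
  rw [iteratedDeriv_one] at h2
  refine h1.mono' (h2.mul ((hg.weighted₁ hy hα).integrable_integral hx
    (hαi.const_mul C) hκ).aestronglyMeasurable) (ae_of_all _ fun w => ?_)
  rw [pow_one]
  exact abs_firstVariation_le hφ hg hκ hx hΛ
    (fun s => le_add_of_nonneg_right (mul_nonneg hC (hα0 s))) hy hα
    (fun s => le_add_of_nonneg_left hC) hαi w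

theorem abs_iteratedDeriv_two_mul_add_le {a b c u v w M Q : ℝ} (hu : |u| ≤ Q) (hv : |v| ≤ Q)
    (ha : |a| ≤ M) (hb : |b| ≤ M) (hc : |c| ≤ w) :
    |u * (a * b) + v * c| ≤ Q * M ^ 2 + Q * w := by
  refine (abs_add_le _ _).trans ?_
  have hQ : 0 ≤ Q := (abs_nonneg u).trans hu
  have hM : 0 ≤ M := (abs_nonneg a).trans ha
  rw [abs_mul, abs_mul, abs_mul, sq]
  gcongr

theorem abs_secondVariation_le (hφ : PolyBounded φ A n) (hg : TaylorFamily g g₁ g₂ C κ)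
    (hκ : 0 ≤ κ) (hx : ExpBounded P x) (hΛ : Integrable Λ μ) (hΛC : ∀ s, C ≤ Λ s)
    (hy : Measurable y) (hyα : ∀ s, ‖y s‖ ≤ α s) (hz : Measurable z) (hzα : ∀ s, ‖z s‖ ≤ α s)
    (hαΛ : ∀ s, C * α s ≤ Λ s) (hα2Λ : ∀ s, C * (α s * α s) ≤ Λ s)
    (hαi : Integrable α μ) (hα2i : Integrable (fun s => α s * α s) μ) (w : Ω) :
    |secondVariation μ g g₁ g₂ φ x y z w| ≤
      A * (1 + expIntegral μ Λ κ x w) ^ n * expIntegral μ Λ κ x w ^ 2 +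
        A * (1 + expIntegral μ Λ κ x w) ^ n * expIntegral μ Λ κ x w := by
  have h1 := hφ.abs_comp_le (k := 1) (by norm_num) hg hκ hx hΛ hΛC w
  rw [iteratedDeriv_one] at h1
  exact abs_iteratedDeriv_two_mul_add_le (hφ.abs_comp_le (by norm_num) hg hκ hx hΛ hΛC w) h1
    (((hg.weighted₁ hy hyα).abs_integral_le hx (hαi.const_mul C) hκ w).trans
      (expIntegral_mono hx (hαi.const_mul C) hΛ hκ hαΛ w))
    (((hg.weighted₁ hz hzα).abs_integral_le hx (hαi.const_mul C) hκ w).trans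
      (expIntegral_mono hx (hαi.const_mul C) hΛ hκ hαΛ w))
    (((hg.weighted₂ hy hyα hz hzα).abs_integral_le hx (hα2i.const_mul C) hκ w).trans
      (expIntegral_mono hx (hα2i.const_mul C) hΛ hκ hα2Λ w))

theorem aestronglyMeasurable_secondVariation (hφ : PolyBounded φ A n)
    (hg : TaylorFamily g g₁ g₂ C κ) (hκ : 0 ≤ κ) (hx : ExpBounded P x)
    (hy : Measurable y) (hyα : ∀ s, ‖y s‖ ≤ α s) (hz : Measurable z) (hzα : ∀ s, ‖z s‖ ≤ α s)
    (hαi : Integrable α μ) (hα2i : Integrable (fun s => α s * α s) μ) :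
    AEStronglyMeasurable (secondVariation μ g g₁ g₂ φ x y z) P := by
  have h2 := hφ.aestronglyMeasurable_comp (μ := μ) (k := 1) (by norm_num) hg hκ hx
  rw [iteratedDeriv_one] at h2
  have hm : ∀ y : ℝ → EuclideanSpace ℝ (Fin d), Measurable y → (∀ s, ‖y s‖ ≤ α s) →
      AEStronglyMeasurable (fun w => ∫ s, g₁ s (x s w) (y s) ∂μ) P := fun y hy hyα =>
    ((hg.weighted₁ hy hyα).integrable_integral hx (hαi.const_mul C) hκ).aestronglyMeasurable
  exact ((hφ.aestronglyMeasurable_comp (by norm_num) hg hκ hx).mul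
    ((hm y hy hyα).mul (hm z hz hzα))).add (h2.mul ((hg.weighted₂ hy hyα hz hzα).integrable_integral
      hx (hα2i.const_mul C) hκ).aestronglyMeasurable)

theorem integrable_secondVariation (hφ : PolyBounded φ A n)
    (hg : TaylorFamily g g₁ g₂ C κ) (hκ : 0 ≤ κ) (hx : ExpBounded P x)
    (hy : Measurable y) (hyα : ∀ s, ‖y s‖ ≤ α s) (hz : Measurable z) (hzα : ∀ s, ‖z s‖ ≤ α s)
    (hαi : Integrable α μ) (hα2i : Integrable (fun s => α s * α s) μ) :
    Integrable (secondVariation μ g g₁ g₂ φ x y z) P := by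
  have hα0 : ∀ s, 0 ≤ α s := fun s => (norm_nonneg _).trans (hyα s)
  have hC := hg.nonneg
  have hΛ : Integrable (fun s => C + C * α s + C * (α s * α s)) μ :=
    ((integrable_const C).add (hαi.const_mul C)).add (hα2i.const_mul C)
  have hp : ∀ s, 0 ≤ C * α s ∧ 0 ≤ C * (α s * α s) := fun s => by
    have := hα0 s
    constructor <;> positivity
  have h1 := hφ.integrable_dominating hκ hx hΛ (fun s => by linarith [hp s]) 1
  have h2 := hφ.integrable_dominating hκ hx hΛ (fun s => by linarith [hp s]) 2
  simp only [pow_one] at h1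
  exact (h2.add h1).mono' (aestronglyMeasurable_secondVariation hφ hg hκ hx hy hyα hz hzα hαi hα2i)
    (ae_of_all _ fun w => abs_secondVariation_le hφ hg hκ hx hΛ (fun s => by linarith [hp s])
      hy hyα hz hzα (fun s => by linarith [hp s]) (fun s => by linarith [hp s]) hαi hα2i w)

end Frechet

/-- A quadratic remainder is o(‖ξ‖); the unit ball suffices, which is where Taylor families give
control. -/
theorem hasFDerivAt_zero_of_norm_le {E V : Type*} [NormedAddCommGroup E] [NormedSpace ℝ E]
    [NormedAddCommGroup V] [NormedSpace ℝ V] {F : E → V} {L : E →L[ℝ] V} {c : ℝ}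
    (h : ∀ ξ, ‖ξ‖ ≤ 1 → ‖F ξ - F 0 - L ξ‖ ≤ c * ‖ξ‖ ^ 2) : HasFDerivAt F L 0 := by
  rw [hasFDerivAt_iff_isLittleO_nhds_zero]
  refine Asymptotics.IsBigO.trans_isLittleO ?_ (Asymptotics.isLittleO_norm_pow_id one_lt_two)
  refine Asymptotics.IsBigO.of_bound c ?_
  filter_upwards [Metric.closedBall_mem_nhds (0 : E) one_pos] with ξ hξ
  rw [zero_add, norm_pow, norm_norm]
  exact h ξ (by simpa using hξ)

/-! ### Fréchet derivatives of the expected value. -/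

section Frechet

variable {Ω : Type*} {mΩ : MeasurableSpace Ω} {P : Measure Ω} [IsProbabilityMeasure P] {d : ℕ}
  {μ : Measure ℝ} [IsFiniteMeasure μ] {x : ℝ → Ω → EuclideanSpace ℝ (Fin d)} {C κ A : ℝ} {n : ℕ}
  {g : ℝ → EuclideanSpace ℝ (Fin d) → ℝ}
  {g₁ : ℝ → EuclideanSpace ℝ (Fin d) → EuclideanSpace ℝ (Fin d) →L[ℝ] ℝ}
  {g₂ : ℝ → EuclideanSpace ℝ (Fin d) →
      EuclideanSpace ℝ (Fin d) →L[ℝ] EuclideanSpace ℝ (Fin d) →L[ℝ] ℝ}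
  {φ : ℝ → ℝ} {E : Type*} [NormedAddCommGroup E] [NormedSpace ℝ E]
  {e : E →ₗ[ℝ] (ℝ → EuclideanSpace ℝ (Fin d))}

theorem abs_integral_firstVariation_le (hφ : PolyBounded φ A n) (hg : TaylorFamily g g₁ g₂ C κ)
    (hκ : 0 ≤ κ) (hx : ExpBounded P x) (he : ∀ ξ, Measurable (e ξ)) (heb : ∀ ξ s, ‖e ξ s‖ ≤ ‖ξ‖)
    (ξ : E) :
    |∫ w, firstVariation μ g g₁ φ x (e ξ) w ∂P| ≤
      (∫ w, A * (1 + expIntegral μ (fun _ => C) κ x w) ^ n *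
        expIntegral μ (fun _ => C) κ x w ^ 1 ∂P) * ‖ξ‖ := by
  have hC := hg.nonneg
  rw [← integral_mul_const, ← Real.norm_eq_abs]
  refine norm_integral_le_of_norm_le ((hφ.integrable_dominating (μ := μ) hκ hx (integrable_const C)
    (fun _ => hC) 1).mul_const _) (ae_of_all _ fun w => ?_)
  have h0 := expIntegral_nonneg (μ := μ) (J := x) (fun _ => hC) κ w
  have h1 := hφ.abs_comp_le (μ := μ) (k := 1) (by norm_num) hg hκ hx (integrable_const C)
    (fun _ => le_rfl) w
  have h2 := (hg.weighted₁ (he ξ) (heb ξ)).abs_integral_le (μ := μ) hx (integrable_const _) hκ w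
  rw [iteratedDeriv_one] at h1
  have h3 : expIntegral μ (fun _ => C * ‖ξ‖) κ x w = expIntegral μ (fun _ => C) κ x w * ‖ξ‖ :=
    expIntegral_mul_const (Λ := fun _ => C) _ w
  rw [h3] at h2
  rw [firstVariation, Real.norm_eq_abs, abs_mul, pow_one, mul_assoc]
  have hA := hφ.nonneg
  exact mul_le_mul h1 h2 (abs_nonneg _) (by positivity)

/-- The variation is linear in the direction, and its mean is at most a constant times ‖ξ‖ because
`e` sends ξ to a path of supremum at most ‖ξ‖. -/
theorem exists_firstDeriv (hφ : PolyBounded φ A n) (hg : TaylorFamily g g₁ g₂ C κ)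
    (hκ : 0 ≤ κ) (hx : ExpBounded P x) (he : ∀ ξ, Measurable (e ξ))
    (heb : ∀ ξ s, ‖e ξ s‖ ≤ ‖ξ‖) :
    ∃ L : E →L[ℝ] ℝ, ∀ ξ, L ξ = ∫ w, firstVariation μ g g₁ φ x (e ξ) w ∂P := by
  have hi : ∀ ξ, Integrable (firstVariation μ g g₁ φ x (e ξ)) P := fun ξ =>
    integrable_firstVariation hφ hg hκ hx (he ξ) (heb ξ) (integrable_const _)
  have hp : ∀ ξ w, Integrable (fun s => g₁ s (x s w) (e ξ s)) μ := fun ξ w =>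
    (hg.weighted₁ (he ξ) (heb ξ)).integrable_path hx (integrable_const _) hκ w
  let L : E →ₗ[ℝ] ℝ :=
    { toFun := fun ξ => ∫ w, firstVariation μ g g₁ φ x (e ξ) w ∂P
      map_add' := fun ξ ζ => by
        rw [← integral_add (hi ξ) (hi ζ)]
        congr 1 with w
        simp only [firstVariation, map_add, Pi.add_apply]
        rw [integral_add (hp ξ w) (hp ζ w), mul_add]
      map_smul' := fun c ξ => by
        rw [RingHom.id_apply, smul_eq_mul, ← integral_const_mul]
        congr 1 with w
        simp only [firstVariation, map_smul, Pi.smul_apply, smul_eq_mul]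
        rw [integral_const_mul]
        ring }
  exact ⟨L.mkContinuous _ fun ξ => abs_integral_firstVariation_le hφ hg hκ hx he heb ξ,
    fun ξ => rfl⟩

/-- For each ω the scalar estimate applies with r = ‖ξ‖ and N the exponential integral. Its random
constant has finite mean, so the expected remainder is quadratic in ‖ξ‖. -/
theorem hasFDerivAt_expectedValue (hφ : PolyBounded φ A n) (hg : TaylorFamily g g₁ g₂ C κ)
    (hκ : 0 ≤ κ) (hx : ExpBounded P x) (he : ∀ ξ, Measurable (e ξ))
    (heb : ∀ ξ s, ‖e ξ s‖ ≤ ‖ξ‖) {L : E →L[ℝ] ℝ}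
    (hL : ∀ ξ, L ξ = ∫ w, firstVariation μ g g₁ φ x (e ξ) w ∂P) :
    HasFDerivAt (fun ξ => expectedValue P μ g φ fun s w => e ξ s + x s w) L 0 := by
  have hC := hg.nonneg
  refine hasFDerivAt_zero_of_norm_le
    (c := ∫ w, 5 * A * (1 + 3 * expIntegral μ (fun _ => C) κ x w) ^ (n + 2) ∂P) fun ξ hξ => ?_
  have hxξ := hx.add_path (he ξ) (heb ξ)
  have i0 := integrable_comp (μ := μ) hφ hg hκ hxξ
  have i1 := integrable_comp (μ := μ) hφ hg hκ hx
  have i2 := integrable_firstVariation (μ := μ) hφ hg hκ hx (he ξ) (heb ξ) (integrable_const _)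
  simp only [map_zero, Pi.zero_apply, zero_add]
  rw [hL, expectedValue, expectedValue, ← integral_sub i0 i1, ← integral_sub
    (show Integrable (fun w => φ (∫ s, g s (e ξ s + x s w) ∂μ) - φ (∫ s, g s (x s w) ∂μ)) P from
      i0.sub i1) i2, ← integral_mul_const]
  refine norm_integral_le_of_norm_le (((hx.integrable_one_add_expIntegral_pow (μ := μ)
    (integrable_const C) (fun _ => hC) hκ 3 (n + 2)).const_mul (5 * A)).mul_const _)
    (ae_of_all _ fun w => ?_)
  have h0 := expIntegral_nonneg (μ := μ) (J := x) (fun _ => hC) κ w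
  have h3 : expIntegral μ (fun _ => C * ‖ξ‖) κ x w = expIntegral μ (fun _ => C) κ x w * ‖ξ‖ :=
    expIntegral_mul_const (Λ := fun _ => C) _ w
  have h2 := (hg.weighted₁ (he ξ) (heb ξ)).abs_integral_le (μ := μ) hx (integrable_const _) hκ w
  rw [h3] at h2
  exact hφ.abs_taylor_le h0 (norm_nonneg ξ) hξ
    (hg.weighted₀.abs_integral_le hx (integrable_const C) hκ w) h2
    (hg.abs_integral_taylor₀_le hκ hx (he ξ) hξ (heb ξ) w)

theorem abs_integral_secondVariation_le (hφ : PolyBounded φ A n)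
    (hg : TaylorFamily g g₁ g₂ C κ) (hκ : 0 ≤ κ) (hx : ExpBounded P x)
    (he : ∀ ξ, Measurable (e ξ)) (heb : ∀ ξ s, ‖e ξ s‖ ≤ ‖ξ‖) (ξ ζ : E) :
    |∫ w, secondVariation μ g g₁ g₂ φ x (e ξ) (e ζ) w ∂P| ≤
      (∫ w, (A * (1 + expIntegral μ (fun _ => C) κ x w) ^ n *
        expIntegral μ (fun _ => C) κ x w ^ 2 + A * (1 + expIntegral μ (fun _ => C) κ x w) ^ n *
        expIntegral μ (fun _ => C) κ x w ^ 1) ∂P) * ‖ξ‖ * ‖ζ‖ := by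
  have hC := hg.nonneg
  rw [mul_assoc, ← integral_mul_const, ← Real.norm_eq_abs]
  have hd := fun k => hφ.integrable_dominating (μ := μ) hκ hx (integrable_const C) (fun _ => hC) k
  refine norm_integral_le_of_norm_le (((hd 2).add (hd 1)).mul_const _) (ae_of_all _ fun w => ?_)
  have h0 := expIntegral_nonneg (μ := μ) (J := x) (fun _ => hC) κ w
  have h1 := hφ.abs_comp_le (μ := μ) (k := 1) (by norm_num) hg hκ hx (integrable_const C)
    (fun _ => le_rfl) w
  have h1' := hφ.abs_comp_le (μ := μ) (k := 2) (by norm_num) hg hκ hx (integrable_const C)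
    (fun _ => le_rfl) w
  have h2 := fun ξ =>
    (hg.weighted₁ (he ξ) (heb ξ)).abs_integral_le (μ := μ) hx (integrable_const _) hκ w
  have h4 := (hg.weighted₂ (he ξ) (heb ξ) (he ζ) (heb ζ)).abs_integral_le (μ := μ) hx
    (integrable_const _) hκ w
  rw [iteratedDeriv_one] at h1
  have h3 : ∀ r, expIntegral μ (fun _ => C * r) κ x w = expIntegral μ (fun _ => C) κ x w * r :=
    fun r => expIntegral_mul_const (Λ := fun _ => C) r w
  simp only [h3] at h2 h4
  have hA := hφ.nonneg
  rw [secondVariation, Real.norm_eq_abs]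
  refine (abs_add_le _ _).trans ?_
  rw [abs_mul, abs_mul, abs_mul]
  generalize expIntegral μ (fun _ => C) κ x w = N at *
  calc _ ≤ A * (1 + N) ^ n * (N * ‖ξ‖ * (N * ‖ζ‖)) + A * (1 + N) ^ n * (N * (‖ξ‖ * ‖ζ‖)) := by
        gcongr
        · exact h2 ξ
        · exact h2 ζ
    _ = _ := by ring

theorem exists_secondDeriv (hφ : PolyBounded φ A n) (hg : TaylorFamily g g₁ g₂ C κ)
    (hκ : 0 ≤ κ) (hx : ExpBounded P x) (he : ∀ ξ, Measurable (e ξ))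
    (heb : ∀ ξ s, ‖e ξ s‖ ≤ ‖ξ‖) :
    ∃ B : E →L[ℝ] E →L[ℝ] ℝ,
      ∀ ξ ζ, B ξ ζ = ∫ w, secondVariation μ g g₁ g₂ φ x (e ξ) (e ζ) w ∂P := by
  have hi : ∀ ξ ζ, Integrable (secondVariation μ g g₁ g₂ φ x (e ξ) (e ζ)) P := fun ξ ζ =>
    -- One α has to bound both directions.
    integrable_secondVariation (α := fun _ => max ‖ξ‖ ‖ζ‖) hφ hg hκ hx (he ξ)
      (fun s => (heb ξ s).trans (le_max_left _ _)) (he ζ)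
      (fun s => (heb ζ s).trans (le_max_right _ _)) (integrable_const _) (integrable_const _)
  have hp : ∀ ξ w, Integrable (fun s => g₁ s (x s w) (e ξ s)) μ := fun ξ w =>
    (hg.weighted₁ (he ξ) (heb ξ)).integrable_path hx (integrable_const _) hκ w
  have hq : ∀ ξ ζ w, Integrable (fun s => g₂ s (x s w) (e ξ s) (e ζ s)) μ := fun ξ ζ w =>
    (hg.weighted₂ (he ξ) (heb ξ) (he ζ) (heb ζ)).integrable_path hx (integrable_const _) hκ w
  let B : E →ₗ[ℝ] E →ₗ[ℝ] ℝ := LinearMap.mk₂ ℝ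
    (fun ξ ζ => ∫ w, secondVariation μ g g₁ g₂ φ x (e ξ) (e ζ) w ∂P)
    (fun ξ ξ' ζ => by
      rw [← integral_add (hi ξ ζ) (hi ξ' ζ)]
      congr 1 with w
      simp only [secondVariation, map_add, Pi.add_apply, add_apply]
      rw [integral_add (hp ξ w) (hp ξ' w), integral_add (hq ξ ζ w) (hq ξ' ζ w)]
      ring)
    (fun c ξ ζ => by
      rw [smul_eq_mul, ← integral_const_mul]
      congr 1 with w
      simp only [secondVariation, map_smul, Pi.smul_apply, smul_apply,
        smul_eq_mul]
      rw [integral_const_mul, integral_const_mul]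
      ring)
    (fun ξ ζ ζ' => by
      rw [← integral_add (hi ξ ζ) (hi ξ ζ')]
      congr 1 with w
      simp only [secondVariation, map_add, Pi.add_apply]
      rw [integral_add (hp ζ w) (hp ζ' w), integral_add (hq ξ ζ w) (hq ξ ζ' w)]
      ring)
    (fun c ξ ζ => by
      rw [smul_eq_mul, ← integral_const_mul]
      congr 1 with w
      simp only [secondVariation, map_smul, Pi.smul_apply, smul_eq_mul]
      rw [integral_const_mul, integral_const_mul]
      ring)
  exact ⟨B.mkContinuous₂ _ fun ξ ζ => abs_integral_secondVariation_le hφ hg hκ hx he heb ξ ζ,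
    fun ξ ζ => rfl⟩

/-- The remainder must be small in operator norm, so it is tested on ζ. The parameter ρ = ‖ζ‖ of
`abs_taylor_mul_le` makes the estimate proportional to ‖ζ‖. -/
theorem hasFDerivAt_firstDeriv (hφ : PolyBounded φ A n) (hg : TaylorFamily g g₁ g₂ C κ)
    (hκ : 0 ≤ κ) (hx : ExpBounded P x) (he : ∀ ξ, Measurable (e ξ))
    (heb : ∀ ξ s, ‖e ξ s‖ ≤ ‖ξ‖) {F : E → E →L[ℝ] ℝ}
    (hF : ∀ ξ ζ, F ξ ζ = ∫ w, firstVariation μ g g₁ φ (fun s w => e ξ s + x s w) (e ζ) w ∂P)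
    {B : E →L[ℝ] E →L[ℝ] ℝ}
    (hB : ∀ ξ ζ, B ξ ζ = ∫ w, secondVariation μ g g₁ g₂ φ x (e ξ) (e ζ) w ∂P) :
    HasFDerivAt F B 0 := by
  have hC := hg.nonneg
  have hA := hφ.nonneg
  have h0 := fun w => expIntegral_nonneg (μ := μ) (J := x) (fun _ => hC) κ w
  set c := ∫ w, 18 * A * (1 + 3 * expIntegral μ (fun _ => C) κ x w) ^ (n + 3) ∂P
  have hc : 0 ≤ c := integral_nonneg fun w => by have := h0 w; positivity
  refine hasFDerivAt_zero_of_norm_le (c := c) fun ξ hξ => ?_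
  refine ContinuousLinearMap.opNorm_le_bound _ (by positivity) fun ζ => ?_
  have hxξ := hx.add_path (he ξ) (heb ξ)
  have i0 := integrable_firstVariation (μ := μ) hφ hg hκ hxξ (he ζ) (heb ζ) (integrable_const _)
  have i1 := integrable_firstVariation (μ := μ) hφ hg hκ hx (he ζ) (heb ζ) (integrable_const _)
  have i2 := integrable_secondVariation (μ := μ) (α := fun _ => max ‖ξ‖ ‖ζ‖) hφ hg hκ hx (he ξ)
      (fun s => (heb ξ s).trans (le_max_left _ _)) (he ζ)
      (fun s => (heb ζ s).trans (le_max_right _ _)) (integrable_const _) (integrable_const _)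
  rw [sub_apply, sub_apply, hF, hF, hB]
  simp only [map_zero, Pi.zero_apply, zero_add]
  rw [← integral_sub i0 i1, ← integral_sub
    (show Integrable (fun w => firstVariation μ g g₁ φ (fun s w => e ξ s + x s w) (e ζ) w -
      firstVariation μ g g₁ φ x (e ζ) w) P from i0.sub i1) i2, mul_assoc, ← integral_mul_const]
  refine norm_integral_le_of_norm_le (((hx.integrable_one_add_expIntegral_pow (μ := μ)
    (integrable_const C) (fun _ => hC) hκ 3 (n + 3)).const_mul (18 * A)).mul_const _)
    (ae_of_all _ fun w => ?_)
  have h3 : ∀ r, expIntegral μ (fun _ => C * r) κ x w = expIntegral μ (fun _ => C) κ x w * r :=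
    fun r => expIntegral_mul_const (Λ := fun _ => C) r w
  have h2 := fun ξ =>
    (hg.weighted₁ (he ξ) (heb ξ)).abs_integral_le (μ := μ) hx (integrable_const _) hκ w
  have h4 := (hg.weighted₂ (he ξ) (heb ξ) (he ζ) (heb ζ)).abs_integral_le (μ := μ) hx
    (integrable_const _) hκ w
  simp only [h3] at h2 h4
  rw [← mul_assoc (expIntegral μ (fun _ => C) κ x w)] at h4
  exact hφ.abs_taylor_mul_le (h0 w) (norm_nonneg ξ) hξ (norm_nonneg ζ)
    (hg.weighted₀.abs_integral_le hx (integrable_const C) hκ w) (h2 ξ)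
    (hg.abs_integral_taylor₀_le hκ hx (he ξ) hξ (heb ξ) w) (h2 ζ) h4
    (hg.abs_integral_taylor₁_le hκ hx (he ξ) hξ (heb ξ) (he ζ) (heb ζ) w)

end Frechet

/-! ### Limits along directions dominated by a square integrable function. -/

section Limits

variable {Ω : Type*} {mΩ : MeasurableSpace Ω} {P : Measure Ω} [IsProbabilityMeasure P] {d : ℕ}
  {μ : Measure ℝ} [IsFiniteMeasure μ] {x : ℝ → Ω → EuclideanSpace ℝ (Fin d)} {C κ A : ℝ} {n : ℕ}
  {g : ℝ → EuclideanSpace ℝ (Fin d) → ℝ}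
  {g₁ : ℝ → EuclideanSpace ℝ (Fin d) → EuclideanSpace ℝ (Fin d) →L[ℝ] ℝ}
  {g₂ : ℝ → EuclideanSpace ℝ (Fin d) →
      EuclideanSpace ℝ (Fin d) →L[ℝ] EuclideanSpace ℝ (Fin d) →L[ℝ] ℝ}
  {φ : ℝ → ℝ} {ι : Type*} {l : Filter ι} [l.IsCountablyGenerated]
  {y : ι → ℝ → EuclideanSpace ℝ (Fin d)} {k : ℝ → EuclideanSpace ℝ (Fin d)} {α : ℝ → ℝ}

/-- Dominated convergence in time for fixed ω: the path is bounded, so Cα_s e^{κ‖x_s‖} is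
integrable. -/
theorem tendsto_integral_fderiv (hg : TaylorFamily g g₁ g₂ C κ)
    (hκ : 0 ≤ κ) (hx : ExpBounded P x) (hy : ∀ i, Measurable (y i))
    (hyα : ∀ᶠ i in l, ∀ s, ‖y i s‖ ≤ α s) (hyk : ∀ s, Tendsto (fun i => y i s) l (𝓝 (k s)))
    (hαi : Integrable α μ) (w : Ω) :
    Tendsto (fun i => ∫ s, g₁ s (x s w) (y i s) ∂μ) l (𝓝 (∫ s, g₁ s (x s w) (k s) ∂μ)) := by
  refine tendsto_integral_filter_of_dominated_convergence
    (fun s => C * α s * Real.exp (κ * ‖x s w‖)) (Eventually.of_forall fun i => ?_) ?_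
    (hx.integrable_path (hαi.const_mul C) hκ w) (ae_of_all _ fun s => ?_)
  · exact ((hg.weighted₁ (hy i) fun s => le_rfl).measurable.comp
      (measurable_id.prodMk (hx.measurable_path w))).aestronglyMeasurable
  · filter_upwards [hyα] with i hi
    exact ae_of_all _ fun s => (hg.weighted₁ (hy i) hi).bound s _
  · exact ((g₁ s (x s w)).continuous.tendsto _).comp (hyk s)

theorem tendsto_integral_fderiv_fderiv (hg : TaylorFamily g g₁ g₂ C κ)
    (hκ : 0 ≤ κ) (hx : ExpBounded P x) (hy : ∀ i, Measurable (y i))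
    (hyα : ∀ᶠ i in l, ∀ s, ‖y i s‖ ≤ α s) (hyk : ∀ s, Tendsto (fun i => y i s) l (𝓝 (k s)))
    (hα2i : Integrable (fun s => α s * α s) μ) (w : Ω) :
    Tendsto (fun i => ∫ s, g₂ s (x s w) (y i s) (y i s) ∂μ) l
      (𝓝 (∫ s, g₂ s (x s w) (k s) (k s) ∂μ)) := by
  refine tendsto_integral_filter_of_dominated_convergence
    (fun s => C * (α s * α s) * Real.exp (κ * ‖x s w‖)) (Eventually.of_forall fun i => ?_) ?_
    (hx.integrable_path (hα2i.const_mul C) hκ w) (ae_of_all _ fun s => ?_)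
  · exact ((hg.weighted₂ (hy i) (fun s => le_rfl) (hy i) fun s => le_rfl).measurable.comp
      (measurable_id.prodMk (hx.measurable_path w))).aestronglyMeasurable
  · filter_upwards [hyα] with i hi
    exact ae_of_all _ fun s => (hg.weighted₂ (hy i) hi (hy i) hi).bound s _
  · have h1 : Tendsto (fun i => g₂ s (x s w) (y i s)) l (𝓝 (g₂ s (x s w) (k s))) :=
      ((g₂ s (x s w)).continuous.tendsto _).comp (hyk s)
    exact ((isBoundedBilinearMap_apply (𝕜 := ℝ) (E := EuclideanSpace ℝ (Fin d))
      (F := ℝ)).continuous.tendsto _).comp (h1.prodMk_nhds (hyk s))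

/-- A second dominated convergence, now on Ω, with the bound of `abs_firstVariation_le`, which
depends on α alone. -/
theorem tendsto_integral_firstVariation (hφ : PolyBounded φ A n) (hg : TaylorFamily g g₁ g₂ C κ)
    (hκ : 0 ≤ κ) (hx : ExpBounded P x) (hy : ∀ i, Measurable (y i))
    (hyα : ∀ᶠ i in l, ∀ s, ‖y i s‖ ≤ α s) (hyk : ∀ s, Tendsto (fun i => y i s) l (𝓝 (k s)))
    (hα0 : ∀ s, 0 ≤ α s) (hαi : Integrable α μ) :
    Tendsto (fun i => ∫ w, firstVariation μ g g₁ φ x (y i) w ∂P) l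
      (𝓝 (∫ w, firstVariation μ g g₁ φ x k w ∂P)) := by
  have hC := hg.nonneg
  have hΛ : Integrable (fun s => C + C * α s) μ := (integrable_const C).add (hαi.const_mul C)
  have h1 := hφ.integrable_dominating hκ hx hΛ (fun s => by have := hα0 s; positivity) 1
  simp only [pow_one] at h1
  refine tendsto_integral_filter_of_dominated_convergence _ ?_ ?_ h1 (ae_of_all _ fun w => ?_)
  · filter_upwards [hyα] with i hi
    exact (integrable_firstVariation hφ hg hκ hx (hy i) hi hαi).aestronglyMeasurable
  · filter_upwards [hyα] with i hi
    exact ae_of_all _ fun w => abs_firstVariation_le hφ hg hκ hx hΛ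
      (fun s => le_add_of_nonneg_right (mul_nonneg hC (hα0 s))) (hy i) hi
      (fun s => le_add_of_nonneg_left hC) hαi w
  · exact (tendsto_integral_fderiv hg hκ hx hy hyα hyk hαi w).const_mul _

/-- The Hessian is evaluated twice at the direction, and this is why α² has to be integrable as
well. -/
theorem tendsto_integral_secondVariation (hφ : PolyBounded φ A n)
    (hg : TaylorFamily g g₁ g₂ C κ) (hκ : 0 ≤ κ) (hx : ExpBounded P x)
    (hy : ∀ i, Measurable (y i)) (hyα : ∀ᶠ i in l, ∀ s, ‖y i s‖ ≤ α s)
    (hyk : ∀ s, Tendsto (fun i => y i s) l (𝓝 (k s))) (hα0 : ∀ s, 0 ≤ α s)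
    (hαi : Integrable α μ) (hα2i : Integrable (fun s => α s * α s) μ) :
    Tendsto (fun i => ∫ w, secondVariation μ g g₁ g₂ φ x (y i) (y i) w ∂P) l
      (𝓝 (∫ w, secondVariation μ g g₁ g₂ φ x k k w ∂P)) := by
  have hC := hg.nonneg
  have hΛ : Integrable (fun s => C + C * α s + C * (α s * α s)) μ :=
    ((integrable_const C).add (hαi.const_mul C)).add (hα2i.const_mul C)
  have hp : ∀ s, 0 ≤ C * α s ∧ 0 ≤ C * (α s * α s) := fun s => by
    have := hα0 s
    constructor <;> positivity
  have h1 := hφ.integrable_dominating hκ hx hΛ (fun s => by linarith [hp s]) 1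
  have h2 := hφ.integrable_dominating hκ hx hΛ (fun s => by linarith [hp s]) 2
  simp only [pow_one] at h1
  refine tendsto_integral_filter_of_dominated_convergence _ ?_ ?_ (h2.add h1)
    (ae_of_all _ fun w => ?_)
  · filter_upwards [hyα] with i hi
    exact (integrable_secondVariation hφ hg hκ hx (hy i) hi (hy i) hi hαi
      hα2i).aestronglyMeasurable
  · filter_upwards [hyα] with i hi
    exact ae_of_all _ fun w => abs_secondVariation_le hφ hg hκ hx hΛ
      (fun s => by linarith [hp s]) (hy i) hi (hy i) hi (fun s => by linarith [hp s])
      (fun s => by linarith [hp s]) hαi hα2i w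
  · have h3 := tendsto_integral_fderiv hg hκ hx hy hyα hyk hαi w
    exact ((h3.mul h3).const_mul _).add
      ((tendsto_integral_fderiv_fderiv hg hκ hx hy hyα hyk hα2i w).const_mul _)

end Limits

/-! ### Conditioning time integrals along a sum of known and independent parts. -/

section Conditional

variable {Ω : Type*} {m mΩ : MeasurableSpace Ω} {P : Measure Ω} [IsProbabilityMeasure P] {d : ℕ}
  {μ : Measure ℝ} [SFinite μ] {X Y Z : ℝ → Ω → EuclideanSpace ℝ (Fin d)} {Λ : ℝ → ℝ} {κ D : ℝ}
  {h : ℝ → EuclideanSpace ℝ (Fin d) → ℝ}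

theorem WeightedFamily.average (hh : WeightedFamily h Λ κ) (hκ : 0 ≤ κ) (hD0 : 0 ≤ D)
    (hY : Measurable (Function.uncurry Y))
    (hD : ∀ s, ∫⁻ w, ENNReal.ofReal (Real.exp (κ * ‖Y s w‖)) ∂P ≤ ENNReal.ofReal D) :
    WeightedFamily (average P Y h) (fun s => Λ s * D) κ := by
  refine ⟨measurable_average hY hh.measurable, fun s x => ?_⟩
  have hΛ : 0 ≤ Λ s := (mul_nonneg_iff_of_pos_right (Real.exp_pos _)).1
    ((norm_nonneg _).trans (hh.bound s x))
  exact norm_integral_comp_add_le hκ hΛ hD0 (hY.comp (measurable_const.prodMk measurable_id))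
    (hD s) fun w => hh.bound s _

/-- The conditional expectation of a time integral along a process `Z = X + Y`, with `X` known and
`Y` independent of the conditioning, is obtained by averaging over `Y`. -/
theorem condExp_integral_comp (hm : m ≤ mΩ) (hX : ExpBounded P X) (hY : ExpBounded P Y)
    (hZ : ExpBounded P Z) (hXm : ∀ s, AEStronglyMeasurable[m] (X s) P)
    (hYi : ∀ s, Indep (MeasurableSpace.comap (Y s) inferInstance) m P)
    (hXYZ : ∀ s, ∀ᵐ w ∂P, Z s w = X s w + Y s w) (hh : WeightedFamily h Λ κ) (hκ : 0 ≤ κ)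
    (hΛ : Integrable Λ μ) :
    P[fun w => ∫ s, h s (Z s w) ∂μ | m] =ᵐ[P] fun w => ∫ s, average P Y h s (X s w) ∂μ := by
  obtain ⟨D, hD0, hD⟩ := hY.moment κ hκ
  have hi := hh.integrable_prod hZ hΛ hκ
  -- It is enough to identify the conditional expectation at almost every single time, where the
  -- freezing lemma applies.
  refine condExp_integral_comm (y := fun s w => h s (Z s w))
    (z := fun s w => average P Y h s (X s w)) hm hi
    ((hh.average hκ hD0 hY.measurable hD).integrable_prod hX (hΛ.mul_const D) hκ) ?_
  filter_upwards [hi.prod_right_ae] with s hs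
  have hs' : Integrable (fun w => h s (X s w + Y s w)) P := by
    refine (show Integrable (fun w => h s (Z s w)) P from hs).congr ?_
    filter_upwards [hXYZ s] with w hw
    rw [hw]
  have h1 := condExp_comp_add_of_indep hm (hXm s) (hY.measurable_apply s) (hYi s)
    (measurable_section hh.measurable s) hs'
  refine h1.symm.trans (condExp_congr_ae ?_)
  filter_upwards [hXYZ s] with w hw
  rw [hw]

end Conditional

/-! ### Directions of perturbation and the singular kernel. -/

section Directions

variable {d m : ℕ} {t Tb : ℝ}

/-- `η 1_{(t,Tb]}`, as a linear function of `η ∈ C([t,Tb], ℝᵈ)`. -/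
noncomputable def extendDir (t Tb : ℝ) :
    C(Icc t Tb, EuclideanSpace ℝ (Fin d)) →ₗ[ℝ] (ℝ → EuclideanSpace ℝ (Fin d)) where
  toFun η := open scoped Classical in
    fun s => if h : s ∈ Ioc t Tb then η ⟨s, Ioc_subset_Icc_self h⟩ else 0
  map_add' η ζ := by
    funext s
    by_cases h : s ∈ Ioc t Tb
    · simp only [Pi.add_apply, dif_pos h, ContinuousMap.add_apply]
    · simp only [Pi.add_apply, dif_neg h, add_zero]
  map_smul' c η := by
    funext s
    by_cases h : s ∈ Ioc t Tb
    · simp only [Pi.smul_apply, dif_pos h, ContinuousMap.smul_apply, RingHom.id_apply]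
    · simp only [Pi.smul_apply, dif_neg h, smul_zero]

theorem extendDir_of_mem {s : ℝ} (h : s ∈ Ioc t Tb)
    (η : C(Icc t Tb, EuclideanSpace ℝ (Fin d))) :
    extendDir t Tb η s = η ⟨s, Ioc_subset_Icc_self h⟩ := dif_pos h

theorem extendDir_of_notMem {s : ℝ} (h : s ∉ Ioc t Tb)
    (η : C(Icc t Tb, EuclideanSpace ℝ (Fin d))) : extendDir t Tb η s = 0 := dif_neg h

theorem norm_extendDir_le (η : C(Icc t Tb, EuclideanSpace ℝ (Fin d))) (s : ℝ) :
    ‖extendDir t Tb η s‖ ≤ ‖η‖ := by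
  by_cases h : s ∈ Ioc t Tb
  · rw [extendDir_of_mem h]
    exact η.norm_coe_le_norm _
  · rw [extendDir_of_notMem h, norm_zero]
    exact norm_nonneg _

theorem measurable_extendDir (η : C(Icc t Tb, EuclideanSpace ℝ (Fin d))) :
    Measurable (extendDir t Tb η) := by
  by_cases htb : t ≤ Tb
  · have : extendDir t Tb η = (Ioc t Tb).indicator fun s => η (projIcc t Tb htb s) := by
      funext s
      by_cases h : s ∈ Ioc t Tb
      · rw [extendDir_of_mem h, indicator_of_mem h, projIcc_of_mem htb (Ioc_subset_Icc_self h)]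
      · rw [extendDir_of_notMem h, indicator_of_notMem h]
    rw [this]
    exact (η.continuous.comp continuous_projIcc).measurable.indicator measurableSet_Ioc
  · have : extendDir t Tb η = 0 := by
      funext s
      exact extendDir_of_notMem (fun h => htb (h.1.le.trans h.2)) η
    rw [this]
    exact measurable_zero

/-- The two extensions of η differ only at time `t`, a null set. Dropping that time lets the
truncated kernels converge everywhere, although K(t+δ,t) may blow up. -/
theorem perturb_eq_extendDir_add {s : ℝ} (hs : s ≠ t) (ω : ℝ → EuclideanSpace ℝ (Fin d))
    (η : C(Icc t Tb, EuclideanSpace ℝ (Fin d))) :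
    perturb ω η s = extendDir t Tb η s + ω s := by
  rw [perturb, add_comm]
  congr 1
  by_cases h : s ∈ Icc t Tb
  · rw [dif_pos h, extendDir_of_mem ⟨lt_of_le_of_ne h.1 hs.symm, h.2⟩]
  · rw [dif_neg h, extendDir_of_notMem fun h' => h (Ioc_subset_Icc_self h')]

variable {K : ℝ → ℝ → Matrix (Fin d) (Fin m) ℝ}

theorem norm_kernelCol_le (t : ℝ) (j : Fin m) (s : ℝ) :
    ‖kernelCol K t j s‖ ≤ frobenius (K s t) := by
  rw [EuclideanSpace.norm_eq, frobenius]
  refine Real.sqrt_le_sqrt (Finset.sum_le_sum fun i _ => ?_)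
  rw [Real.norm_eq_abs, sq_abs]
  exact Finset.single_le_sum (f := fun j => (K s t i j) ^ 2) (fun j _ => sq_nonneg _)
    (Finset.mem_univ j)

/-- The singular direction `s ↦ 1_{(t,Tb]}(s) K^{(j)}(s,t)`. -/
noncomputable def singularDir (K : ℝ → ℝ → Matrix (Fin d) (Fin m) ℝ) (t Tb : ℝ) (j : Fin m) :
    ℝ → EuclideanSpace ℝ (Fin d) :=
  (Ioc t Tb).indicator (kernelCol K t j)

theorem measurable_singularDir {Tb' : ℝ} (hK : IsVolterraKernel Tb' K) (j : Fin m) :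
    Measurable (singularDir K t Tb j) := by
  refine Measurable.indicator ?_ measurableSet_Ioc
  refine (PiLp.continuous_toLp 2 _).measurable.comp (measurable_pi_lambda _ fun i => ?_)
  exact (hK.measurable i j).comp (measurable_id.prodMk measurable_const)

/-- At a fixed time s > t the truncation is inactive as soon as δ < s - t. -/
theorem tendsto_extendDir_truncCol (hK : KernelAssumption K) (ht : 0 ≤ t) (j : Fin m) (s : ℝ) :
    Tendsto (fun δ => extendDir t Tb (truncCol K Tb t δ j) s) (𝓝[>] 0)
      (𝓝 (singularDir K t Tb j s)) := by
  by_cases hs : s ∈ Ioc t Tb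
  · refine tendsto_const_nhds.congr' ?_
    have h1 : Iio (s - t) ∈ 𝓝[>] (0 : ℝ) :=
      mem_nhdsWithin_of_mem_nhds (Iio_mem_nhds (sub_pos.2 hs.1))
    filter_upwards [self_mem_nhdsWithin, h1] with δ hδ hδ'
    rw [extendDir_of_mem hs, truncCol_apply hK ht hδ, singularDir, indicator_of_mem hs,
      max_eq_left]
    have : δ < s - t := hδ'
    linarith
  · simp_rw [extendDir_of_notMem hs]
    rw [singularDir, indicator_of_notMem hs]
    exact tendsto_const_nhds

/-- A square integrable bound for the kernel and all its truncations. -/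
theorem KernelAssumption.exists_bound (hK : KernelAssumption K) (ht : 0 ≤ t) (htb : t ≤ Tb) :
    ∃ α : ℝ → ℝ, (∀ s, 0 ≤ α s) ∧ Integrable α volume ∧ Integrable (fun s => α s * α s) volume ∧
      (∀ j s, ‖singularDir K t Tb j s‖ ≤ α s) ∧
      ∀ j, ∀ᶠ δ in 𝓝[>] (0 : ℝ), ∀ s, ‖extendDir t Tb (truncCol K Tb t δ j) s‖ ≤ α s := by
  have hK0 := hK
  obtain ⟨C, H, hC, hH, hH1, h⟩ := hK
  -- The truncated kernel is evaluated at s ∨ (t+δ), at most Tb + 1 when δ ≤ 1. The power of s - t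
  -- bounds it when H ≤ 1/2, and `b` when H ≥ 1/2.
  set b := (Tb - t + 1) ^ (H - 1 / 2)
  have hb : 0 ≤ b := Real.rpow_nonneg (by linarith) _
  have hF : ∀ s ∈ Ioc t Tb, ∀ s', s ≤ s' → s' ≤ Tb + 1 →
      frobenius (K s' t) ≤ C * ((s - t) ^ (H - 1 / 2) + b) := by
    intro s hs s' hss' hs'
    have hst : 0 < s - t := sub_pos.2 hs.1
    refine ((h t s' ht (by linarith [hs.1])).2.1).trans (mul_le_mul_of_nonneg_left ?_ hC.le)
    have ha : 0 ≤ (s - t) ^ (H - 1 / 2) := Real.rpow_nonneg hst.le _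
    rcases le_total 0 (H - 1 / 2) with h0 | h0
    · have := Real.rpow_le_rpow (by linarith) (show s' - t ≤ Tb - t + 1 by linarith) h0
      exact this.trans (le_add_of_nonneg_left ha)
    · have := Real.rpow_le_rpow_of_nonpos hst (show s - t ≤ s' - t by linarith) h0
      exact this.trans (le_add_of_nonneg_right hb)
  have hr : ∀ r : ℝ, -1 < r → IntegrableOn (fun s => (s - t) ^ r) (Ioc t Tb) volume := by
    intro r hr
    have h1 := (intervalIntegral.intervalIntegrable_rpow' (a := 0) (b := Tb - t)
      hr).comp_sub_right t
    simp only [zero_add, sub_add_cancel] at h1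
    exact (intervalIntegrable_iff_integrableOn_Ioc_of_le htb).1 h1
  have hcst : ∀ c : ℝ, IntegrableOn (fun _ => c) (Ioc t Tb) volume := fun c =>
    integrableOn_const (by simp)
  refine ⟨(Ioc t Tb).indicator fun s => C * ((s - t) ^ (H - 1 / 2) + b), fun s => ?_, ?_, ?_, ?_,
    fun j => ?_⟩
  · refine indicator_nonneg (fun s hs => ?_) s
    exact mul_nonneg hC.le (add_nonneg (Real.rpow_nonneg (sub_pos.2 hs.1).le _) hb)
  · refine (integrable_indicator_iff measurableSet_Ioc).2 (Integrable.const_mul ?_ C)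
    exact (hr _ (by linarith)).add (hcst b)
  -- The worst term of the square has exponent 2H - 1 > -1, so it is integrable precisely because H
  -- > 0.
  · have e : (fun s => (Ioc t Tb).indicator (fun s => C * ((s - t) ^ (H - 1 / 2) + b)) s *
        (Ioc t Tb).indicator (fun s => C * ((s - t) ^ (H - 1 / 2) + b)) s) =
        (Ioc t Tb).indicator fun s => C ^ 2 * ((s - t) ^ (2 * H - 1) +
          2 * b * (s - t) ^ (H - 1 / 2) + b ^ 2) := by
      funext s
      by_cases hs : s ∈ Ioc t Tb
      · simp only [indicator_of_mem hs]
        have : (s - t) ^ (2 * H - 1) = (s - t) ^ (H - 1 / 2) * (s - t) ^ (H - 1 / 2) := by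
          rw [← Real.rpow_add (sub_pos.2 hs.1)]
          ring_nf
        rw [this]
        ring
      · simp [indicator_of_notMem hs]
    rw [e]
    refine (integrable_indicator_iff measurableSet_Ioc).2 (Integrable.const_mul ?_ (C ^ 2))
    exact ((hr _ (by linarith)).add ((hr _ (by linarith)).const_mul _)).add (hcst _)
  · intro j s
    by_cases hs : s ∈ Ioc t Tb
    · rw [singularDir, indicator_of_mem hs, indicator_of_mem hs]
      exact (norm_kernelCol_le t j s).trans (hF s hs s le_rfl (by linarith [hs.2]))
    · rw [singularDir, indicator_of_notMem hs, indicator_of_notMem hs, norm_zero]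
  · have h1 : Iic (1 : ℝ) ∈ 𝓝[>] (0 : ℝ) := mem_nhdsWithin_of_mem_nhds (Iic_mem_nhds one_pos)
    filter_upwards [self_mem_nhdsWithin, h1] with δ hδ hδ' s
    have hδ1 : δ ≤ 1 := hδ'
    by_cases hs : s ∈ Ioc t Tb
    · rw [extendDir_of_mem hs, truncCol_apply hK0 ht hδ, indicator_of_mem hs]
      refine (norm_kernelCol_le t j _).trans (hF s hs _ (le_max_left _ _) ?_)
      exact max_le (by linarith [hs.2]) (by linarith)
    · rw [extendDir_of_notMem hs, indicator_of_notMem hs, norm_zero]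

end Directions

/-! ### The value as an expected value of the averaged family. -/

section Value

variable {Ω : Type*} {mΩ : MeasurableSpace Ω} {P : Measure Ω} [IsProbabilityMeasure P] {d : ℕ}
  {f : ℝ → EuclideanSpace ℝ (Fin d) → ℝ} {φ : ℝ → ℝ}
  {J : ℝ → ℝ → ℝ → Ω → EuclideanSpace ℝ (Fin d)} {T Tb t C κ A : ℝ} {n : ℕ}

theorem average_eq_of_eq_zero {V : Type*} [NormedAddCommGroup V] [NormedSpace ℝ V]
    [CompleteSpace V] {I : ℝ → Ω → EuclideanSpace ℝ (Fin d)}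
    {h : ℝ → EuclideanSpace ℝ (Fin d) → V} {s : ℝ} (h0 : ∀ w, I s w = 0) :
    average P I h s = h s := by
  funext x
  simp [average, h0]

/-- Before `T` the averaging noise is zero, so the averaged family is `f` itself and the two
integrals of 𝔉 merge into one. Time `T`, where the noise is not assumed to vanish, is a null set. -/
theorem frakF_eq {I x : ℝ → Ω → EuclideanSpace ℝ (Fin d)}
    (hg : WeightedFamily (average P I (cutFamily Tb f)) (fun _ => C) κ) (hκ : 0 ≤ κ)
    (hx : ExpBounded P x) (hT : 0 ≤ T) (hTb : T ≤ Tb) (hI : ∀ s < T, ∀ w, I s w = 0)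
    {p : ℝ → EuclideanSpace ℝ (Fin d)} {w : Ω}
    (hp : ∀ᵐ s ∂volume.restrict (Ioc 0 Tb), p s = x s w) :
    frakF P f I T Tb p =
      ∫ s, average P I (cutFamily Tb f) s (x s w) ∂volume.restrict (Ioc 0 Tb) := by
  have hi : IntegrableOn (fun s => average P I (cutFamily Tb f) s (x s w)) (Ioc 0 Tb) :=
    hg.integrable_path hx (integrable_const C) hκ w
  have hp' := (ae_restrict_iff' measurableSet_Ioc).1 hp
  have i1 : IntervalIntegrable (fun s => average P I (cutFamily Tb f) s (x s w)) volume 0 T :=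
    (intervalIntegrable_iff_integrableOn_Ioc_of_le hT).2
      (hi.mono_set (Ioc_subset_Ioc_right hTb))
  have i2 : IntervalIntegrable (fun s => average P I (cutFamily Tb f) s (x s w)) volume T Tb :=
    (intervalIntegrable_iff_integrableOn_Ioc_of_le hTb).2
      (hi.mono_set (Ioc_subset_Ioc_left hT))
  rw [← intervalIntegral.integral_of_le (hT.trans hTb),
    ← intervalIntegral.integral_add_adjacent_intervals i1 i2, frakF]
  congr 1
  · refine intervalIntegral.integral_congr_ae ?_
    filter_upwards [hp', Measure.ae_ne volume T] with s hs hsT hmem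
    rw [uIoc_of_le hT] at hmem
    rw [hs ⟨hmem.1, hmem.2.trans hTb⟩,
      average_eq_of_eq_zero (hI s (lt_of_le_of_ne hmem.2 hsT)),
      cutFamily_eq ⟨hmem.1.le, hmem.2.trans hTb⟩]
  · refine intervalIntegral.integral_congr_ae ?_
    filter_upwards [hp'] with s hs hmem
    rw [uIoc_of_le hTb] at hmem
    rw [hs ⟨hT.trans_lt hmem.1, hmem.2⟩, average, frakf,
      cutFamily_eq ⟨hT.trans hmem.1.le, hmem.2⟩]

theorem value_eq (hg : WeightedFamily (average P (J T Tb) (cutFamily Tb f)) (fun _ => C) κ)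
    (hκ : 0 ≤ κ) (hJ : ExpBounded P (J t T)) (hT : 0 ≤ T) (hTb : T ≤ Tb)
    (hI : ∀ s < T, ∀ w, J T Tb s w = 0) {p y : ℝ → EuclideanSpace ℝ (Fin d)} (hy : Measurable y)
    {R : ℝ} (hR : ∀ s, ‖y s‖ ≤ R) (hp : ∀ᵐ s ∂volume.restrict (Ioc 0 Tb), p s = y s) :
    value P f φ J T Tb t p = expectedValue P (volume.restrict (Ioc 0 Tb))
      (average P (J T Tb) (cutFamily Tb f)) φ fun s w => y s + J t T s w := by
  rw [value, expectedValue]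
  congr 1 with w
  rw [frakF_eq hg hκ (hJ.add_path hy hR) hT hTb hI (w := w)]
  filter_upwards [hp] with s hs
  rw [hs]

variable {g₁ : ℝ → EuclideanSpace ℝ (Fin d) → EuclideanSpace ℝ (Fin d) →L[ℝ] ℝ}
  {g₂ : ℝ → EuclideanSpace ℝ (Fin d) →
      EuclideanSpace ℝ (Fin d) →L[ℝ] EuclideanSpace ℝ (Fin d) →L[ℝ] ℝ}
  {ω y : ℝ → EuclideanSpace ℝ (Fin d)} {R : ℝ}

theorem ae_perturb_eq (hω : ∀ᵐ s ∂volume.restrict (Ioc 0 Tb), ω s = y s)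
    (ξ : C(Icc t Tb, EuclideanSpace ℝ (Fin d))) :
    ∀ᵐ s ∂volume.restrict (Ioc 0 Tb), perturb ω ξ s = extendDir t Tb ξ s + y s := by
  filter_upwards [hω, ae_restrict_of_ae (Measure.ae_ne volume t)] with s hs hst
  rw [perturb_eq_extendDir_add hst, hs]

theorem hasFDerivAt_value (hφ : PolyBounded φ A n)
    (hg : TaylorFamily (average P (J T Tb) (cutFamily Tb f)) g₁ g₂ C κ)
    (hκ : 0 ≤ κ) (hJ : ExpBounded P (J t T)) (hT : 0 ≤ T) (hTb : T ≤ Tb)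
    (hI : ∀ s < T, ∀ w, J T Tb s w = 0) (hy : Measurable y) (hR : ∀ s, ‖y s‖ ≤ R)
    (hω : ∀ᵐ s ∂volume.restrict (Ioc 0 Tb), ω s = y s)
    {L : C(Icc t Tb, EuclideanSpace ℝ (Fin d)) →L[ℝ] ℝ}
    (hL : ∀ ζ, L ζ = ∫ w, firstVariation (volume.restrict (Ioc 0 Tb))
      (average P (J T Tb) (cutFamily Tb f)) g₁ φ (fun s w => y s + J t T s w)
      (extendDir t Tb ζ) w ∂P) :
    HasFDerivAt (fun ζ : C(Icc t Tb, EuclideanSpace ℝ (Fin d)) =>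
      value P f φ J T Tb t (perturb ω ζ)) L 0 := by
  have h := hasFDerivAt_expectedValue hφ hg hκ (hJ.add_path hy hR) measurable_extendDir
    norm_extendDir_le hL
  refine h.congr_of_eventuallyEq (Eventually.of_forall fun ζ => ?_)
  simp only [← add_assoc]
  refine value_eq (y := fun s => extendDir t Tb ζ s + y s) (R := ‖ζ‖ + R) hg.weighted₀ hκ hJ hT hTb
    hI ((measurable_extendDir ζ).add hy)
    (fun s => (norm_add_le _ _).trans (add_le_add (norm_extendDir_le ζ s) (hR s)))
    (ae_perturb_eq hω ζ)

/-- The value is Fréchet differentiable. -/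
theorem value_differentiable (hφ : PolyBounded φ A n)
    (hg : TaylorFamily (average P (J T Tb) (cutFamily Tb f)) g₁ g₂ C κ)
    (hκ : 0 ≤ κ) (hJ : ExpBounded P (J t T)) (hT : 0 ≤ T) (hTb : T ≤ Tb)
    (hI : ∀ s < T, ∀ w, J T Tb s w = 0) (hy : Measurable y) (hR : ∀ s, ‖y s‖ ≤ R)
    (hω : ∀ᵐ s ∂volume.restrict (Ioc 0 Tb), ω s = y s) :
    PathDifferentiableAt t Tb (value P f φ J T Tb t) ω ∧
    ∀ ζ, pathDeriv t Tb (value P f φ J T Tb t) ω ζ =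
      ∫ w, firstVariation (volume.restrict (Ioc 0 Tb)) (average P (J T Tb) (cutFamily Tb f)) g₁ φ
        (fun s w => y s + J t T s w) (extendDir t Tb ζ) w ∂P := by
  obtain ⟨L, hL⟩ := exists_firstDeriv (μ := volume.restrict (Ioc 0 Tb)) (e := extendDir t Tb) hφ hg
    hκ (hJ.add_path hy hR) measurable_extendDir norm_extendDir_le
  have h := hasFDerivAt_value hφ hg hκ hJ hT hTb hI hy hR hω hL
  refine ⟨h.differentiableAt, fun ζ => ?_⟩
  rw [pathDeriv, h.fderiv, hL]

/-- The value is twice Fréchet differentiable. -/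
theorem value_differentiable_two (hφ : PolyBounded φ A n)
    (hg : TaylorFamily (average P (J T Tb) (cutFamily Tb f)) g₁ g₂ C κ)
    (hκ : 0 ≤ κ) (hJ : ExpBounded P (J t T)) (hT : 0 ≤ T) (hTb : T ≤ Tb)
    (hI : ∀ s < T, ∀ w, J T Tb s w = 0) (hy : Measurable y) (hR : ∀ s, ‖y s‖ ≤ R)
    (hω : ∀ᵐ s ∂volume.restrict (Ioc 0 Tb), ω s = y s) :
    PathDifferentiableAt t Tb (pathDeriv t Tb (value P f φ J T Tb t)) ω ∧
    ∀ ξ ζ, pathDeriv t Tb (pathDeriv t Tb (value P f φ J T Tb t)) ω ξ ζ =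
      ∫ w, secondVariation (volume.restrict (Ioc 0 Tb)) (average P (J T Tb) (cutFamily Tb f)) g₁ g₂
        φ (fun s w => y s + J t T s w) (extendDir t Tb ξ) (extendDir t Tb ζ) w ∂P := by
  obtain ⟨B, hB⟩ := exists_secondDeriv (μ := volume.restrict (Ioc 0 Tb)) (e := extendDir t Tb) hφ
    hg hκ (hJ.add_path hy hR) measurable_extendDir norm_extendDir_le
  -- The first derivative is needed at perturbed paths, which may jump at `t`;
  -- `value_differentiable` covers them, as it asks only for a bounded measurable path up to null
  -- sets.
  have h := hasFDerivAt_firstDeriv (F := fun ξ => pathDeriv t Tb (value P f φ J T Tb t)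
    (perturb ω ξ)) hφ hg hκ (hJ.add_path hy hR) measurable_extendDir norm_extendDir_le
    (fun ξ ζ => by
      rw [(value_differentiable (y := fun s => extendDir t Tb ξ s + y s) (R := ‖ξ‖ + R) hφ hg hκ hJ
        hT hTb hI ((measurable_extendDir ξ).add hy)
        (fun s => (norm_add_le _ _).trans (add_le_add (norm_extendDir_le ξ s) (hR s)))
        (ae_perturb_eq hω ξ)).2]
      simp only [add_assoc]) hB
  refine ⟨h.differentiableAt, fun ξ ζ => ?_⟩
  rw [pathDeriv, h.fderiv, hB]

end Value

/-! ### Integrability of products along two processes. -/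

section Products

variable {Ω : Type*} {mΩ : MeasurableSpace Ω} {P : Measure Ω} [IsProbabilityMeasure P] {d : ℕ}
  {μ : Measure ℝ} [IsFiniteMeasure μ] {x z : ℝ → Ω → EuclideanSpace ℝ (Fin d)} {C κ κ' A : ℝ}
  {n : ℕ} {g : ℝ → EuclideanSpace ℝ (Fin d) → ℝ}
  {g₁ : ℝ → EuclideanSpace ℝ (Fin d) → EuclideanSpace ℝ (Fin d) →L[ℝ] ℝ}
  {g₂ : ℝ → EuclideanSpace ℝ (Fin d) →
      EuclideanSpace ℝ (Fin d) →L[ℝ] EuclideanSpace ℝ (Fin d) →L[ℝ] ℝ}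
  {φ : ℝ → ℝ} {Λ : ℝ → ℝ}

theorem mul_le_sq_add_sq (a b : ℝ) : a * b ≤ a ^ 2 + b ^ 2 := by
  nlinarith [sq_nonneg (a - b), sq_nonneg a, sq_nonneg b]

/-- Integrability of `φ^{(k)}(∫ g_s(x_s) ds) X` for `X` bounded by a power of an exponential
integral along another process. -/
theorem PolyBounded.integrable_mul (hφ : PolyBounded φ A n) {k : ℕ} (hk : k ≤ 3)
    (hg : TaylorFamily g g₁ g₂ C κ) (hκ : 0 ≤ κ) (hx : ExpBounded P x) (hz : ExpBounded P z)
    (hΛ : Integrable Λ μ) (hΛ0 : ∀ s, 0 ≤ Λ s) (hκ' : 0 ≤ κ') {X : Ω → ℝ}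
    (hXm : AEStronglyMeasurable X P) {j : ℕ} (hX : ∀ w, |X w| ≤ expIntegral μ Λ κ' z w ^ j) :
    Integrable (fun w => iteratedDeriv k φ (∫ s, g s (x s w) ∂μ) * X w) P := by
  -- The two factors live on different processes; ab ≤ a² + b² separates them, whence the doubled
  -- exponents.
  have h1 := (hx.integrable_one_add_expIntegral_pow (μ := μ) (integrable_const C)
    (fun _ => hg.nonneg) hκ 1 (n * 2)).const_mul (A ^ 2)
  have h2 := hz.integrable_one_add_expIntegral_pow hΛ hΛ0 hκ' 1 (j * 2)
  refine (h1.add h2).mono' ((hφ.aestronglyMeasurable_comp hk hg hκ hx).mul hXm)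
    (ae_of_all _ fun w => ?_)
  have h3 := hφ.abs_comp_le (μ := μ) hk hg hκ hx (integrable_const C) (fun _ => le_rfl) w
  have h4 := expIntegral_nonneg (μ := μ) (J := z) hΛ0 κ' w
  have h5 : |X w| ≤ (1 + 1 * expIntegral μ Λ κ' z w) ^ j :=
    (hX w).trans (pow_le_pow_left₀ h4 (by linarith) j)
  rw [norm_mul, Real.norm_eq_abs, Real.norm_eq_abs]
  simp only [Pi.add_apply]
  rw [pow_mul, pow_mul, ← mul_pow]
  exact (mul_le_mul h3 h5 (abs_nonneg _) ((abs_nonneg _).trans h3)).trans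
    (by simpa only [one_mul] using mul_le_sq_add_sq _ _)

end Products

/-! ### Removing the conditional expectation from linear terms. -/

section PullOut

variable {Ω : Type*} {m mΩ : MeasurableSpace Ω} {P : Measure Ω} [IsProbabilityMeasure P] {d : ℕ}
  {μ : Measure ℝ} [IsFiniteMeasure μ] {X Y Z : ℝ → Ω → EuclideanSpace ℝ (Fin d)} {Λ : ℝ → ℝ}
  {κ C A : ℝ} {n : ℕ} {φ : ℝ → ℝ} {h g : ℝ → EuclideanSpace ℝ (Fin d) → ℝ}
  {g₁ : ℝ → EuclideanSpace ℝ (Fin d) → EuclideanSpace ℝ (Fin d) →L[ℝ] ℝ}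
  {g₂ : ℝ → EuclideanSpace ℝ (Fin d) →
      EuclideanSpace ℝ (Fin d) →L[ℝ] EuclideanSpace ℝ (Fin d) →L[ℝ] ℝ} {V : Ω → ℝ}

theorem WeightedFamily.weight_nonneg (hh : WeightedFamily h Λ κ) (s : ℝ) : 0 ≤ Λ s :=
  (mul_nonneg_iff_of_pos_right (Real.exp_pos _)).1 ((norm_nonneg _).trans (hh.bound s 0))

theorem integrable_deriv_mul_integral (hX : ExpBounded P X) (hZ : ExpBounded P Z)
    (hh : WeightedFamily h Λ κ) (hκ : 0 ≤ κ) (hΛ : Integrable Λ μ) (hφ : PolyBounded φ A n)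
    (hg : TaylorFamily g g₁ g₂ C κ) (hVG : V =ᵐ[P] fun w => ∫ s, g s (X s w) ∂μ) :
    Integrable (fun w => deriv φ (V w) * ∫ s, h s (Z s w) ∂μ) P := by
  have h1 := hφ.integrable_mul (k := 1) (by norm_num) hg hκ hX hZ hΛ hh.weight_nonneg hκ
    (hh.integrable_integral hZ hΛ hκ).aestronglyMeasurable (j := 1)
    fun w => (hh.abs_integral_le hZ hΛ hκ w).trans_eq (pow_one _).symm
  rw [iteratedDeriv_one] at h1
  refine h1.congr ?_
  filter_upwards [hVG] with w hw
  rw [hw]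

/-- Condition on `m`: the factor φ'(V) is known and comes out, and the conditional time integral is
the averaged one along `X`. -/
theorem integral_deriv_mul_integral (hm : m ≤ mΩ) (hX : ExpBounded P X) (hY : ExpBounded P Y)
    (hZ : ExpBounded P Z) (hXm : ∀ s, AEStronglyMeasurable[m] (X s) P)
    (hYi : ∀ s, Indep (MeasurableSpace.comap (Y s) inferInstance) m P)
    (hXYZ : ∀ s, ∀ᵐ w ∂P, Z s w = X s w + Y s w) (hh : WeightedFamily h Λ κ) (hκ : 0 ≤ κ)
    (hΛ : Integrable Λ μ) (hφ : PolyBounded φ A n) (hg : TaylorFamily g g₁ g₂ C κ)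
    (hV : StronglyMeasurable[m] V) (hVG : V =ᵐ[P] fun w => ∫ s, g s (X s w) ∂μ) :
    ∫ w, deriv φ (V w) * ∫ s, h s (Z s w) ∂μ ∂P =
      ∫ w, deriv φ (∫ s, g s (X s w) ∂μ) * ∫ s, average P Y h s (X s w) ∂μ ∂P := by
  have hi := integrable_deriv_mul_integral hX hZ hh hκ hΛ hφ hg hVG
  rw [← integral_condExp hm]
  have h1 := condExp_mul_of_stronglyMeasurable_left (m := m)
    (hφ.continuous_deriv.comp_stronglyMeasurable hV) hi (hh.integrable_integral hZ hΛ hκ)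
  refine integral_congr_ae (h1.trans ?_)
  filter_upwards [hVG, condExp_integral_comp hm hX hY hZ hXm hYi hXYZ hh hκ hΛ] with w hw hw'
  rw [Pi.mul_apply, hw', hw]

/-- If `h` vanishes whenever `Y` does not, the time integral along `Z = X + Y` is known. -/
theorem condExp_integral_eq_self (hm : m ≤ mΩ) (hZ : ExpBounded P Z)
    (hXm : ∀ s, AEStronglyMeasurable[m] (X s) P)
    (hXYZ : ∀ s, ∀ᵐ w ∂P, Z s w = X s w + Y s w) (hh : WeightedFamily h Λ κ) (hκ : 0 ≤ κ)
    (hΛ : Integrable Λ μ) (h0 : ∀ᵐ s ∂μ, (∀ w, Y s w = 0) ∨ h s = 0) :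
    P[fun w => ∫ s, h s (Z s w) ∂μ | m] =ᵐ[P] fun w => ∫ s, h s (Z s w) ∂μ := by
  have hi := hh.integrable_prod hZ hΛ hκ
  refine condExp_integral_comm (y := fun s w => h s (Z s w)) hm hi hi ?_
  filter_upwards [h0, hi.prod_right_ae] with s hs his
  have hm' : AEStronglyMeasurable[m] (fun w => h s (Z s w)) P := by
    -- At each relevant time either Z = X almost surely, which is known, or the integrand is zero.
    rcases hs with hs | hs
    · obtain ⟨X', hX', hXX'⟩ := hXm s
      refine ⟨fun w => h s (X' w), ((measurable_section hh.measurable s).comp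
        hX'.measurable).stronglyMeasurable, ?_⟩
      filter_upwards [hXX', hXYZ s] with w hw hw'
      rw [hw', hs, add_zero, hw]
    · simp only [hs, Pi.zero_apply]
      exact aestronglyMeasurable_const
  exact (condExp_of_aestronglyMeasurable' hm hm' his).symm

end PullOut

/-! ### Averages of derivatives in a fixed direction. -/

section Averages

variable {Ω : Type*} {mΩ : MeasurableSpace Ω} {P : Measure Ω} {d : ℕ} {κ C : ℝ}
  {I : ℝ → Ω → EuclideanSpace ℝ (Fin d)} {g : ℝ → EuclideanSpace ℝ (Fin d) → ℝ}
  {g₁ : ℝ → EuclideanSpace ℝ (Fin d) → EuclideanSpace ℝ (Fin d) →L[ℝ] ℝ}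
  {g₂ : ℝ → EuclideanSpace ℝ (Fin d) →
      EuclideanSpace ℝ (Fin d) →L[ℝ] EuclideanSpace ℝ (Fin d) →L[ℝ] ℝ}

/-- Evaluation at a vector is a continuous linear map and commutes with the Bochner integral. This
matches the averages of scalar integrands from conditioning with the averaged derivatives of the
Fréchet formulae. -/
theorem TaylorFamily.average_apply₁ (hg : TaylorFamily g g₁ g₂ C κ) (hκ : 0 ≤ κ)
    (hI : ExpBounded P I) (y : ℝ → EuclideanSpace ℝ (Fin d)) (s : ℝ)
    (x : EuclideanSpace ℝ (Fin d)) :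
    VolDeriv.average P I (fun s θ => g₁ s θ (y s)) s x = VolDeriv.average P I g₁ s x (y s) := by
  obtain ⟨D, -, hD⟩ := hI.moment κ hκ
  exact (ContinuousLinearMap.integral_apply (integrable_comp_add hκ hg.nonneg
    (hI.measurable_apply s) (hD s) (measurable_section hg.measurable₁ s) (hg.bound₁ s) x)
    (y s)).symm

theorem TaylorFamily.average_apply₂ (hg : TaylorFamily g g₁ g₂ C κ) (hκ : 0 ≤ κ)
    (hI : ExpBounded P I) (y : ℝ → EuclideanSpace ℝ (Fin d)) (s : ℝ)
    (x : EuclideanSpace ℝ (Fin d)) :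
    VolDeriv.average P I (fun s θ => g₂ s θ (y s) (y s)) s x =
      VolDeriv.average P I g₂ s x (y s) (y s) := by
  obtain ⟨D, -, hD⟩ := hI.moment κ hκ
  have h := integrable_comp_add hκ hg.nonneg
    (hI.measurable_apply s) (hD s) (measurable_section hg.measurable₂ s) (hg.bound₂ s) x
  rw [VolDeriv.average, VolDeriv.average, ContinuousLinearMap.integral_apply h,
    ContinuousLinearMap.integral_apply (h.apply_continuousLinearMap (y s))]

end Averages

/-! ### Time integrals over (t,Tb] as integrals over (0,Tb]. -/

section TimeIntegrals

variable {t Tb : ℝ} {F G : ℝ → ℝ}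

theorem intervalIntegral_eq_of_indicator (ht : 0 ≤ t) (htb : t ≤ Tb)
    (hG : ∀ s, G s = (Ioc t Tb).indicator F s) :
    ∫ s in t..Tb, F s = ∫ s, G s ∂volume.restrict (Ioc 0 Tb) := by
  have : G = (Ioc t Tb).indicator F := funext hG
  rw [this, setIntegral_indicator measurableSet_Ioc, intervalIntegral.integral_of_le htb,
    inter_eq_self_of_subset_right (Ioc_subset_Ioc_left ht)]

theorem intervalIntegrable_of_indicator (ht : 0 ≤ t) (htb : t ≤ Tb)
    (hG : ∀ s, G s = (Ioc t Tb).indicator F s) (hi : Integrable G (volume.restrict (Ioc 0 Tb))) :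
    IntervalIntegrable F volume t Tb := by
  have h1 : IntegrableOn G (Ioc t Tb) := IntegrableOn.mono_set hi (Ioc_subset_Ioc_left ht)
  rw [intervalIntegrable_iff_integrableOn_Ioc_of_le htb]
  exact h1.congr_fun (fun s hs => by rw [hG, indicator_of_mem hs]) measurableSet_Ioc

variable {Ω : Type*} {d m : ℕ} {K : ℝ → ℝ → Matrix (Fin d) (Fin m) ℝ}
  {f : ℝ → EuclideanSpace ℝ (Fin d) → ℝ} {J : ℝ → ℝ → ℝ → Ω → EuclideanSpace ℝ (Fin d)}
  {ω : ℝ → EuclideanSpace ℝ (Fin d)}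

/-- Outside (t,Tb] the direction is zero, and inside neither cut-off, of f or of the path, has any
effect. -/
theorem fderiv_singularDir_eq_indicator (ht : 0 ≤ t) (j : Fin m) (w : Ω) (s : ℝ) :
    fderiv ℝ (cutFamily Tb f s) ((Icc 0 Tb).indicator ω s + J t Tb s w) (singularDir K t Tb j s) =
      (Ioc t Tb).indicator (gradTerm K f J Tb t ω j w) s := by
  by_cases hs : s ∈ Ioc t Tb
  · have hs' : s ∈ Icc 0 Tb := ⟨ht.trans hs.1.le, hs.2⟩
    rw [cutFamily_eq hs', singularDir, indicator_of_mem hs, indicator_of_mem hs,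
      indicator_of_mem hs', gradTerm, shiftedProcess]
  · rw [singularDir, indicator_of_notMem hs, indicator_of_notMem hs, map_zero]

theorem sum_fderiv_singularDir_eq_indicator (ht : 0 ≤ t) (w : Ω) (s : ℝ) :
    ∑ j, fderiv ℝ (fderiv ℝ (cutFamily Tb f s)) ((Icc 0 Tb).indicator ω s + J t Tb s w)
        (singularDir K t Tb j s) (singularDir K t Tb j s) =
      (Ioc t Tb).indicator (hessTerm K f J Tb t ω w) s := by
  by_cases hs : s ∈ Ioc t Tb
  · have hs' : s ∈ Icc 0 Tb := ⟨ht.trans hs.1.le, hs.2⟩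
    simp only [singularDir, indicator_of_mem hs, cutFamily_eq hs', indicator_of_mem hs', hessTerm,
      shiftedProcess]
  · simp only [singularDir, indicator_of_notMem hs, map_zero, Finset.sum_const_zero]

end TimeIntegrals

theorem IsVolterraIntegral.expBounded {Ω : Type*} {mΩ : MeasurableSpace Ω} {P : Measure Ω}
    [IsProbabilityMeasure P] {𝓕 : Filtration ℝ≥0 mΩ} {d m : ℕ} {Tb t b : ℝ}
    {W : ℝ≥0 → Ω → EuclideanSpace ℝ (Fin m)} {K : ℝ → ℝ → Matrix (Fin d) (Fin m) ℝ}
    {J : ℝ → Ω → EuclideanSpace ℝ (Fin d)} (hJ : IsVolterraIntegral P W K Tb t b J)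
    (hW : IsBrownianMotion P 𝓕 W) (hK : IsVolterraKernel Tb K) (ht : 0 ≤ t) : ExpBounded P J :=
  ⟨hJ.measurable_uncurry, hJ.exists_exp_moment hW hK ht, hJ.exists_norm_le⟩

end VolDeriv

/-! ### Assembly of the derivative formulae. -/

theorem mainTheorem4 {Ω : Type*} {mΩ : MeasurableSpace Ω} (P : Measure Ω) [IsProbabilityMeasure P]
    (𝓕 : Filtration ℝ≥0 mΩ) {d m : ℕ} (T Tb : ℝ) (hT : 0 < T) (hTb : T ≤ Tb)
    (W : ℝ≥0 → Ω → EuclideanSpace ℝ (Fin m)) (hW : VolDeriv.IsBrownianMotion P 𝓕 W)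
    (K : ℝ → ℝ → Matrix (Fin d) (Fin m) ℝ) (hK : VolDeriv.IsVolterraKernel Tb K)
    (hK' : VolDeriv.KernelAssumption K)
    (φ : ℝ → ℝ) (hφ : VolDeriv.CPoly 3 φ)
    (f : ℝ → EuclideanSpace ℝ (Fin d) → ℝ)
    (hf_meas : Measurable (fun p : ℝ × EuclideanSpace ℝ (Fin d) => f p.1 p.2))
    (hf : VolDeriv.CExp 3 (VolDeriv.timeSupport Tb f) f)
    (J : ℝ → ℝ → ℝ → Ω → EuclideanSpace ℝ (Fin d))
    (hJ : ∀ t b : ℝ, 0 ≤ t → t ≤ b → b ≤ Tb → VolDeriv.IsVolterraIntegral P W K Tb t b (J t b))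
    (t : ℝ) (ht : t ∈ Icc 0 T)
    (ω : ℝ → EuclideanSpace ℝ (Fin d)) (hω : ContinuousOn ω (Icc 0 Tb)) :
    -- the first and second Fréchet derivatives of `u(t,·)` exist
    (∀ η : C(Icc t Tb, EuclideanSpace ℝ (Fin d)),
      VolDeriv.PathDifferentiableAt t Tb (VolDeriv.value P f φ J T Tb t)
        (VolDeriv.perturb ω η)) ∧
    VolDeriv.PathDifferentiableAt t Tb
      (VolDeriv.pathDeriv t Tb (VolDeriv.value P f φ J T Tb t)) ω ∧
    -- the time integrals in the formulae converge
    (∀ᵐ w ∂P, (∀ j : Fin m,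
        IntervalIntegrable (VolDeriv.gradTerm K f J Tb t ω j w) volume t Tb) ∧
      IntervalIntegrable (VolDeriv.hessTerm K f J Tb t ω w) volume t Tb) ∧
    -- first derivative in the singular direction, column by column
    (∀ j : Fin m,
      Integrable (fun w => deriv φ (VolDeriv.payoffVar P 𝓕 f J T Tb t ω w) *
        VolDeriv.gradInt K f J Tb t ω j w) P ∧
      Tendsto (fun δ : ℝ => VolDeriv.pathDeriv t Tb (VolDeriv.value P f φ J T Tb t) ω
          (VolDeriv.truncCol K Tb t δ j)) (𝓝[>] 0)
        (𝓝 (∫ w, deriv φ (VolDeriv.payoffVar P 𝓕 f J T Tb t ω w) *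
          VolDeriv.gradInt K f J Tb t ω j w ∂P))) ∧
    -- second derivative in the singular direction
    (∀ j : Fin m, Integrable (VolDeriv.gradInt K f J Tb t ω j) P) ∧
    Integrable (fun w => iteratedDeriv 2 φ (VolDeriv.payoffVar P 𝓕 f J T Tb t ω w) *
      ∑ j : Fin m, ((P[VolDeriv.gradInt K f J Tb t ω j | 𝓕 T.toNNReal]) w) ^ 2) P ∧
    Integrable (fun w => deriv φ (VolDeriv.payoffVar P 𝓕 f J T Tb t ω w) *
      VolDeriv.hessInt K f J Tb t ω w) P ∧
    Tendsto (fun δ : ℝ => ∑ j : Fin m,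
        VolDeriv.pathDeriv t Tb (VolDeriv.pathDeriv t Tb (VolDeriv.value P f φ J T Tb t)) ω
          (VolDeriv.truncCol K Tb t δ j) (VolDeriv.truncCol K Tb t δ j)) (𝓝[>] 0)
      (𝓝 ((∫ w, iteratedDeriv 2 φ (VolDeriv.payoffVar P 𝓕 f J T Tb t ω w) *
            ∑ j : Fin m, ((P[VolDeriv.gradInt K f J Tb t ω j | 𝓕 T.toNNReal]) w) ^ 2 ∂P) +
          ∫ w, deriv φ (VolDeriv.payoffVar P 𝓕 f J T Tb t ω w) *
            VolDeriv.hessInt K f J Tb t ω w ∂P)) ∧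
    -- if `f` vanishes after `T`, the inner conditional expectation can be dropped
    ((∀ s ∈ Ioc T Tb, ∀ x, f s x = 0) →
      Integrable (fun w => iteratedDeriv 2 φ (VolDeriv.payoffVar P 𝓕 f J T Tb t ω w) *
        ∑ j : Fin m, (VolDeriv.gradInt K f J Tb t ω j w) ^ 2) P ∧
      Tendsto (fun δ : ℝ => ∑ j : Fin m,
          VolDeriv.pathDeriv t Tb (VolDeriv.pathDeriv t Tb (VolDeriv.value P f φ J T Tb t)) ω
            (VolDeriv.truncCol K Tb t δ j) (VolDeriv.truncCol K Tb t δ j)) (𝓝[>] 0)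
        (𝓝 ((∫ w, iteratedDeriv 2 φ (VolDeriv.payoffVar P 𝓕 f J T Tb t ω w) *
              ∑ j : Fin m, (VolDeriv.gradInt K f J Tb t ω j w) ^ 2 ∂P) +
            ∫ w, deriv φ (VolDeriv.payoffVar P 𝓕 f J T Tb t ω w) *
              VolDeriv.hessInt K f J Tb t ω w ∂P))) := by
  obtain ⟨C, κ, -, hκ, hg⟩ := hf.exists_taylorFamily hf_meas
  obtain ⟨A, n, hφ'⟩ := hφ.exists_polyBounded
  have htb : t ≤ Tb := ht.2.trans hTb
  have hJX := hJ t T ht.1 ht.2 hTb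
  have hJZ := hJ t Tb ht.1 htb le_rfl
  have hJY := hJ T Tb hT.le hTb le_rfl
  have eJ := hJX.expBounded hW hK ht.1
  have eY := hJY.expBounded hW hK hT.le
  obtain ⟨D, hD0, hD⟩ := eY.moment κ hκ
  -- The averaged derivatives of f act as derivatives of the averaged f.
  have hG := hg.average hg.nonneg hκ hD0 eY.measurable hD
  have hI0 : ∀ s < T, ∀ w, J T Tb s w = 0 := fun s hs w =>
    hJY.zero_off s (fun h => absurd h.1 (not_le.2 hs)) w
  -- the path, cut off outside `[0,Tb]`
  let y : ℝ → EuclideanSpace ℝ (Fin d) := (Icc 0 Tb).indicator ω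
  have hym : Measurable y := by
    classical
    rw [show y = (Icc 0 Tb).piecewise ω 0 from (piecewise_eq_indicator ..).symm]
    exact hω.measurable_piecewise continuousOn_const measurableSet_Icc
  obtain ⟨R, hR⟩ : ∃ R, ∀ s, ‖y s‖ ≤ R := by
    obtain ⟨R, hR⟩ := isCompact_Icc.exists_bound_of_continuousOn hω
    refine ⟨max R 0, fun s => ?_⟩
    by_cases hs : s ∈ Icc 0 Tb
    · simpa only [y, indicator_of_mem hs] using (hR s hs).trans (le_max_left R 0)
    · simp [y, indicator_of_notMem hs]
  set μ : Measure ℝ := volume.restrict (Ioc 0 Tb) with hμ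
  have hωy : ∀ᵐ s ∂μ, ω s = y s := by
    refine (ae_restrict_iff' measurableSet_Ioc).2 (ae_of_all _ fun s hs => ?_)
    simp only [y, indicator_of_mem (Ioc_subset_Icc_self hs)]
  have eX := eJ.add_path hym hR
  have eZ := (hJZ.expBounded hW hK ht.1).add_path hym hR
  set X : ℝ → Ω → EuclideanSpace ℝ (Fin d) := fun s w => y s + J t T s w with hXdef
  set Z : ℝ → Ω → EuclideanSpace ℝ (Fin d) := fun s w => y s + J t Tb s w with hZdef
  -- derivatives
  have hd1 := VolDeriv.value_differentiable (t := t) hφ' hG hκ eJ hT.le hTb hI0 hym hR hωy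
  have hd2 := VolDeriv.value_differentiable_two (t := t) hφ' hG hκ eJ hT.le hTb hI0 hym hR hωy
  -- conditional expectations
  have hm : 𝓕 T.toNNReal ≤ mΩ := 𝓕.le _
  have hXm : ∀ s, AEStronglyMeasurable[𝓕 T.toNNReal] (X s) P := fun s =>
    aestronglyMeasurable_const.add (hJX.aestronglyMeasurable hW hT.le s)
  have hYi := fun s => hJY.indep hW hT.le s
  have hXYZ : ∀ s, ∀ᵐ w ∂P, Z s w = X s w + J T Tb s w := fun s => by
    filter_upwards [VolDeriv.volterraIntegral_split hW hK ht.2 hJZ hJX hJY s] with w hw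
    simp only [hXdef, hZdef, hw, add_assoc]
  set V := VolDeriv.payoffVar P 𝓕 f J T Tb t ω with hVdef
  have hV : StronglyMeasurable[𝓕 T.toNNReal] V := stronglyMeasurable_condExp
  -- The payoff variable is the argument of φ in the value, because conditioning on 𝓕_T averages out
  -- exactly the noise after `T`.
  have hVG : V =ᵐ[P] fun w => ∫ s, VolDeriv.average P (J T Tb) (VolDeriv.cutFamily Tb f) s
      (X s w) ∂μ := by
    refine EventuallyEq.trans (condExp_congr_ae (ae_of_all _ fun w => ?_))
      (VolDeriv.condExp_integral_comp hm eX eY eZ hXm hYi hXYZ hg.weighted₀ hκ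
        (integrable_const C))
    simp only
    rw [intervalIntegral.integral_of_le (hT.le.trans hTb)]
    refine setIntegral_congr_fun measurableSet_Ioc fun s hs => ?_
    have hs' := Ioc_subset_Icc_self hs
    simp only [VolDeriv.cutFamily_eq hs', VolDeriv.shiftedProcess, hZdef, y, indicator_of_mem hs']
  -- the singular directions
  obtain ⟨α, hα0, hα, hα2, hkα, hkδ⟩ := hK'.exists_bound ht.1 htb
  replace hα : Integrable α μ := hα.restrict
  replace hα2 : Integrable (fun s => α s * α s) μ := hα2.restrict
  let k : Fin m → ℝ → EuclideanSpace ℝ (Fin d) := VolDeriv.singularDir K t Tb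
  have hkm : ∀ j, Measurable (k j) := fun j => VolDeriv.measurable_singularDir hK j
  have hw1 := fun j => hg.weighted₁ (hkm j) (hkα j)
  have hw2 := fun j => hg.weighted₂ (hkm j) (hkα j) (hkm j) (hkα j)
  have hgi : ∀ j w, VolDeriv.gradInt K f J Tb t ω j w =
      ∫ s, fderiv ℝ (VolDeriv.cutFamily Tb f s) (Z s w) (k j s) ∂μ := fun j w =>
    VolDeriv.intervalIntegral_eq_of_indicator ht.1 htb
      (VolDeriv.fderiv_singularDir_eq_indicator ht.1 j w)
  have hpi1 := fun j w => (hw1 j).integrable_path eZ (hα.const_mul C) hκ w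
  have hpi2 := fun j w => (hw2 j).integrable_path eZ (hα2.const_mul C) hκ w
  have hhi : ∀ w, VolDeriv.hessInt K f J Tb t ω w =
      ∑ j, ∫ s, fderiv ℝ (fderiv ℝ (VolDeriv.cutFamily Tb f s)) (Z s w) (k j s) (k j s) ∂μ :=
    fun w => by
      rw [← integral_finsetSum _ fun j _ => hpi2 j w]
      exact VolDeriv.intervalIntegral_eq_of_indicator ht.1 htb
        (VolDeriv.sum_fderiv_singularDir_eq_indicator ht.1 w)
  have hgi' : ∀ j, VolDeriv.gradInt K f J Tb t ω j = fun w =>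
      ∫ s, fderiv ℝ (VolDeriv.cutFamily Tb f s) (Z s w) (k j s) ∂μ := fun j => funext (hgi j)
  have hci : ∀ j, P[VolDeriv.gradInt K f J Tb t ω j | 𝓕 T.toNNReal] =ᵐ[P] fun w =>
      ∫ s, VolDeriv.average P (J T Tb) (fun s => fderiv ℝ (VolDeriv.cutFamily Tb f s)) s (X s w)
        (k j s) ∂μ := fun j => by
    rw [hgi' j]
    refine (VolDeriv.condExp_integral_comp hm eX eY eZ hXm hYi hXYZ (hw1 j) hκ
      (hα.const_mul C)).trans (ae_of_all _ fun w => ?_)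
    simp only [hg.average_apply₁ hκ eY]
  have hgrad : ∀ j, Integrable (fun w => deriv φ (V w) * VolDeriv.gradInt K f J Tb t ω j w) P ∧
      ∫ w, deriv φ (V w) * VolDeriv.gradInt K f J Tb t ω j w ∂P =
        ∫ w, VolDeriv.firstVariation μ (VolDeriv.average P (J T Tb) (VolDeriv.cutFamily Tb f))
          (VolDeriv.average P (J T Tb) fun s => fderiv ℝ (VolDeriv.cutFamily Tb f s)) φ X (k j) w
          ∂P := fun j => by
    rw [hgi' j]
    refine ⟨VolDeriv.integrable_deriv_mul_integral eX eZ (hw1 j) hκ (hα.const_mul C) hφ' hG hVG, ?_⟩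
    rw [VolDeriv.integral_deriv_mul_integral hm eX eY eZ hXm hYi hXYZ (hw1 j) hκ (hα.const_mul C)
      hφ' hG hV hVG]
    simp only [hg.average_apply₁ hκ eY]
    rfl
  let G : Ω → ℝ := fun w => ∫ s, VolDeriv.average P (J T Tb) (VolDeriv.cutFamily Tb f) s (X s w) ∂μ
  let G₁ : Fin m → Ω → ℝ := fun j w => ∫ s, VolDeriv.average P (J T Tb)
    (fun s => fderiv ℝ (VolDeriv.cutFamily Tb f s)) s (X s w) (k j s) ∂μ
  let G₂ : Fin m → Ω → ℝ := fun j w => ∫ s, VolDeriv.average P (J T Tb)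
    (fun s => fderiv ℝ (fderiv ℝ (VolDeriv.cutFamily Tb f s))) s (X s w) (k j s) (k j s) ∂μ
  have hv1 := fun j => hG.weighted₁ (hkm j) (hkα j)
  have hv2 := fun j => hG.weighted₂ (hkm j) (hkα j) (hkm j) (hkα j)
  have hq1 : ∀ j, Integrable (fun w => iteratedDeriv 2 φ (G w) * (G₁ j w * G₁ j w)) P := fun j => by
    have h1 := ((hv1 j).integrable_integral eX (hα.const_mul _) hκ).aestronglyMeasurable
    refine hφ'.integrable_mul (j := 2) (by norm_num) hG hκ eX eX (hα.const_mul _)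
      (hv1 j).weight_nonneg hκ (h1.mul h1) fun w => ?_
    have h2 := (hv1 j).abs_integral_le eX (hα.const_mul _) hκ w
    rw [abs_mul, sq]
    exact mul_le_mul h2 h2 (abs_nonneg _) ((abs_nonneg _).trans h2)
  have hq2 : ∀ j, Integrable (fun w => deriv φ (G w) * G₂ j w) P := fun j =>
    VolDeriv.integrable_deriv_mul_integral eX eX (hv2 j) hκ (hα2.const_mul _) hφ' hG
      (EventuallyEq.refl _ _)
  have hhess : ∀ j, Integrable (fun w => deriv φ (V w) *
        ∫ s, fderiv ℝ (fderiv ℝ (VolDeriv.cutFamily Tb f s)) (Z s w) (k j s) (k j s) ∂μ) P ∧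
      ∫ w, deriv φ (V w) *
        ∫ s, fderiv ℝ (fderiv ℝ (VolDeriv.cutFamily Tb f s)) (Z s w) (k j s) (k j s) ∂μ ∂P =
        ∫ w, deriv φ (G w) * G₂ j w ∂P := fun j => by
    refine ⟨VolDeriv.integrable_deriv_mul_integral eX eZ (hw2 j) hκ (hα2.const_mul C) hφ' hG hVG,
      ?_⟩
    rw [VolDeriv.integral_deriv_mul_integral hm eX eY eZ hXm hYi hXYZ (hw2 j) hκ (hα2.const_mul C)
      hφ' hG hV hVG]
    simp only [hg.average_apply₂ hκ eY]
    rfl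
  have hsum : (fun w => deriv φ (V w) * VolDeriv.hessInt K f J Tb t ω w) = fun w =>
      ∑ j, deriv φ (V w) *
        ∫ s, fderiv ℝ (fderiv ℝ (VolDeriv.cutFamily Tb f s)) (Z s w) (k j s) (k j s) ∂μ := by
    funext w
    rw [hhi, Finset.mul_sum]
  -- In the φ'' term the averaged gradient integral is squared, so the conditional expectation has
  -- to be taken before the square.
  have hsq : (fun w => iteratedDeriv 2 φ (V w) *
      ∑ j : Fin m, ((P[VolDeriv.gradInt K f J Tb t ω j | 𝓕 T.toNNReal]) w) ^ 2) =ᵐ[P] fun w =>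
      ∑ j, iteratedDeriv 2 φ (G w) * (G₁ j w * G₁ j w) := by
    filter_upwards [hVG, ae_all_iff.2 hci] with w hw hw'
    rw [hw, Finset.mul_sum]
    refine Finset.sum_congr rfl fun j _ => ?_
    rw [hw' j, sq]
  have hlim : Tendsto (fun δ : ℝ => ∑ j : Fin m,
        VolDeriv.pathDeriv t Tb (VolDeriv.pathDeriv t Tb (VolDeriv.value P f φ J T Tb t)) ω
          (VolDeriv.truncCol K Tb t δ j) (VolDeriv.truncCol K Tb t δ j)) (𝓝[>] 0)
      (𝓝 ((∫ w, iteratedDeriv 2 φ (V w) *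
            ∑ j : Fin m, ((P[VolDeriv.gradInt K f J Tb t ω j | 𝓕 T.toNNReal]) w) ^ 2 ∂P) +
          ∫ w, deriv φ (V w) * VolDeriv.hessInt K f J Tb t ω w ∂P)) := by
    rw [integral_congr_ae hsq, hsum, integral_finsetSum _ fun j _ => hq1 j,
      integral_finsetSum _ fun j _ => (hhess j).1, ← Finset.sum_add_distrib]
    refine tendsto_finsetSum _ fun j _ => ?_
    rw [(hhess j).2, ← integral_add (hq1 j) (hq2 j)]
    simp only [hd2.2]
    exact VolDeriv.tendsto_integral_secondVariation hφ' hG hκ eX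
      (fun δ => VolDeriv.measurable_extendDir _) (hkδ j)
      (VolDeriv.tendsto_extendDir_truncCol hK' ht.1 j) hα0 hα hα2
  have hsqi : Integrable (fun w => iteratedDeriv 2 φ (V w) *
      ∑ j : Fin m, ((P[VolDeriv.gradInt K f J Tb t ω j | 𝓕 T.toNNReal]) w) ^ 2) P :=
    (integrable_finsetSum _ fun j _ => hq1 j).congr hsq.symm
  refine ⟨fun η => ?_, hd2.1, ae_of_all _ fun w => ⟨fun j => ?_, ?_⟩, fun j => ⟨(hgrad j).1, ?_⟩,
    fun j => ?_, hsqi, ?_, hlim, fun hf0 => ?_⟩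
  · exact (VolDeriv.value_differentiable (t := t) hφ' hG hκ eJ hT.le hTb hI0
      ((VolDeriv.measurable_extendDir η).add hym)
      (fun s => (norm_add_le _ _).trans (add_le_add (VolDeriv.norm_extendDir_le η s) (hR s)))
      (VolDeriv.ae_perturb_eq hωy η)).1
  · exact VolDeriv.intervalIntegrable_of_indicator ht.1 htb
      (VolDeriv.fderiv_singularDir_eq_indicator ht.1 j w) (hpi1 j w)
  · exact VolDeriv.intervalIntegrable_of_indicator ht.1 htb
      (VolDeriv.sum_fderiv_singularDir_eq_indicator ht.1 w)
      (integrable_finsetSum _ fun j _ => hpi2 j w)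
  · rw [(hgrad j).2]
    simp only [hd1.2]
    exact VolDeriv.tendsto_integral_firstVariation hφ' hG hκ eX
      (fun δ => VolDeriv.measurable_extendDir _) (hkδ j)
      (VolDeriv.tendsto_extendDir_truncCol hK' ht.1 j) hα0 hα
  · rw [hgi' j]
    exact (hw1 j).integrable_integral eZ (hα.const_mul C) hκ
  · rw [hsum]
    exact integrable_finsetSum _ fun j _ => (hhess j).1
  -- Before `T` there is no later noise, after `T` the gradient of f is zero, and time `T` is
  -- negligible; the gradient integral is therefore already known at time `T`.
  · have hself : ∀ j, P[VolDeriv.gradInt K f J Tb t ω j | 𝓕 T.toNNReal] =ᵐ[P]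
        VolDeriv.gradInt K f J Tb t ω j := fun j => by
      rw [hgi' j]
      refine VolDeriv.condExp_integral_eq_self (Y := J T Tb) hm eZ hXm hXYZ (hw1 j) hκ
        (hα.const_mul C) ?_
      refine (ae_restrict_iff' measurableSet_Ioc).2 ?_
      filter_upwards [Measure.ae_ne volume T] with s hsT hs
      rcases lt_or_gt_of_ne hsT with h | h
      · exact Or.inl (hI0 s h)
      · right
        have h0 : f s = 0 := funext fun x => hf0 s ⟨h, hs.2⟩ x
        funext θ
        simp [VolDeriv.cutFamily_eq (Ioc_subset_Icc_self hs), h0]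
    have hrep : (fun w => iteratedDeriv 2 φ (V w) *
        ∑ j : Fin m, ((P[VolDeriv.gradInt K f J Tb t ω j | 𝓕 T.toNNReal]) w) ^ 2) =ᵐ[P] fun w =>
        iteratedDeriv 2 φ (V w) * ∑ j : Fin m, (VolDeriv.gradInt K f J Tb t ω j w) ^ 2 := by
      filter_upwards [ae_all_iff.2 hself] with w hw
      simp only [hw]
    refine ⟨hsqi.congr hrep, ?_⟩
    rw [← integral_congr_ae hrep]
    exact hlim
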